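/- Let $\alpha_1,\alpha_2,\alpha_3,\alpha_4=\beta$ be Hermitian $4\times4$ matrices with $\alpha_j\alpha_k+\alpha_k\alpha_j=2\delta_{jk}I_4$, and let $V\in C_c^\infty(\mathbb R^3;M_4(\mathbb C))$ be Hermitian-valued. Let $$D=-i\sum_{j=1}^3\alpha_j\partial_j+\beta+V\qquad\text{on } L^2(\mathbb R^3;\mathbb C^4),\text{ with domain } H^1(\mathbb R^3;\mathbb C^4).$$ Let $\Sigma=\{(\lambda,\kappa)\in\mathbb C^2:\kappa^2=\lambda^2-1\}$ be the Riemann surface of $\sqrt{\lambda^2-1}$, with physical sheet $\operatorname{Im}\kappa>0$ and global coordinate $w=\lambda+\kappa\in\mathbb C\setminus\{0\}$, so that $\lambda=(w+w^{-1})/2$. For every $\chi\in C_c^\infty(\mathbb R^3)$ with $\chi V=V$, the cut-off resolvent $\chi(D-\lambda)^{-1}\chi$, as a bounded operator on $L^2(\mathbb R^3;\mathbb C^4)$, continues meromorphically from the physical sheet to all of $\Sigma$. The poles on $\Sigma$ of the continuation $R(\lambda)$ are called resonances (so the poles at eigenvalues of $D$ on the physical sheet are included). The multiplicity of a resonance with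 $\lambda\ne\pm1$ is $\operatorname{rank}\oint R(\lambda)\,d\lambda$ over a small circle around it; for a resonance at a branch point $\lambda=\pm1$ it is the dimension of the span of the ranges of all coefficients of the principal part of $R$ in the coordinate $w$. Let $N(r)$ be the number of resonances with $|\lambda|\le r$, counted with multiplicity. Then there is a constant $C>0$, depending only on $V$ and the matrices $\alpha_j$ (not on $\chi$), such that $$N(r)\le C\,r^3\qquad\text{for all } r\ge 1 .$$ -/

import Mathlib

open MeasureTheory Topology Filter
open scoped ENNReal ContDiff SchwartzMap LineDeriv

noncomputable section

namespace DiracResonance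

/-- Physical space `ℝ³`. -/
abbrev Space : Type := EuclideanSpace ℝ (Fin 3)

/-- Spinor space `ℂ⁴`. -/
abbrev Spinor : Type := EuclideanSpace ℂ (Fin 4)

/-- The Hilbert space `L²(ℝ³; ℂ⁴)`. -/
abbrev L2 : Type := Lp Spinor 2 (volume : Measure Space)

/-- Dirac matrices `α₁, α₂, α₃, α₄ = β` (indexed here by `0, 1, 2, 3`): Hermitian `4 × 4` matrices
with `αⱼ αₖ + αₖ αⱼ = 2 δⱼₖ I`. -/
structure IsDiracMatrices (α : Fin 4 → Matrix (Fin 4) (Fin 4) ℂ) : Prop where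
  isHermitian : ∀ j, (α j).IsHermitian
  anticomm : ∀ j k, α j * α k + α k * α j = if j = k then (2 : ℂ) • 1 else 0

/-- Potentials: smooth compactly supported functions with values in the Hermitian matrices. -/
structure IsPotential (V : Space → Matrix (Fin 4) (Fin 4) ℂ) : Prop where
  smooth : ∀ i j, ContDiff ℝ ∞ (fun x => V x i j)
  hasCompactSupport : HasCompactSupport V
  isHermitian : ∀ x, (V x).IsHermitian

/-- `g = ∂ⱼ u` in the sense of distributions, for `u, g ∈ L²(ℝ³; ℂ⁴)`. -/
def IsWeakPartial (j : Fin 3) (u g : L2) : Prop :=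
  ∂_{(EuclideanSpace.single j (1 : ℝ) : Space)} (u : 𝓢'(Space, Spinor)) = (g : 𝓢'(Space, Spinor))

/-- The graph of the Dirac operator `D = -i ∑ⱼ αⱼ ∂ⱼ + β + V` with domain `H¹(ℝ³; ℂ⁴)`:
all weak partial derivatives of `u ∈ L²` are in `L²`, and `D u = f`. -/
def DiracGraph (α : Fin 4 → Matrix (Fin 4) (Fin 4) ℂ) (V : Space → Matrix (Fin 4) (Fin 4) ℂ)
    (u f : L2) : Prop :=
  ∃ g : Fin 3 → L2, (∀ j, IsWeakPartial j u (g j)) ∧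
    ∀ᵐ x : Space, f x =
      (-Complex.I) • (∑ j : Fin 3, Matrix.toEuclideanLin (α j.castSucc) (g j x))
        + Matrix.toEuclideanLin (α 3) (u x) + Matrix.toEuclideanLin (V x) (u x)

/-- `R = (D - z)⁻¹`: the bounded operator `R` maps `L²` into `H¹` and is a two-sided inverse of
`D - z`. Such an `R` exists exactly for `z` in the resolvent set of `D`, and is then unique. -/
def IsResolvent (α : Fin 4 → Matrix (Fin 4) (Fin 4) ℂ) (V : Space → Matrix (Fin 4) (Fin 4) ℂ)
    (z : ℂ) (R : L2 →L[ℂ] L2) : Prop :=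
  (∀ f : L2, DiracGraph α V (R f) (f + z • R f)) ∧
    ∀ u f : L2, DiracGraph α V u f → R (f - z • u) = u

/-- Cut-off functions `χ ∈ C_c^∞(ℝ³)` with `χ V = V`. -/
structure Cutoff (V : Space → Matrix (Fin 4) (Fin 4) ℂ) where
  /-- The underlying function. -/
  toFun : Space → ℂ
  smooth : ContDiff ℝ ∞ toFun
  hasCompactSupport : HasCompactSupport toFun
  smul_eq : ∀ x, toFun x • V x = V x

/-- Multiplication by `χ` as a bounded operator on `L²(ℝ³; ℂ⁴)`. -/
def Cutoff.mul {V : Space → Matrix (Fin 4) (Fin 4) ℂ} (χ : Cutoff V) : L2 →L[ℂ] L2 :=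
  (ContinuousLinearMap.lsmul ℂ ℂ).holderL (volume : Measure Space) ∞ 2 2
    ((χ.smooth.continuous.memLp_top_of_hasCompactSupport χ.hasCompactSupport volume).toLp χ.toFun)

/-- The spectral parameter `λ` as a function on the Riemann surface of `κ = √(λ² - 1)`. That
surface `{(λ, κ) : κ² = λ² - 1}` is `ℂ \ {0}`, with global coordinate `w = λ + κ`, so that
`λ = (w + w⁻¹) / 2` and `κ = (w - w⁻¹) / 2`. The physical sheet `Im κ > 0` is the half-plane
`Im w > 0`, the second sheet `Im κ < 0` is `Im w < 0`, the two sides of the cuts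
`(-∞, -1] ∪ [1, ∞)` are the real `w ≠ 0`, and the branch points `λ = ±1` are `w = ±1`. -/
def spectralParam (w : ℂ) : ℂ := (w + w⁻¹) / 2

/-- `F` is the meromorphic continuation of the cut-off resolvent `χ (D - λ)⁻¹ χ` from the physical
sheet to the whole Riemann surface of `√(λ² - 1)`. -/
def IsContinuation (α : Fin 4 → Matrix (Fin 4) (Fin 4) ℂ)
    (V : Space → Matrix (Fin 4) (Fin 4) ℂ) (χ : Cutoff V) (F : ℂ → (L2 →L[ℂ] L2)) : Prop :=
  MeromorphicOn F {w | w ≠ 0} ∧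
    ∀ w : ℂ, 0 < w.im → ∀ R : L2 →L[ℂ] L2, IsResolvent α V (spectralParam w) R →
      F w = χ.mul ∘L R ∘L χ.mul

/-- Resonances: poles on the Riemann surface of the continued cut-off resolvent. -/
def IsResonance (F : ℂ → (L2 →L[ℂ] L2)) (w : ℂ) : Prop :=
  w ≠ 0 ∧ meromorphicOrderAt F w < 0

/-- `∮ G(w) dw` over sufficiently small circles around `w₀` (for `G` meromorphic at `w₀`, the
integral does not depend on the radius once this is small). -/
def smallLoopIntegral (G : ℂ → (L2 →L[ℂ] L2)) (w₀ : ℂ) : L2 →L[ℂ] L2 :=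
  limUnder (𝓝[>] (0 : ℝ)) fun ε => ∮ w in C(w₀, ε), G w

/-- The multiplicity of a resonance. Away from the branch points `λ = ±1` it is the rank of
`∮ R(λ) dλ` over a small circle, where `dλ = λ'(w) dw` in the coordinate `w`. At a branch point
`λ` is not a local coordinate, and the multiplicity is the dimension of the span of the ranges of
all coefficients of the principal part in the local coordinate `w`. -/
def multiplicity (F : ℂ → (L2 →L[ℂ] L2)) (w₀ : ℂ) : ℕ∞ :=
  open Classical in
  if w₀ = 1 ∨ w₀ = -1 then
    Cardinal.toENat (Module.rank ℂ
      ↥(⨆ k : ℕ, LinearMap.range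
        (smallLoopIntegral (fun w => (w - w₀) ^ k • F w) w₀ : L2 →ₗ[ℂ] L2)))
  else
    Cardinal.toENat (LinearMap.rank
      (smallLoopIntegral (fun w => deriv spectralParam w • F w) w₀ : L2 →ₗ[ℂ] L2))

/-- `N(r)`: the number of resonances with `|λ| ≤ r`, counted with multiplicity. -/
def countingFunction (F : ℂ → (L2 →L[ℂ] L2)) (r : ℝ) : ℝ≥0∞ :=
  ∑' w : {w : ℂ // IsResonance F w ∧ ‖spectralParam w‖ ≤ r}, (multiplicity F w : ℝ≥0∞)

end DiracResonance

end

/-! The proof is a Birman–Schwinger argument in which the Fredholm determinant is replaced by a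
finite-dimensional one.

Analytic continuation. In dimension three Huygens' principle is sharp. Hence, between functions
supported in a ball of radius `L`, the free resolvent at `λ` equals the truncated wave integral `∫₀ᵀ
e^{iκt} sin(t√-Δ)/√-Δ dt` times `D₀ + λ`, where `D₀` is the free Dirac operator and `T > 2L`
(`inner_freeResolvent_eq`). The truncated integral is analytic in `w ≠ 0` in operator norm. So `K(w)
= 1_L P(w) V` (`birmanOp`) is analytic on the whole surface, and the cut-off resolvent becomes `χP'χ
- χP'V (1 + K)⁻¹ 1_L P'χ`, with `P'` truncated at a time adapted to `χ`
(`resolvent_continuation_eq`). Poles come only from `(1 + K)⁻¹`, and `K` does not involve `χ`; this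
is why the constant does not depend on `χ`.

Reduction to a determinant. Let `E` be the span of the polynomial spinors on the ball of degree less
than `M` in each coordinate, of dimension at most `4M³`. If `M ≥ AR`, the component of `K`
orthogonal to `E` has norm at most `1/2` for `|κ| ≤ R` (`norm_residualPart_cutPropagator_le`): high
frequencies are damped by the symbol, and functions orthogonal to polynomials have exponentially
small Fourier transform at low ones. The inversion of `1 + K` then reduces to that of a Schur
complement on `E`. The polar part of the continuation has values in a space of dimension at most the
order of vanishing of the determinant of that complement (`exists_polarIn_of_schurComplement`),
which bounds both kinds of multiplicity.

Growth of the determinant. For `Im κ ≥ 0`, `K` is bounded uniformly, so Hadamard's inequality gives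
`e^{O(M³)}`. For `Im κ ≤ 0` compare with `-κ`, which has the same `λ`: the difference is a
superposition over the unit sphere of plane waves of frequency `κθ`. It sees a function only through
its transform on a sphere, and up to exponentially small errors through `O(M²)` spherical polynomial
moments. Thus `K` is bounded off `8M²` directions and is `e^{O(R)}` on those, so with `M` of order
`R` the determinant is `e^{O(M³ + R M²)} = e^{O(R³)}` (`exists_birmanDet_le`). Using `e^{O(R)}` in
all `4M³` directions would only give `R⁴`.

Counting. At `w = it` with `t + 1/t` large, `‖K‖ ≤ 1/2` and the determinant is at least `3^{-4M³}`.
Jensen's inequality in the variable `log w` bounds its zeros in an annulus around `|w| = t` by `C (t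
+ 1/t)³` (`exists_sum_order_le`). Summing over dyadic annuli towards `w = ∞` and towards `w = 0`
gives a geometric series of ratio `8`, hence the bound `r³`. -/

noncomputable section

namespace DiracResonance

/-! ### Hadamard's inequality and determinants of endomorphisms -/

section Hadamard

variable {E : Type*} [NormedAddCommGroup E] [InnerProductSpace ℂ E] [FiniteDimensional ℂ E]

/-- Hadamard's inequality for the determinant of an endomorphism. -/
theorem norm_det_le_prod_norm {ι : Type*} [Fintype ι] (b : OrthonormalBasis ι ℂ E)
    (m : E →ₗ[ℂ] E) : ‖LinearMap.det m‖ ≤ ∏ i, ‖m (b i)‖ := by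
  classical
  let e := Fintype.equivFin ι
  let b' := b.reindex e
  suffices h : ‖LinearMap.det m‖ ≤ ∏ i, ‖m (b' i)‖ by
    refine h.trans_eq ?_
    rw [← e.prod_comp]
    simp [b']
  have hc : Module.finrank ℂ E = Fintype.card (Fin (Fintype.card ι)) := by
    rw [Module.finrank_eq_card_basis b'.toBasis]
  set f : Fin (Fintype.card ι) → E := fun i => m (b' i)
  -- Gram–Schmidt applied to the images makes their matrix triangular, so the determinant is a
  -- product of diagonal inner products; changing orthonormal basis costs a factor of modulus one.
  set g := InnerProductSpace.gramSchmidtOrthonormalBasis (𝕜 := ℂ) hc f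
  have h1 : ‖LinearMap.det m‖ = ‖g.toBasis.det f‖ := by
    have h2 := g.toBasis.det_comp m b'
    have h3 : (m ∘ b' : Fin (Fintype.card ι) → E) = f := rfl
    rw [h3] at h2
    have h4 := OrthonormalBasis.det_to_matrix_orthonormalBasis g b'
    rw [h2, norm_mul, h4, mul_one]
  rw [h1, InnerProductSpace.gramSchmidtOrthonormalBasis_det, norm_prod]
  refine Finset.prod_le_prod (fun _ _ => norm_nonneg _) fun i _ => ?_
  refine (norm_inner_le_norm _ _).trans ?_
  rw [g.orthonormal.1 i, one_mul]

/-- A determinant bound for an endomorphism which is better bounded on a large subspace. -/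
theorem norm_det_le_of_le_on (m : E →ₗ[ℂ] E) (G : Submodule ℂ E) {a c : ℝ} (ha : 1 ≤ a)
    (hc : 1 ≤ c) {N k : ℕ} (hN : Module.finrank ℂ E ≤ N)
    (hk : Module.finrank ℂ E ≤ Module.finrank ℂ G + k)
    (hG : ∀ x ∈ G, ‖m x‖ ≤ a * ‖x‖) (hm : ∀ x, ‖m x‖ ≤ c * ‖x‖) :
    ‖LinearMap.det m‖ ≤ a ^ N * c ^ k := by
  classical
  -- Hadamard is applied in an orthonormal basis of `E` extending one of `G`: at most `N` factors
  -- are bounded by `a`, and at most `k` by `c`.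
  let b₀ := stdOrthonormalBasis ℂ G
  have ho : Orthonormal ℂ (fun i => (b₀ i : E)) :=
    b₀.orthonormal.comp_linearIsometry G.subtypeₗᵢ
  obtain ⟨u, b, hu, hb⟩ := ho.toSubtypeRange.exists_orthonormalBasis_extension
  refine (norm_det_le_prod_norm b m).trans ?_
  have hcard : u.card = Module.finrank ℂ E := by
    rw [Module.finrank_eq_card_basis b.toBasis, Fintype.card_coe]
  set v : Finset E := Finset.univ.image (fun i => (b₀ i : E)) with hv
  have hvcard : v.card = Module.finrank ℂ G := by
    rw [hv, Finset.card_image_of_injective _ ho.linearIndependent.injective]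
    simp
  have hvu : v ⊆ u := by
    intro x hx
    apply hu
    simpa [hv] using hx
  have h1 : ∏ i, ‖m (b i)‖ = ∏ x ∈ u, ‖m x‖ := by
    rw [hb, ← Finset.prod_coe_sort u (fun x => ‖m x‖)]
  have hnorm : ∀ x ∈ u, ‖x‖ = 1 := by
    intro x hx
    have := b.orthonormal.1 ⟨x, hx⟩
    rwa [hb] at this
  rw [h1, ← Finset.prod_sdiff hvu, mul_comm]
  have h2 : ∏ x ∈ v, ‖m x‖ ≤ a ^ v.card := by
    rw [← Finset.prod_const]
    refine Finset.prod_le_prod ?_ ?_ <;> intro x hx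
    · exact norm_nonneg _
    · have hxG : x ∈ G := by
        obtain ⟨i, -, rfl⟩ := Finset.mem_image.1 hx
        exact (b₀ i).2
      simpa [hnorm x (hvu hx)] using hG x hxG
  have h3 : ∏ x ∈ u \ v, ‖m x‖ ≤ c ^ (u \ v).card := by
    rw [← Finset.prod_const]
    refine Finset.prod_le_prod ?_ ?_ <;> intro x hx
    · exact norm_nonneg _
    · simpa [hnorm x (Finset.mem_sdiff.1 hx).1] using hm x
  refine mul_le_mul (h2.trans ?_) (h3.trans ?_) (Finset.prod_nonneg fun _ _ => norm_nonneg _)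
    (by positivity)
  · refine pow_le_pow_right₀ ha ?_
    rw [hvcard]
    exact (Submodule.finrank_le G).trans hN
  · refine pow_le_pow_right₀ hc ?_
    rw [Finset.card_sdiff_of_subset hvu]
    omega

end Hadamard

/-! ### Principal parts of operator-valued functions and orders of determinants -/

section PrincipalPart

variable {X Y : Type} [NormedAddCommGroup X] [NormedSpace ℂ X]
  [NormedAddCommGroup Y] [NormedSpace ℂ Y]

/-- `G` has a pole (or a regular point) at `w₀`, and all coefficients of the principal part of `G`
at `w₀` have their ranges in `W`. -/
def PolarIn (G : ℂ → Y →L[ℂ] X) (w₀ : ℂ) (W : Submodule ℂ X) : Prop :=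
  ∃ (n : ℕ) (C : ℕ → Y →L[ℂ] X) (h : ℂ → Y →L[ℂ] X), AnalyticAt ℂ h w₀ ∧
    (∀ k y, C k y ∈ W) ∧ (∀ k, n ≤ k → C k = 0) ∧
    ∀ᶠ w in 𝓝[≠] w₀, G w = ∑ k ∈ Finset.range n, ((w - w₀)⁻¹) ^ (k + 1) • C k + h w

theorem PolarIn.of_analyticAt {G : ℂ → Y →L[ℂ] X} {w₀ : ℂ} {W : Submodule ℂ X}
    (hG : AnalyticAt ℂ G w₀) : PolarIn G w₀ W :=
  ⟨0, fun _ => 0, G, hG, by simp, by simp, by simp⟩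

theorem PolarIn.congr {G G' : ℂ → Y →L[ℂ] X} {w₀ : ℂ} {W : Submodule ℂ X}
    (hG : PolarIn G w₀ W) (h : G' =ᶠ[𝓝[≠] w₀] G) : PolarIn G' w₀ W := by
  obtain ⟨n, C, h', h1, h2, h3, h4⟩ := hG
  refine ⟨n, C, h', h1, h2, h3, ?_⟩
  filter_upwards [h, h4] with w hw hw'
  rw [hw, hw']

theorem PolarIn.add {G G' : ℂ → Y →L[ℂ] X} {w₀ : ℂ} {W W' : Submodule ℂ X}
    (hG : PolarIn G w₀ W) (hG' : PolarIn G' w₀ W') :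
    PolarIn (fun w => G w + G' w) w₀ (W ⊔ W') := by
  obtain ⟨n, C, h, h1, h2, h3, h4⟩ := hG
  obtain ⟨n', C', h', h1', h2', h3', h4'⟩ := hG'
  refine ⟨max n n', fun k => C k + C' k, fun w => h w + h' w, h1.add h1', ?_, ?_, ?_⟩
  · intro k y
    exact Submodule.add_mem_sup (h2 k y) (h2' k y)
  · intro k hk
    dsimp only
    rw [h3 k (le_trans (le_max_left _ _) hk), h3' k (le_trans (le_max_right _ _) hk), add_zero]
  · filter_upwards [h4, h4'] with w hw hw'
    have e1 : ∑ k ∈ Finset.range n, ((w - w₀)⁻¹) ^ (k + 1) • C k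
        = ∑ k ∈ Finset.range (max n n'), ((w - w₀)⁻¹) ^ (k + 1) • C k := by
      refine Finset.sum_subset (Finset.range_mono (le_max_left _ _)) fun k _ hk => ?_
      rw [h3 k (by simpa using hk), smul_zero]
    have e2 : ∑ k ∈ Finset.range n', ((w - w₀)⁻¹) ^ (k + 1) • C' k
        = ∑ k ∈ Finset.range (max n n'), ((w - w₀)⁻¹) ^ (k + 1) • C' k := by
      refine Finset.sum_subset (Finset.range_mono (le_max_right _ _)) fun k _ hk => ?_
      rw [h3' k (by simpa using hk), smul_zero]
    rw [hw, hw', e1, e2]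
    simp only [smul_add, Finset.sum_add_distrib]
    abel

theorem PolarIn.mono {G : ℂ → Y →L[ℂ] X} {w₀ : ℂ} {W W' : Submodule ℂ X}
    (hG : PolarIn G w₀ W) (h : W ≤ W') : PolarIn G w₀ W' := by
  obtain ⟨n, C, h', h1, h2, h3, h4⟩ := hG
  exact ⟨n, C, h', h1, fun k y => h (h2 k y), h3, h4⟩

theorem PolarIn.meromorphicAt {G : ℂ → Y →L[ℂ] X} {w₀ : ℂ} {W : Submodule ℂ X}
    (hG : PolarIn G w₀ W) : MeromorphicAt G w₀ := by
  obtain ⟨n, C, h', h1, h2, h3, h4⟩ := hG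
  refine MeromorphicAt.congr ?_ (EventuallyEq.symm h4)
  refine MeromorphicAt.fun_add ?_ h1.meromorphicAt
  refine MeromorphicAt.fun_sum fun k _ => ?_
  refine MeromorphicAt.fun_smul ?_ (MeromorphicAt.const _ _)
  fun_prop

/-- Induction on the order of the pole: write the numerator as its value at `w₀` plus `(w - w₀)`
times its `dslope`, which is again analytic and has one pole order less in front of it. -/
theorem polarIn_top_of_meromorphicAt {G : ℂ → Y →L[ℂ] X} {w₀ : ℂ} (hG : MeromorphicAt G w₀) :
    PolarIn G w₀ ⊤ := by
  obtain ⟨n, hn⟩ := hG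
  have key : ∀ (n : ℕ) (g : ℂ → Y →L[ℂ] X), AnalyticAt ℂ g w₀ →
      PolarIn (fun w => ((w - w₀)⁻¹) ^ n • g w) w₀ ⊤ := by
    intro n
    induction n with
    | zero => intro g hg; simpa using PolarIn.of_analyticAt hg
    | succ n ih =>
      intro g hg
      obtain ⟨p, hp⟩ := hg
      have hd : AnalyticAt ℂ (dslope g w₀) w₀ := ⟨_, hp.has_fpower_series_dslope_fslope⟩
      have h1 : PolarIn (fun w => ((w - w₀)⁻¹) ^ (n + 1) • g w₀) w₀ ⊤ := by
        refine ⟨n + 1, fun k => if k = n then g w₀ else 0, fun _ => 0, analyticAt_const,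
          by simp, ?_, ?_⟩
        · intro k hk
          exact if_neg (by omega)
        · refine Eventually.of_forall fun w => ?_
          simp
      have h2 := h1.add (ih _ hd)
      rw [sup_top_eq] at h2
      refine h2.congr ?_
      filter_upwards [self_mem_nhdsWithin] with w hw
      have hw' : w - w₀ ≠ 0 := sub_ne_zero.2 hw
      have h3 : g w = g w₀ + (w - w₀) • dslope g w₀ w := by
        rw [sub_smul_dslope]; abel
      rw [h3, smul_add, smul_smul, pow_succ, mul_assoc, inv_mul_cancel₀ hw', mul_one]
  refine (key n _ hn).congr ?_
  filter_upwards [self_mem_nhdsWithin] with w hw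
  have hw' : w - w₀ ≠ 0 := sub_ne_zero.2 hw
  rw [smul_smul, ← mul_pow, inv_mul_cancel₀ hw', one_pow, one_smul]

theorem PolarIn.clm_comp {X' : Type} [NormedAddCommGroup X'] [NormedSpace ℂ X']
    {G : ℂ → Y →L[ℂ] X} {w₀ : ℂ} {W : Submodule ℂ X} (hG : PolarIn G w₀ W) (L : X →L[ℂ] X') :
    PolarIn (fun w => L ∘L G w) w₀ (LinearMap.range (L : X →ₗ[ℂ] X')) := by
  obtain ⟨n, C, h', h1, h2, h3, h4⟩ := hG
  refine ⟨n, fun k => L ∘L C k, fun w => L ∘L h' w, ?_, ?_, ?_, ?_⟩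
  · exact ((ContinuousLinearMap.compL ℂ Y X X' L).analyticAt _).comp h1
  · intro k y
    exact ⟨C k y, rfl⟩
  · intro k hk
    dsimp only
    rw [h3 k hk, ContinuousLinearMap.comp_zero]
  · filter_upwards [h4] with w hw
    rw [hw, ContinuousLinearMap.comp_add, ContinuousLinearMap.comp_finsetSum]
    simp only [ContinuousLinearMap.comp_smul]

theorem analyticAt_clm_comp {Z : Type} [NormedAddCommGroup Z] [NormedSpace ℂ Z]
    {A : ℂ → Z →L[ℂ] X} {B : ℂ → Y →L[ℂ] Z} {w₀ : ℂ} (hA : AnalyticAt ℂ A w₀)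
    (hB : AnalyticAt ℂ B w₀) : AnalyticAt ℂ (fun w => A w ∘L B w) w₀ :=
  ((ContinuousLinearMap.compL ℂ Y Z X).analyticAt_bilinear (A w₀, B w₀)).comp₂ hA hB

variable {E : Type} [NormedAddCommGroup E] [NormedSpace ℂ E] [FiniteDimensional ℂ E]

/-- By the Leibniz formula the determinant is a polynomial in matrix entries, each a continuous
linear functional of the operator. -/
theorem analyticAt_det {m : ℂ → E →L[ℂ] E} {w₀ : ℂ} (hm : AnalyticAt ℂ m w₀) :
    AnalyticAt ℂ (fun w => LinearMap.det (m w : E →ₗ[ℂ] E)) w₀ := by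
  classical
  let b := Module.finBasis ℂ E
  have h1 : (fun w => LinearMap.det (m w : E →ₗ[ℂ] E))
      = fun w => ∑ σ : Equiv.Perm (Fin (Module.finrank ℂ E)),
        ((Equiv.Perm.sign σ : ℤ) : ℂ) * ∏ i, b.repr (m w (b i)) (σ i) := by
    funext w
    rw [← LinearMap.det_toMatrix b, Matrix.det_apply']
    simp [LinearMap.toMatrix_apply]
  rw [h1]
  refine Finset.analyticAt_fun_sum _ fun σ _ => ?_
  refine analyticAt_const.mul ?_
  refine Finset.analyticAt_fun_prod _ fun i _ => ?_
  let L : (E →L[ℂ] E) →ₗ[ℂ] ℂ :=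
    (b.coord (σ i)) ∘ₗ (ContinuousLinearMap.apply ℂ E (b i) : (E →L[ℂ] E) →ₗ[ℂ] E)
  exact (L.toContinuousLinearMap.analyticAt _).comp hm

theorem isUnit_of_det_ne_zero {m : E →L[ℂ] E} (h : LinearMap.det (m : E →ₗ[ℂ] E) ≠ 0) :
    IsUnit m := by
  have h1 : (m : E →ₗ[ℂ] E).ker = ⊥ := by
    by_contra hne
    exact h (LinearMap.det_eq_zero_iff_ker_ne_bot.2 hne)
  have h2 : (m : E →ₗ[ℂ] E).range = ⊤ := LinearMap.ker_eq_bot_iff_range_eq_top.1 h1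
  have := FiniteDimensional.complete ℂ E
  exact ContinuousLinearMap.isUnit_iff_bijective.2
    ⟨LinearMap.ker_eq_bot.1 h1, LinearMap.range_eq_top.1 h2⟩

/-- The principal part at `w₀` of `A m⁻¹ B`, for analytic `A`, `m`, `B`, takes values in a space
whose dimension is at most the order of vanishing of `det m`. -/
theorem exists_polarIn_of_analyticOrderAt_det (n : ℕ) : ∀ {X : Type} [NormedAddCommGroup X]
    [NormedSpace ℂ X] (w₀ : ℂ) (m mi : ℂ → E →L[ℂ] E) (A : ℂ → E →L[ℂ] X),
    AnalyticAt ℂ m w₀ → AnalyticAt ℂ A w₀ →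
    (∀ᶠ w in 𝓝[≠] w₀, m w * mi w = 1 ∧ mi w * m w = 1) →
    analyticOrderAt (fun w => LinearMap.det (m w : E →ₗ[ℂ] E)) w₀ = n →
    ∃ W : Submodule ℂ X, FiniteDimensional ℂ W ∧ Module.finrank ℂ W ≤ n ∧
      ∀ B : ℂ → Y →L[ℂ] E, AnalyticAt ℂ B w₀ →
        PolarIn (fun w => A w ∘L mi w ∘L B w) w₀ W := by
  have := FiniteDimensional.complete ℂ E
  induction n with
  | zero =>
    intro X _ _ w₀ m mi A hm hA hi ho
    refine ⟨⊥, inferInstance, by simp, fun B hB => ?_⟩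
    have hu : IsUnit (m w₀) := by
      apply isUnit_of_det_ne_zero
      exact (analyticAt_det hm).analyticOrderAt_eq_zero.1 (by simpa using ho)
    obtain ⟨u, hu⟩ := hu
    have h1 : AnalyticAt ℂ (fun w => Ring.inverse (m w)) w₀ := by
      refine AnalyticAt.fun_comp ?_ hm
      rw [← hu]
      exact analyticAt_inverse u
    have h2 : AnalyticAt ℂ (fun w => A w ∘L Ring.inverse (m w) ∘L B w) w₀ :=
      analyticAt_clm_comp hA (analyticAt_clm_comp h1 hB)
    refine (PolarIn.of_analyticAt h2).congr ?_
    filter_upwards [hi] with w hw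
    have : Ring.inverse (m w) = mi w :=
      Ring.inverse_unit ⟨m w, mi w, hw.1, hw.2⟩
    rw [this]
  | succ n ih =>
    intro X _ _ w₀ m mi A hm hA hi ho
    have h0 : LinearMap.det (m w₀ : E →ₗ[ℂ] E) = 0 := by
      by_contra hne
      rw [(analyticAt_det hm).analyticOrderAt_eq_zero.2 hne] at ho
      exact absurd ho.symm (by simp)
    have hker := LinearMap.det_eq_zero_iff_ker_ne_bot.1 h0
    obtain ⟨v, hv, hv0⟩ := (Submodule.ne_bot_iff _).1 hker
    have hv : m w₀ v = 0 := hv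
    obtain ⟨φ₀, -, hφ₀⟩ := exists_dual_vector ℂ v (norm_ne_zero_iff.2 hv0)
    have hvn : ((‖v‖ : ℝ) : ℂ) ≠ 0 := by simpa using hv0
    let φ : E →L[ℂ] ℂ := ((‖v‖ : ℝ) : ℂ)⁻¹ • φ₀
    have hφ : φ v = 1 := by
      change ((‖v‖ : ℝ) : ℂ)⁻¹ * φ₀ v = 1
      rw [hφ₀]
      exact inv_mul_cancel₀ hvn
    -- A rank-one projection onto a kernel vector of `m w₀`. Right multiplication by `(1 - P) + (w -
    -- w₀)⁻¹ P` removes one zero of the determinant and keeps `m` analytic, because `m w₀ * P = 0`.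
    let P : E →L[ℂ] E := φ.smulRight v
    have hPa : ∀ x, P x = φ x • v := fun x => rfl
    have hPP : P * P = P := by
      ext x
      simp [hPa, hφ]
    have hmP : m w₀ * P = 0 := by
      ext x
      simp [hPa, hv]
    -- the factors
    have hds : ∀ {Z : Type} [NormedAddCommGroup Z] [NormedSpace ℂ Z] (g : ℂ → Z),
        AnalyticAt ℂ g w₀ → AnalyticAt ℂ (dslope g w₀) w₀ := by
      rintro Z _ _ g ⟨p, hp⟩
      exact ⟨_, hp.has_fpower_series_dslope_fslope⟩
    let s : ℂ → E →L[ℂ] E := fun w => (1 - P) + (w - w₀)⁻¹ • P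
    let t : ℂ → E →L[ℂ] E := fun w => (1 - P) + (w - w₀) • P
    have hst : ∀ w, w ≠ w₀ → s w * t w = 1 ∧ t w * s w = 1 := by
      intro w hw
      have hw' : w - w₀ ≠ 0 := sub_ne_zero.2 hw
      constructor <;>
      · simp only [s, t, mul_add, add_mul, sub_mul, mul_sub, one_mul, mul_one, smul_mul_assoc,
          mul_smul_comm, hPP, sub_self, smul_zero, add_zero, zero_add, smul_smul,
          inv_mul_cancel₀ hw', mul_inv_cancel₀ hw', one_smul, smul_sub]
        abel
    -- The analytic version of `m s` across `w₀`. The product `A s` does not extend in the same way: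
    -- it is `A₁` plus a simple pole with coefficient `A w₀ ∘L P`, of rank at most one.
    let m₁ : ℂ → E →L[ℂ] E := fun w => m w * (1 - P) + dslope m w₀ w * P
    let mi₁ : ℂ → E →L[ℂ] E := fun w => t w * mi w
    let A₁ : ℂ → E →L[ℂ] X := fun w => A w ∘L (1 - P) + dslope A w₀ w ∘L P
    have hm₁ : AnalyticAt ℂ m₁ w₀ :=
      (hm.mul analyticAt_const).add ((hds m hm).mul analyticAt_const)
    have hA₁ : AnalyticAt ℂ A₁ w₀ :=
      (analyticAt_clm_comp hA analyticAt_const).add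
        (analyticAt_clm_comp (hds A hA) analyticAt_const)
    have hm₁s : ∀ w, w ≠ w₀ → m₁ w = m w * s w := by
      intro w hw
      have hd : dslope m w₀ w = (w - w₀)⁻¹ • (m w - m w₀) := by
        rw [dslope_of_ne _ hw, slope_def_module]
      simp only [m₁, s, hd, mul_add, smul_mul_assoc, sub_mul, hmP, sub_zero, mul_smul_comm]
    have hA₁s : ∀ w, w ≠ w₀ → A w ∘L s w = A₁ w + (w - w₀)⁻¹ • ((A w₀ ∘L P)) := by
      intro w hw
      have hd : dslope A w₀ w = (w - w₀)⁻¹ • (A w - A w₀) := by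
        rw [dslope_of_ne _ hw, slope_def_module]
      ext x
      simp only [A₁, s, hd]
      change A w ((x - P x) + (w - w₀)⁻¹ • P x)
        = (A w (x - P x) + (w - w₀)⁻¹ • (A w (P x) - A w₀ (P x))) + (w - w₀)⁻¹ • A w₀ (P x)
      rw [map_add, map_smul]
      module
    have hi₁ : ∀ᶠ w in 𝓝[≠] w₀, m₁ w * mi₁ w = 1 ∧ mi₁ w * m₁ w = 1 := by
      filter_upwards [hi, self_mem_nhdsWithin] with w hw hne
      obtain ⟨a1, a2⟩ := hst w hne
      rw [hm₁s w hne]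
      constructor
      · change m w * s w * (t w * mi w) = 1
        rw [mul_assoc, ← mul_assoc (s w), a1, one_mul, hw.1]
      · change t w * mi w * (m w * s w) = 1
        rw [mul_assoc, ← mul_assoc (mi w), hw.2, one_mul, a2]
    -- `t w` is the identity plus a rank-one map, that is, a transvection.
    have hdt : ∀ w, LinearMap.det (t w : E →ₗ[ℂ] E) = w - w₀ := by
      intro w
      have : (t w : E →ₗ[ℂ] E)
          = LinearMap.transvection ((w - w₀ - 1) • (φ : E →ₗ[ℂ] ℂ)) v := by
        ext x
        change (x - φ x • v) + (w - w₀) • (φ x • v) = x + ((w - w₀ - 1) * φ x) • v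
        module
      rw [this, LinearMap.transvection.det]
      simp [hφ]
    have ho₁ : analyticOrderAt (fun w => LinearMap.det (m₁ w : E →ₗ[ℂ] E)) w₀ = n := by
      have e1 : (fun w => LinearMap.det (m w : E →ₗ[ℂ] E)) =ᶠ[𝓝[≠] w₀]
          (fun w => LinearMap.det (m₁ w : E →ₗ[ℂ] E)) * (fun w => w - w₀) := by
        filter_upwards [self_mem_nhdsWithin] with w hne
        have : m w = m₁ w * t w := by
          rw [hm₁s w hne, mul_assoc, (hst w hne).1, mul_one]
        simp only [Pi.mul_apply]
        rw [this, ← hdt w, ← LinearMap.det_comp]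
        rfl
      have ha : AnalyticAt ℂ (fun w : ℂ => w - w₀) w₀ := by fun_prop
      have e2 : (fun w => LinearMap.det (m w : E →ₗ[ℂ] E)) =ᶠ[𝓝 w₀]
          (fun w => LinearMap.det (m₁ w : E →ₗ[ℂ] E)) * (fun w => w - w₀) :=
        ((analyticAt_det hm).continuousAt.eventuallyEq_nhds_iff_eventuallyEq_nhdsNE
          ((analyticAt_det hm₁).mul ha).continuousAt).1 e1
      rw [analyticOrderAt_congr e2, analyticOrderAt_mul (analyticAt_det hm₁) ha] at ho
      have h1 : analyticOrderAt (fun w : ℂ => w - w₀) w₀ = 1 := by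
        refine (ha.analyticOrderAt_eq_natCast (n := 1)).2 ⟨fun _ => 1, analyticAt_const, by simp, ?_⟩
        simp
      rw [h1] at ho
      push_cast at ho
      exact (ENat.add_left_injective_of_ne_top (by simp)) ho
    obtain ⟨W₁, hfd, hW₁, hP₁⟩ := ih w₀ m₁ mi₁ A₁ hm₁ hA₁ hi₁ ho₁
    -- The induction hypothesis with `A` the identity, used only to know that `mi₁ B` is
    -- meromorphic.
    obtain ⟨W₂, -, -, hP₂⟩ := ih w₀ m₁ mi₁ (fun _ => ContinuousLinearMap.id ℂ E) hm₁
      analyticAt_const hi₁ ho₁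
    let L : E →L[ℂ] X := A w₀ ∘L P
    have hLle : LinearMap.range (L : E →ₗ[ℂ] X) ≤ ℂ ∙ (A w₀ v) := by
      rintro _ ⟨x, rfl⟩
      refine Submodule.mem_span_singleton.2 ⟨φ x, ?_⟩
      simp [L, hPa]
    -- Each cancelled zero costs one dimension: the extra pole factors through `P`, so all its
    -- coefficients lie on the line of `A w₀ v`, however high the order of the pole of `mi₁ B`.
    refine ⟨W₁ ⊔ (ℂ ∙ (A w₀ v)), inferInstance, ?_, fun B hB => ?_⟩
    · refine (Submodule.finrank_add_le_finrank_add_finrank _ _).trans ?_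
      exact add_le_add hW₁ ((finrank_span_le_card {A w₀ v}).trans (by simp))
    · have hmer : MeromorphicAt (fun w => (w - w₀)⁻¹ • (mi₁ w ∘L B w)) w₀ := by
        refine MeromorphicAt.fun_smul (by fun_prop) ?_
        simpa using (hP₂ B hB).meromorphicAt
      have h2 := ((polarIn_top_of_meromorphicAt hmer).clm_comp L).mono hLle
      refine ((hP₁ B hB).add h2).congr ?_
      filter_upwards [self_mem_nhdsWithin] with w hne
      have e1 : mi w = s w * mi₁ w := by
        change mi w = s w * (t w * mi w)
        rw [← mul_assoc, (hst w hne).1, one_mul]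
      calc A w ∘L mi w ∘L B w = (A w ∘L s w) ∘L mi₁ w ∘L B w := by rw [e1]; rfl
        _ = _ := by
          rw [hA₁s w hne]
          ext x
          simp [L]

end PrincipalPart

end DiracResonance

end

noncomputable section

namespace DiracResonance

/-! ### Loop integrals and multiplicities -/

section LoopIntegral

/-- Integrate the Laurent expansion termwise on a small circle: the analytic part and the higher
powers integrate to zero, so `2πi` times the residue `C 0`, which maps into `W`, is left. -/
theorem smallLoopIntegral_eq {G : ℂ → L2 →L[ℂ] L2} {w₀ : ℂ} {W : Submodule ℂ L2}
    (hG : PolarIn G w₀ W) : ∀ u, smallLoopIntegral G w₀ u ∈ W := by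
  obtain ⟨n, C, h, h1, h2, h3, h4⟩ := hG
  have key : ∀ᶠ ε in 𝓝[>] (0 : ℝ), (∮ w in C(w₀, ε), G w) = (2 * Real.pi * Complex.I) • C 0 := by
    obtain ⟨δ₁, hδ₁, hb₁⟩ := Metric.eventually_nhds_iff_ball.1 h1.eventually_analyticAt
    obtain ⟨δ₂, hδ₂, hb₂⟩ := Metric.eventually_nhds_iff_ball.1 (eventually_nhdsWithin_iff.1 h4)
    filter_upwards [Ioo_mem_nhdsGT (lt_min hδ₁ hδ₂)] with ε hε
    have hε0 : 0 < ε := hε.1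
    have hε1 : ε < δ₁ := hε.2.trans_le (min_le_left _ _)
    have hε2 : ε < δ₂ := hε.2.trans_le (min_le_right _ _)
    have hsph : ∀ w ∈ Metric.sphere w₀ ε, w ≠ w₀ := by
      rintro w hw rfl
      simp at hw
      exact hε0.ne' hw.symm
    have e1 : (∮ w in C(w₀, ε), G w) = ∮ w in C(w₀, ε),
        (∑ k ∈ Finset.range n, ((w - w₀)⁻¹) ^ (k + 1) • C k + h w) := by
      refine circleIntegral.integral_congr hε0.le fun w hw => ?_
      refine hb₂ w ?_ (hsph w hw)
      rw [Metric.mem_ball, Metric.mem_sphere.1 hw]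
      exact hε2
    have hh : ContinuousOn h (Metric.closedBall w₀ ε) := fun w hw =>
      (hb₁ w (Metric.closedBall_subset_ball hε1 hw)).continuousAt.continuousWithinAt
    have hci : ∀ k, ContinuousOn (fun w => ((w - w₀)⁻¹) ^ (k + 1) • C k) (Metric.sphere w₀ ε) := by
      intro k
      have hcs : ContinuousOn (fun w : ℂ => w - w₀) (Metric.sphere w₀ ε) := by fun_prop
      refine ContinuousOn.smul ((hcs.inv₀ ?_).pow _) continuousOn_const
      intro w hw
      exact sub_ne_zero.2 (hsph w hw)
    have hint : ∀ k ∈ Finset.range n,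
        CircleIntegrable (fun w => ((w - w₀)⁻¹) ^ (k + 1) • C k) w₀ ε :=
      fun k _ => (hci k).circleIntegrable hε0.le
    have e2 : (∮ w in C(w₀, ε), h w) = 0 := by
      refine Complex.circleIntegral_eq_zero_of_differentiable_on_off_countable hε0.le
        Set.countable_empty hh fun w hw => ?_
      exact (hb₁ w (Metric.ball_subset_ball hε1.le hw.1)).differentiableAt
    rw [e1, circleIntegral.integral_add
      ((continuousOn_finsetSum _ fun k _ => hci k).circleIntegrable hε0.le)
      ((hh.mono Metric.sphere_subset_closedBall).circleIntegrable hε0.le), e2, add_zero,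
      circleIntegral.integral_fun_sum hint]
    have e3 : ∀ k, (∮ w in C(w₀, ε), ((w - w₀)⁻¹) ^ (k + 1) • C k)
        = if k = 0 then (2 * Real.pi * Complex.I) • C 0 else 0 := by
      intro k
      rw [circleIntegral.integral_smul_const]
      split_ifs with hk
      · subst hk
        have := circleIntegral.integral_sub_center_inv w₀ hε0.ne'
        simp only [zero_add, pow_one]
        rw [this]
      · have := circleIntegral.integral_sub_zpow_of_ne (n := -((k : ℤ) + 1)) (by omega) w₀ w₀ ε
        have e : ∀ w : ℂ, ((w - w₀)⁻¹) ^ (k + 1) = (w - w₀) ^ (-((k : ℤ) + 1)) := by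
          intro w
          rw [zpow_neg, inv_pow]
          norm_cast
        simp only [e]
        rw [this, zero_smul]
    simp only [e3]
    rcases Nat.eq_zero_or_pos n with hn | hn
    · subst hn
      simp [h3 0 le_rfl]
    · simp [hn.ne']
  intro u
  have : smallLoopIntegral G w₀ = (2 * Real.pi * Complex.I) • C 0 :=
    Tendsto.limUnder_eq (tendsto_const_nhds.congr' (EventuallyEq.symm key))
  rw [this]
  exact W.smul_mem _ (h2 0 u)

/-- Both definitions of the multiplicity use loop integrals of `a F` with `a` analytic: `a = λ'(w)`
away from the branch points, `a = (w - w₀)^k` at them. A space `W` that serves every analytic weight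
bounds both. -/
theorem multiplicity_le_finrank {F : ℂ → L2 →L[ℂ] L2} {w₀ : ℂ} (hw₀ : w₀ ≠ 0)
    {W : Submodule ℂ L2} [FiniteDimensional ℂ W]
    (h : ∀ a : ℂ → ℂ, AnalyticAt ℂ a w₀ → PolarIn (fun w => a w • F w) w₀ W) :
    multiplicity F w₀ ≤ (Module.finrank ℂ W : ℕ) := by
  have hrank : ∀ W' : Submodule ℂ L2, W' ≤ W →
      Cardinal.toENat (Module.rank ℂ W') ≤ (Module.finrank ℂ W : ℕ) := by
    intro W' hle
    have h1 : Module.rank ℂ W' ≤ Module.rank ℂ W := Submodule.rank_mono hle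
    rw [← Module.finrank_eq_rank ℂ W] at h1
    calc Cardinal.toENat (Module.rank ℂ W')
        ≤ Cardinal.toENat (Module.finrank ℂ W : Cardinal) := Cardinal.toENat.monotone' h1
      _ = _ := by simp
  unfold multiplicity
  split_ifs with hb
  · refine hrank _ (iSup_le fun k => ?_)
    rintro _ ⟨u, rfl⟩
    exact smallLoopIntegral_eq (h (fun w => (w - w₀) ^ k) (by fun_prop)) u
  · refine hrank _ ?_
    rintro _ ⟨u, rfl⟩
    refine smallLoopIntegral_eq (h (deriv spectralParam) ?_) u
    have : AnalyticAt ℂ spectralParam w₀ := by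
      unfold spectralParam
      have : AnalyticAt ℂ (fun w : ℂ => w⁻¹) w₀ := analyticAt_inv hw₀
      have h2 : AnalyticAt ℂ (fun w : ℂ => w) w₀ := analyticAt_id
      exact (h2.add this).div analyticAt_const (by norm_num)
    exact this.deriv

end LoopIntegral

/-! ### Zeros of analytic functions in discs and annuli -/

section ZeroCount

/-- Jensen's inequality. The divisor of an analytic function is nonnegative and records orders of
vanishing, so a sum over finitely many points is at most its total mass. -/
theorem sum_analyticOrderAt_le {f : ℂ → ℂ} {c : ℂ} {r R M : ℝ} (hr : 0 < r) (hrR : r < R)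
    (hM : 1 ≤ M) (hf : AnalyticOnNhd ℂ f (Metric.closedBall c R)) (hc : f c ≠ 0)
    (hb : ∀ z ∈ Metric.closedBall c R, ‖f z‖ ≤ M) (s : Finset ℂ)
    (hs : ∀ z ∈ s, z ∈ Metric.closedBall c r) :
    ∑ z ∈ s, ((analyticOrderAt f z).toNat : ℝ) ≤ Real.log (M / ‖f c‖) / Real.log (R / r) := by
  have hR : 0 < R := hr.trans hrR
  have h1 := AnalyticOnNhd.sum_divisor_le (c := c) (r := r) (R := R) (M := M) (f := f)
    (by rwa [abs_of_pos hr]) (by rwa [abs_of_pos hr, abs_of_pos hR]) hM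
    (by rwa [abs_of_pos hR]) hc
    (by rw [abs_of_pos hR]; exact fun z hz => hb z (Metric.sphere_subset_closedBall hz))
  refine le_trans ?_ h1
  have hf' : AnalyticOnNhd ℂ f (Metric.closedBall c |r|) := by
    rw [abs_of_pos hr]
    exact hf.mono (Metric.closedBall_subset_closedBall hrR.le)
  have hd : ∀ z ∈ s, ((analyticOrderAt f z).toNat : ℤ)
      = MeromorphicOn.divisor f (Metric.closedBall c |r|) z := by
    intro z hz
    rw [MeromorphicOn.AnalyticOnNhd.divisor_apply hf' (by rw [abs_of_pos hr]; exact hs z hz)]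
    cases analyticOrderAt f z <;> simp
  have hfin : (Function.support (MeromorphicOn.divisor f (Metric.closedBall c |r|))).Finite :=
    (MeromorphicOn.divisor f (Metric.closedBall c |r|)).finiteSupport (isCompact_closedBall _ _)
  have h2 : ∑ z ∈ s, MeromorphicOn.divisor f (Metric.closedBall c |r|) z
      ≤ ∑ᶠ u, MeromorphicOn.divisor f (Metric.closedBall c |r|) u := by
    classical
    rw [finsum_eq_sum_of_support_subset (s := hfin.toFinset ∪ s) _ (by
      intro x hx; simp [hfin.mem_toFinset]; left; exact hx)]
    exact Finset.sum_le_sum_of_subset_of_nonneg Finset.subset_union_right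
      fun i _ _ => MeromorphicOn.AnalyticOnNhd.divisor_nonneg hf' i
  calc ∑ z ∈ s, ((analyticOrderAt f z).toNat : ℝ)
      = ((∑ z ∈ s, ((analyticOrderAt f z).toNat : ℤ) : ℤ) : ℝ) := by push_cast; rfl
    _ = ((∑ z ∈ s, MeromorphicOn.divisor f (Metric.closedBall c |r|) z : ℤ) : ℝ) := by
        rw [Finset.sum_congr rfl hd]
    _ ≤ _ := by exact_mod_cast h2

/-- Counting zeros in an annulus, through the covering `ζ ↦ w e^ζ`. -/
theorem sum_analyticOrderAt_annulus_le {f : ℂ → ℂ} {c : ℂ} {T M : ℝ} (hc0 : c ≠ 0) (hT : 0 < T)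
    (hM : 1 ≤ M)
    (hf : ∀ w : ℂ, ‖c‖ * Real.exp (-(2 * (T + Real.pi))) ≤ ‖w‖ →
      ‖w‖ ≤ ‖c‖ * Real.exp (2 * (T + Real.pi)) → AnalyticAt ℂ f w ∧ ‖f w‖ ≤ M)
    (hc : f c ≠ 0) (s : Finset ℂ)
    (hs : ∀ w ∈ s, ‖c‖ * Real.exp (-T) ≤ ‖w‖ ∧ ‖w‖ ≤ ‖c‖ * Real.exp T) :
    (∀ w ∈ s, analyticOrderAt f w ≠ ⊤) ∧
    ∑ w ∈ s, ((analyticOrderAt f w).toNat : ℝ) ≤ Real.log (M / ‖f c‖) / Real.log 2 := by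
  classical
  have hcn : 0 < ‖c‖ := norm_pos_iff.2 hc0
  -- The exponential is locally biholomorphic, so it preserves orders of vanishing. It unrolls the
  -- annulus, and the puncture `w = 0` no longer prevents the use of discs.
  set Φ : ℂ → ℂ := fun ζ => c * Complex.exp ζ with hΦ
  have hΦa : ∀ ζ, AnalyticAt ℂ Φ ζ := fun ζ => by fun_prop
  have hΦd : ∀ ζ, deriv Φ ζ ≠ 0 := by
    intro ζ
    have : HasDerivAt Φ (c * Complex.exp ζ) ζ := (Complex.hasDerivAt_exp ζ).const_mul c
    rw [this.deriv]
    exact mul_ne_zero hc0 (Complex.exp_ne_zero _)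
  set g : ℂ → ℂ := f ∘ Φ with hg
  -- On the annulus, `log (w / c)` has real part at most `T` and imaginary part at most `π` in
  -- modulus. The outer disc has radius `2 * r`, whence the denominator `log 2`.
  set r := T + Real.pi with hr
  have hr0 : 0 < r := add_pos hT Real.pi_pos
  have hΦn : ∀ ζ, ‖Φ ζ‖ = ‖c‖ * Real.exp ζ.re := by
    intro ζ
    simp [hΦ, Complex.norm_exp]
  have hball : ∀ ζ ∈ Metric.closedBall (0 : ℂ) (2 * r), AnalyticAt ℂ f (Φ ζ) ∧ ‖f (Φ ζ)‖ ≤ M := by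
    intro ζ hζ
    have h1 : |ζ.re| ≤ 2 * r := (Complex.abs_re_le_norm ζ).trans (by simpa using hζ)
    refine hf _ ?_ ?_ <;> rw [hΦn]
    · exact mul_le_mul_of_nonneg_left (Real.exp_le_exp.2 (abs_le.1 h1).1) hcn.le
    · exact mul_le_mul_of_nonneg_left (Real.exp_le_exp.2 (abs_le.1 h1).2) hcn.le
  have hga : AnalyticOnNhd ℂ g (Metric.closedBall 0 (2 * r)) :=
    fun ζ hζ => (hball ζ hζ).1.comp (hΦa ζ)
  have hg0 : g 0 ≠ 0 := by simpa [hg, hΦ] using hc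
  set L : ℂ → ℂ := fun w => Complex.log (w / c) with hL
  have hsw : ∀ w ∈ s, w ≠ 0 := by
    rintro w hw rfl
    have := (hs _ hw).1
    rw [norm_zero] at this
    exact absurd this (not_le.2 (by positivity))
  have hΦL : ∀ w ∈ s, Φ (L w) = w := by
    intro w hw
    simp only [hΦ, hL]
    rw [Complex.exp_log (div_ne_zero (hsw w hw) hc0)]
    field_simp
  have hLr : ∀ w ∈ s, L w ∈ Metric.closedBall (0 : ℂ) r := by
    intro w hw
    have h0 : 0 < ‖w‖ := norm_pos_iff.2 (hsw w hw)
    have h1 : |(L w).re| ≤ T := by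
      simp only [hL, Complex.log_re, norm_div]
      rw [abs_le]
      constructor
      · rw [Real.le_log_iff_exp_le (by positivity), le_div_iff₀ hcn, mul_comm]
        exact (hs w hw).1
      · rw [Real.log_le_iff_le_exp (by positivity), div_le_iff₀ hcn, mul_comm]
        exact (hs w hw).2
    have h2 : |(L w).im| ≤ Real.pi := by
      simp only [hL, Complex.log_im]
      exact Complex.abs_arg_le_pi _
    rw [mem_closedBall_zero_iff]
    exact (Complex.norm_le_abs_re_add_abs_im _).trans (add_le_add h1 h2)
  have hord : ∀ w ∈ s, analyticOrderAt g (L w) = analyticOrderAt f w := by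
    intro w hw
    have hb : L w ∈ Metric.closedBall (0 : ℂ) (2 * r) :=
      Metric.closedBall_subset_closedBall (by linarith) (hLr w hw)
    have hfa := (hball _ hb).1
    rw [hg, hfa.analyticOrderAt_comp (hΦa _), (hΦa _).analyticOrderAt_sub_eq_one_of_deriv_ne_zero
      (hΦd _), mul_one, hΦL w hw]
  have htop : ∀ w ∈ s, analyticOrderAt f w ≠ ⊤ := by
    intro w hw
    rw [← hord w hw]
    refine hga.analyticOrderAt_ne_top_of_isPreconnected
      (convex_closedBall _ _).isPreconnected (x := 0) (by simp; linarith)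
      (Metric.closedBall_subset_closedBall (by linarith) (hLr w hw)) ?_
    rw [(hga 0 (by simp; linarith)).analyticOrderAt_eq_zero.2 hg0]
    simp
  refine ⟨htop, ?_⟩
  have h1 := sum_analyticOrderAt_le hr0 (by linarith : r < 2 * r) hM hga hg0
    (fun z hz => (hball z hz).2) (s.image L) (by
      intro z hz
      obtain ⟨w, hw, rfl⟩ := Finset.mem_image.1 hz
      exact hLr w hw)
  rw [Finset.sum_image (fun w hw w' hw' h => by rw [← hΦL w hw, ← hΦL w' hw', h])] at h1
  have h2 : 2 * r / r = 2 := by field_simp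
  have h3 : g 0 = f c := by simp [hg, hΦ]
  rw [h2, h3, Finset.sum_congr rfl (fun w hw => by rw [hord w hw])] at h1
  exact h1

end ZeroCount

end DiracResonance

end

noncomputable section

namespace DiracResonance

/-! ### Reduction of `1 + K` to a finite-dimensional Schur complement -/

section Reduction

variable {H : Type} [NormedAddCommGroup H] [InnerProductSpace ℂ H] [CompleteSpace H]
  (K : H →L[ℂ] H) (E : Submodule ℂ H) [FiniteDimensional ℂ E]

/-- The part of `K` with values orthogonal to `E`. -/
def residualPart : H →L[ℂ] H := K - E.subtypeL ∘L E.orthogonalProjectionOnto ∘L K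

/-- The inverse of `1 +` the residual part. -/
def residualInv : H →L[ℂ] H := Ring.inverse (1 + residualPart K E)

/-- The finite-dimensional Schur complement of `1 + K`. -/
def schurComplement : E →L[ℂ] E :=
  1 + E.orthogonalProjectionOnto ∘L K ∘L residualInv K E ∘L E.subtypeL

variable {K E}

theorem isUnit_one_add_residualPart (hQ : ‖residualPart K E‖ ≤ 1 / 2) :
    IsUnit (1 + residualPart K E) := by
  have : ‖-residualPart K E‖ < 1 := by rw [norm_neg]; linarith
  simpa using isUnit_one_sub_of_norm_lt_one this

theorem residual_mul_inv (hQ : ‖residualPart K E‖ ≤ 1 / 2) :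
    (1 + residualPart K E) * residualInv K E = 1 :=
  Ring.mul_inverse_cancel _ (isUnit_one_add_residualPart hQ)

theorem residualInv_mul (hQ : ‖residualPart K E‖ ≤ 1 / 2) :
    residualInv K E * (1 + residualPart K E) = 1 :=
  Ring.inverse_mul_cancel _ (isUnit_one_add_residualPart hQ)

theorem norm_residualInv_le (hQ : ‖residualPart K E‖ ≤ 1 / 2) (x : H) :
    ‖residualInv K E x‖ ≤ 2 * ‖x‖ := by
  have h1 : residualInv K E x + residualPart K E (residualInv K E x) = x :=
    DFunLike.congr_fun (residual_mul_inv hQ) x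
  have h2 : ‖residualPart K E (residualInv K E x)‖ ≤ 1 / 2 * ‖residualInv K E x‖ :=
    (ContinuousLinearMap.le_opNorm _ _).trans (by gcongr)
  have h3 : residualInv K E x = x - residualPart K E (residualInv K E x) := eq_sub_of_add_eq h1
  have h4 : ‖residualInv K E x‖ ≤ ‖x‖ + ‖residualPart K E (residualInv K E x)‖ := by
    conv_lhs => rw [h3]
    exact norm_sub_le _ _
  linarith

/-- Multiplication by the residual inverse removes the part of `K` orthogonal to `E`; what remains
is the identity plus an operator with values in `E`. It therefore preserves `E`, and acts on it as
the Schur complement. -/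
theorem one_add_eq (hQ : ‖residualPart K E‖ ≤ 1 / 2) :
    (1 + K) * residualInv K E
      = 1 + E.subtypeL ∘L E.orthogonalProjectionOnto ∘L K ∘L residualInv K E := by
  have h1 : 1 + K = (1 + residualPart K E) + E.subtypeL ∘L E.orthogonalProjectionOnto ∘L K := by
    simp only [residualPart]; abel
  rw [h1, add_mul, residual_mul_inv hQ]
  rfl

theorem schur_intertwine (hQ : ‖residualPart K E‖ ≤ 1 / 2) (x : E) :
    ((1 + K) * residualInv K E) (x : H) = (schurComplement K E x : H) := by
  rw [one_add_eq hQ]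
  rfl

theorem norm_schurComplement_le {a : ℝ} {x : E}
    (h : ‖K (residualInv K E x)‖ ≤ a * ‖residualInv K E x‖) (ha : 0 ≤ a)
    (hQ : ‖residualPart K E‖ ≤ 1 / 2) :
    ‖schurComplement K E x‖ ≤ (1 + 2 * a) * ‖x‖ := by
  have h1 : schurComplement K E x
      = x + E.orthogonalProjectionOnto (K (residualInv K E (x : H))) := rfl
  have h2 := E.norm_orthogonalProjectionOnto_apply_le (K (residualInv K E (x : H)))
  have h3 := norm_residualInv_le hQ (x : H)
  have h4 : ‖(x : H)‖ = ‖x‖ := rfl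
  calc ‖schurComplement K E x‖ ≤ ‖x‖ + ‖E.orthogonalProjectionOnto (K (residualInv K E (x : H)))‖ := by
        rw [h1]; exact norm_add_le _ _
    _ ≤ ‖x‖ + a * (2 * ‖x‖) := by
        gcongr
        refine h2.trans (h.trans ?_)
        gcongr
        exact h3
    _ = _ := by ring

/-- `ℓ` encodes finitely many moment conditions. By rank–nullity the `x` in `E` whose image under
the residual inverse is killed by `ℓ` form a subspace of codimension at most `k`, and on it the
better constant `a` is available. The factor `2` is the norm bound of the residual inverse. -/
theorem norm_det_schurComplement_le (hQ : ‖residualPart K E‖ ≤ 1 / 2) {a c : ℝ} (ha : 0 ≤ a)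
    (hc : 0 ≤ c) {F : Type} [AddCommGroup F] [Module ℂ F] (ℓ : H →ₗ[ℂ] F) (S : Submodule ℂ F)
    [FiniteDimensional ℂ S] (hℓ : ∀ u, ℓ u ∈ S) {N k : ℕ} (hN : Module.finrank ℂ E ≤ N)
    (hk : Module.finrank ℂ S ≤ k) (hKa : ∀ u, ℓ u = 0 → ‖K u‖ ≤ a * ‖u‖)
    (hKc : ∀ u, ‖K u‖ ≤ c * ‖u‖) :
    ‖LinearMap.det (schurComplement K E : E →ₗ[ℂ] E)‖ ≤ (1 + 2 * a) ^ N * (1 + 2 * c) ^ k := by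
  let ℓ' : E →ₗ[ℂ] S :=
    LinearMap.codRestrict S (ℓ ∘ₗ (residualInv K E : H →ₗ[ℂ] H) ∘ₗ E.subtype) fun x => hℓ _
  refine norm_det_le_of_le_on _ (LinearMap.ker ℓ') (by linarith) (by linarith) hN ?_ ?_ ?_
  · have h1 := ℓ'.finrank_range_add_finrank_ker
    have h2 := (Submodule.finrank_le (LinearMap.range ℓ')).trans hk
    omega
  · intro x hx
    refine norm_schurComplement_le (hKa _ ?_) ha hQ
    exact congrArg Subtype.val (LinearMap.mem_ker.1 hx)
  · intro x
    exact norm_schurComplement_le (hKc _) hc hQ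

/-- The compression to `E` of `(1 + Q) M`, with `Q` the residual part, is a left inverse of the
Schur complement. An upper bound for its determinant is thus a lower bound for the other; `3/2`
bounds the norm of `1 + Q`. -/
theorem one_le_norm_det_schurComplement (hQ : ‖residualPart K E‖ ≤ 1 / 2) {N : ℕ}
    (hN : Module.finrank ℂ E ≤ N) {M : H →L[ℂ] H} (hM : M * (1 + K) = 1) {b : ℝ}
    (hb : ∀ x, ‖M x‖ ≤ b * ‖x‖) (hb1 : 1 ≤ b) :
    1 ≤ ‖LinearMap.det (schurComplement K E : E →ₗ[ℂ] E)‖ * (3 / 2 * b) ^ N := by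
  let n : E →L[ℂ] E := E.orthogonalProjectionOnto ∘L (1 + residualPart K E) ∘L M ∘L E.subtypeL
  have h1 : (n : E →ₗ[ℂ] E) ∘ₗ (schurComplement K E : E →ₗ[ℂ] E) = LinearMap.id := by
    ext x
    change ((E.orthogonalProjectionOnto ((1 + residualPart K E) (M (schurComplement K E x : H))) : E) : H) = x
    rw [← schur_intertwine hQ]
    have e1 : M (((1 + K) * residualInv K E) (x : H)) = residualInv K E x := by
      change (M * (1 + K)) (residualInv K E x) = _
      rw [hM]; rfl
    have e2 : (1 + residualPart K E) (residualInv K E x) = x :=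
      DFunLike.congr_fun (residual_mul_inv hQ) (x : H)
    rw [e1, e2]
    simp
  have h2 : LinearMap.det (n : E →ₗ[ℂ] E) * LinearMap.det (schurComplement K E : E →ₗ[ℂ] E) = 1 := by
    rw [← LinearMap.det_comp, h1, LinearMap.det_id]
  have h3 : ‖LinearMap.det (n : E →ₗ[ℂ] E)‖ ≤ (3 / 2 * b) ^ N * (3 / 2 * b) ^ 0 := by
    have key : ∀ x : E, ‖n x‖ ≤ 3 / 2 * b * ‖x‖ := by
      intro x
      have e1 := E.norm_orthogonalProjectionOnto_apply_le ((1 + residualPart K E) (M (x : H)))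
      have e2 : ‖(1 + residualPart K E) (M (x : H))‖ ≤ 3 / 2 * ‖M (x : H)‖ := by
        have e3 : ‖residualPart K E (M (x : H))‖ ≤ 1 / 2 * ‖M (x : H)‖ :=
          (ContinuousLinearMap.le_opNorm _ _).trans (by gcongr)
        calc _ ≤ ‖M (x : H)‖ + ‖residualPart K E (M (x : H))‖ := norm_add_le _ _
          _ ≤ _ := by linarith
      have e4 := hb (x : H)
      have e5 : ‖(x : H)‖ = ‖x‖ := rfl
      refine e1.trans (e2.trans ?_)
      rw [e5] at e4
      linarith
    exact norm_det_le_of_le_on _ ⊤ (by linarith) (by linarith) hN (by simp) (fun x _ => key x) key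
  rw [pow_zero, mul_one] at h3
  calc 1 = ‖LinearMap.det (n : E →ₗ[ℂ] E)‖ * ‖LinearMap.det (schurComplement K E : E →ₗ[ℂ] E)‖ := by
        rw [← norm_mul, h2, norm_one]
    _ ≤ _ := by rw [mul_comm]; gcongr

/-- The inverse of `1 + K` in terms of the inverse of the Schur complement. -/
theorem isInverse_of_schurComplement (hQ : ‖residualPart K E‖ ≤ 1 / 2) {n : E →L[ℂ] E}
    (h1 : schurComplement K E * n = 1) (h2 : n * schurComplement K E = 1) :
    Ring.inverse (1 + K) = residualInv K E -
      residualInv K E ∘L E.subtypeL ∘L n ∘L E.orthogonalProjectionOnto ∘L K ∘L residualInv K E ∧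
    IsUnit (1 + K) := by
  set ι := E.subtypeL with hι
  set B : H →L[ℂ] E := E.orthogonalProjectionOnto ∘L K ∘L residualInv K E with hB
  have hm : schurComplement K E = 1 + B ∘L ι := rfl
  -- `1 + K` is `Y` times `1 +` the residual part, and `Y = 1 + ιB` is inverted by the push-through
  -- identity `(1 + ιB)⁻¹ = 1 - ι(1 + Bι)⁻¹B`, where `1 + Bι` is the Schur complement.
  set Y : H →L[ℂ] H := 1 + ι ∘L B with hY
  set Z : H →L[ℂ] H := 1 - ι ∘L n ∘L B with hZ
  have hYZ : Y * Z = 1 := by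
    ext x
    have e : n (B x) + B (ι (n (B x))) = B x := DFunLike.congr_fun h1 (B x)
    have e' : ι (n (B x)) + ι (B (ι (n (B x)))) = ι (B x) := by rw [← map_add, e]
    change (x - ι (n (B x))) + ι (B (x - ι (n (B x)))) = x
    rw [map_sub, map_sub, ← e']
    abel
  have hZY : Z * Y = 1 := by
    ext x
    have e : n (B x + B (ι (B x))) = B x := DFunLike.congr_fun h2 (B x)
    change (x + ι (B x)) - ι (n (B (x + ι (B x)))) = x
    rw [map_add B, e]
    abel
  have hKY : (1 + K) = Y * (1 + residualPart K E) := by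
    have := one_add_eq hQ
    calc (1 + K) = (1 + K) * (residualInv K E * (1 + residualPart K E)) := by
          rw [residualInv_mul hQ, mul_one]
      _ = _ := by rw [← mul_assoc, this]
  have hl : (1 + K) * (residualInv K E * Z) = 1 := by
    rw [hKY, mul_assoc, ← mul_assoc (1 + residualPart K E), residual_mul_inv hQ, one_mul, hYZ]
  have hr : (residualInv K E * Z) * (1 + K) = 1 := by
    rw [hKY, mul_assoc, ← mul_assoc Z, hZY, one_mul, residualInv_mul hQ]
  refine ⟨?_, ⟨⟨1 + K, _, hl, hr⟩, rfl⟩⟩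
  have := Ring.inverse_unit (⟨1 + K, residualInv K E * Z, hl, hr⟩ : (H →L[ℂ] H)ˣ)
  refine this.trans ?_
  change residualInv K E * Z = _
  rw [hZ, mul_sub, mul_one]
  rfl

variable {κ : ℂ → H →L[ℂ] H} {w₀ : ℂ}

theorem analyticAt_residualPart (hκ : AnalyticAt ℂ κ w₀) :
    AnalyticAt ℂ (fun w => residualPart (κ w) E) w₀ :=
  hκ.sub (analyticAt_clm_comp analyticAt_const (analyticAt_clm_comp analyticAt_const hκ))

theorem analyticAt_residualInv (hκ : AnalyticAt ℂ κ w₀) (hQ : ‖residualPart (κ w₀) E‖ ≤ 1 / 2) :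
    AnalyticAt ℂ (fun w => residualInv (κ w) E) w₀ := by
  have h1 : AnalyticAt ℂ (fun w => 1 + residualPart (κ w) E) w₀ :=
    analyticAt_const.add (analyticAt_residualPart hκ)
  refine AnalyticAt.fun_comp ?_ h1
  obtain ⟨u, hu⟩ := isUnit_one_add_residualPart hQ
  rw [← hu]
  exact analyticAt_inverse u

theorem analyticAt_schurComplement (hκ : AnalyticAt ℂ κ w₀)
    (hQ : ‖residualPart (κ w₀) E‖ ≤ 1 / 2) :
    AnalyticAt ℂ (fun w => schurComplement (κ w) E) w₀ :=
  analyticAt_const.add (analyticAt_clm_comp analyticAt_const (analyticAt_clm_comp hκ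
    (analyticAt_clm_comp (analyticAt_residualInv hκ hQ) analyticAt_const)))

/-- The principal part of `A (1 + K)⁻¹ B` has values in a space whose dimension is at most the
order of vanishing of the determinant of the Schur complement. -/
theorem exists_polarIn_of_schurComplement (hκ : AnalyticAt ℂ κ w₀)
    (hQ : ∀ᶠ w in 𝓝 w₀, ‖residualPart (κ w) E‖ ≤ 1 / 2)
    (ho : analyticOrderAt (fun w => LinearMap.det (schurComplement (κ w) E : E →ₗ[ℂ] E)) w₀ ≠ ⊤)
    {A : ℂ → H →L[ℂ] H} (hA : AnalyticAt ℂ A w₀) :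
    ∃ W : Submodule ℂ H, FiniteDimensional ℂ W ∧ Module.finrank ℂ W ≤
      (analyticOrderAt (fun w => LinearMap.det (schurComplement (κ w) E : E →ₗ[ℂ] E)) w₀).toNat ∧
      ∀ B : ℂ → H →L[ℂ] H, AnalyticAt ℂ B w₀ →
        PolarIn (fun w => A w ∘L Ring.inverse (1 + κ w) ∘L B w) w₀ W := by
  have hQ₀ := hQ.self_of_nhds
  have hm := analyticAt_schurComplement hκ hQ₀
  have hT := analyticAt_residualInv hκ hQ₀
  set m : ℂ → E →L[ℂ] E := fun w => schurComplement (κ w) E with hmdef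
  obtain ⟨n, hn⟩ := ENat.ne_top_iff_exists.1 ho
  have hdet : ∀ᶠ w in 𝓝[≠] w₀, LinearMap.det (m w : E →ₗ[ℂ] E) ≠ 0 := by
    rcases (analyticAt_det hm).eventually_eq_zero_or_eventually_ne_zero with h | h
    · exact absurd (analyticOrderAt_eq_top.2 h) ho
    · exact h
  have hinv : ∀ᶠ w in 𝓝[≠] w₀, m w * Ring.inverse (m w) = 1 ∧ Ring.inverse (m w) * m w = 1 := by
    filter_upwards [hdet] with w hw
    have := isUnit_of_det_ne_zero hw
    exact ⟨Ring.mul_inverse_cancel _ this, Ring.inverse_mul_cancel _ this⟩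
  have hA' : AnalyticAt ℂ (fun w => A w ∘L residualInv (κ w) E ∘L E.subtypeL) w₀ :=
    analyticAt_clm_comp hA (analyticAt_clm_comp hT analyticAt_const)
  -- With `T` the residual inverse and `Π` the projection onto `E`, `A (1 + K)⁻¹ B` is the analytic
  -- `A T B` minus `(A T ι) m⁻¹ (Π K T B)`. The space `W` is chosen before `B`.
  obtain ⟨W, hW, hWn, hP⟩ := exists_polarIn_of_analyticOrderAt_det (Y := H) n w₀ m
    (fun w => Ring.inverse (m w)) (fun w => A w ∘L residualInv (κ w) E ∘L E.subtypeL) hm hA' hinv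
    hn.symm
  refine ⟨W, hW, ?_, fun B hB => ?_⟩
  · rw [← hn]
    simpa using hWn
  · have hB' : AnalyticAt ℂ
        (fun w => -(E.orthogonalProjectionOnto ∘L κ w ∘L residualInv (κ w) E ∘L B w)) w₀ :=
      (analyticAt_clm_comp analyticAt_const (analyticAt_clm_comp hκ
        (analyticAt_clm_comp hT hB))).neg
    have h1 : AnalyticAt ℂ (fun w => A w ∘L residualInv (κ w) E ∘L B w) w₀ :=
      analyticAt_clm_comp hA (analyticAt_clm_comp hT hB)
    have h2 := ((PolarIn.of_analyticAt (W := W) h1).add (hP _ hB')).mono (sup_le le_rfl le_rfl)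
    refine h2.congr ?_
    filter_upwards [hinv, hQ.filter_mono nhdsWithin_le_nhds] with w hw hQw
    rw [(isInverse_of_schurComplement hQw hw.1 hw.2).1]
    ext x
    simp [hmdef, sub_eq_add_neg]

end Reduction

end DiracResonance

end

noncomputable section

namespace DiracResonance

/-! ### Multiplication by bounded matrix functions -/

section MultiplicationOperators

/-- Bounded measurable matrix-valued functions. -/
def IsSymbol (a : Space → Spinor →L[ℂ] Spinor) : Prop :=
  StronglyMeasurable a ∧ ∃ C, ∀ x, ‖a x‖ ≤ C

theorem IsSymbol.memLp {a : Space → Spinor →L[ℂ] Spinor} (ha : IsSymbol a) :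
    MemLp a ∞ (volume : Measure Space) := by
  obtain ⟨h, C, hC⟩ := ha
  exact memLp_top_of_bound h.aestronglyMeasurable C (ae_of_all _ hC)

theorem IsSymbol.add {a b : Space → Spinor →L[ℂ] Spinor} (ha : IsSymbol a) (hb : IsSymbol b) :
    IsSymbol (fun x => a x + b x) := by
  obtain ⟨h, C, hC⟩ := ha
  obtain ⟨h', C', hC'⟩ := hb
  exact ⟨h.add h', C + C', fun x => (norm_add_le _ _).trans (add_le_add (hC x) (hC' x))⟩

theorem IsSymbol.smul {a : Space → Spinor →L[ℂ] Spinor} (ha : IsSymbol a) {b : Space → ℂ}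
    (hb : StronglyMeasurable b) {C : ℝ} (hC : ∀ x, ‖b x‖ ≤ C) :
    IsSymbol (fun x => b x • a x) := by
  obtain ⟨h, C', hC'⟩ := ha
  refine ⟨hb.smul h, C * C', fun x => ?_⟩
  rw [norm_smul]
  exact mul_le_mul (hC x) (hC' x) (norm_nonneg _) ((norm_nonneg _).trans (hC x))

theorem IsSymbol.const (a : Spinor →L[ℂ] Spinor) : IsSymbol (fun _ => a) :=
  ⟨stronglyMeasurable_const, ‖a‖, fun _ => le_rfl⟩

theorem isSymbol_scalar {b : Space → ℂ} (hb : StronglyMeasurable b) {C : ℝ}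
    (hC : ∀ x, ‖b x‖ ≤ C) : IsSymbol (fun x => b x • (1 : Spinor →L[ℂ] Spinor)) :=
  (IsSymbol.const 1).smul hb hC

open Classical in
/-- Pointwise multiplication by a bounded measurable matrix-valued function. -/
def mulOp (a : Space → Spinor →L[ℂ] Spinor) : L2 →L[ℂ] L2 :=
  if h : IsSymbol a then
    (ContinuousLinearMap.id ℂ (Spinor →L[ℂ] Spinor)).holderL (volume : Measure Space) ∞ 2 2
      (h.memLp.toLp a)
  else 0

theorem coeFn_mulOp {a : Space → Spinor →L[ℂ] Spinor} (ha : IsSymbol a) (u : L2) :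
    mulOp a u =ᵐ[volume] fun x => a x (u x) := by
  have h1 : mulOp a u = (ContinuousLinearMap.id ℂ (Spinor →L[ℂ] Spinor)).holder 2
      (ha.memLp.toLp a) u := by
    unfold mulOp
    rw [dif_pos ha]
    rfl
  rw [h1]
  filter_upwards [(ContinuousLinearMap.id ℂ (Spinor →L[ℂ] Spinor)).coeFn_holder (r := 2)
    (ha.memLp.toLp a) u, ha.memLp.coeFn_toLp] with x hx hx'
  rw [hx, hx']
  rfl

theorem norm_mulOp_apply_le {a : Space → Spinor →L[ℂ] Spinor} {C : ℝ}
    (hm : StronglyMeasurable a) (hC : ∀ x, ‖a x‖ ≤ C) (u : L2) : ‖mulOp a u‖ ≤ C * ‖u‖ := by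
  refine Lp.norm_le_mul_norm_of_ae_le_mul ?_
  filter_upwards [coeFn_mulOp ⟨hm, C, hC⟩ u] with x hx
  rw [hx]
  exact (ContinuousLinearMap.le_opNorm _ _).trans (by gcongr; exact hC x)

theorem mulOp_add {a b : Space → Spinor →L[ℂ] Spinor} (ha : IsSymbol a) (hb : IsSymbol b) :
    mulOp (fun x => a x + b x) = mulOp a + mulOp b := by
  ext1 u
  apply Lp.ext
  filter_upwards [coeFn_mulOp (ha.add hb) u, coeFn_mulOp ha u, coeFn_mulOp hb u,
    Lp.coeFn_add (mulOp a u) (mulOp b u)] with x h1 h2 h3 h4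
  change _ = (mulOp a u + mulOp b u : L2) x
  rw [h1, h4, Pi.add_apply, h2, h3]
  rfl

theorem mulOp_const_smul {a : Space → Spinor →L[ℂ] Spinor} (ha : IsSymbol a) (c : ℂ) :
    mulOp (fun x => c • a x) = c • mulOp a := by
  ext1 u
  apply Lp.ext
  have hc : IsSymbol (fun x => c • a x) :=
    ha.smul (b := fun _ => c) stronglyMeasurable_const (fun _ => le_rfl)
  filter_upwards [coeFn_mulOp hc u, coeFn_mulOp ha u, Lp.coeFn_smul c (mulOp a u)] with x h1 h2 h3
  change _ = (c • mulOp a u : L2) x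
  rw [h1, h3, Pi.smul_apply, h2]
  rfl

theorem inner_mulOp {a : Space → Spinor →L[ℂ] Spinor} (ha : IsSymbol a) (v u : L2) :
    inner ℂ v (mulOp a u) = ∫ x, inner ℂ (v x) (a x (u x)) := by
  rw [L2.inner_def]
  refine integral_congr_ae ?_
  filter_upwards [coeFn_mulOp ha u] with x hx
  rw [hx]

theorem Cutoff.mul_eq_mulOp {V : Space → Matrix (Fin 4) (Fin 4) ℂ} (χ : Cutoff V) :
    χ.mul = mulOp (fun x => χ.toFun x • (1 : Spinor →L[ℂ] Spinor)) := by
  obtain ⟨C, hC⟩ := χ.hasCompactSupport.exists_bound_of_continuous χ.smooth.continuous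
  have hs := isSymbol_scalar χ.smooth.continuous.stronglyMeasurable hC
  have hm := χ.smooth.continuous.memLp_top_of_hasCompactSupport χ.hasCompactSupport
    (volume : Measure Space)
  ext1 u
  apply Lp.ext
  have h1 : χ.mul u = (ContinuousLinearMap.lsmul ℂ ℂ).holder 2 (hm.toLp χ.toFun) u := rfl
  rw [h1]
  filter_upwards [(ContinuousLinearMap.lsmul ℂ ℂ).coeFn_holder (r := 2) (hm.toLp χ.toFun) u,
    hm.coeFn_toLp, coeFn_mulOp hs u] with x hx hx' hx''
  rw [hx, hx', hx'']
  rfl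

end MultiplicationOperators

/-! ### Fourier multipliers, plane waves and translations on `L²` -/

section FourierMultipliers

/-- The Fourier transform on `L²(ℝ³; ℂ⁴)`. -/
abbrev fourierL2 : L2 ≃ₗᵢ[ℂ] L2 := Lp.fourierTransformₗᵢ Space Spinor

/-- The Fourier multiplier with symbol `a`. -/
def fourierOp (a : Space → Spinor →L[ℂ] Spinor) : L2 →L[ℂ] L2 :=
  (fourierL2.symm.toContinuousLinearEquiv : L2 →L[ℂ] L2) ∘L mulOp a ∘L
    (fourierL2.toContinuousLinearEquiv : L2 →L[ℂ] L2)

theorem fourierL2_fourierOp (a : Space → Spinor →L[ℂ] Spinor) (u : L2) :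
    fourierL2 (fourierOp a u) = mulOp a (fourierL2 u) :=
  fourierL2.apply_symm_apply _

theorem inner_fourierOp {a : Space → Spinor →L[ℂ] Spinor} (ha : IsSymbol a) (v u : L2) :
    inner ℂ v (fourierOp a u) = ∫ ξ, inner ℂ (fourierL2 v ξ) (a ξ (fourierL2 u ξ)) := by
  rw [← fourierL2.inner_map_map, fourierL2_fourierOp, inner_mulOp ha]

theorem norm_fourierOp_apply_le {a : Space → Spinor →L[ℂ] Spinor} {C : ℝ}
    (hm : StronglyMeasurable a) (hC : ∀ x, ‖a x‖ ≤ C) (u : L2) : ‖fourierOp a u‖ ≤ C * ‖u‖ := by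
  rw [← fourierL2.norm_map, fourierL2_fourierOp, ← fourierL2.norm_map u]
  exact norm_mulOp_apply_le hm hC _

theorem fourierOp_add {a b : Space → Spinor →L[ℂ] Spinor} (ha : IsSymbol a) (hb : IsSymbol b) :
    fourierOp (fun x => a x + b x) = fourierOp a + fourierOp b := by
  ext1 u
  apply fourierL2.injective
  change _ = fourierL2 (fourierOp a u + fourierOp b u)
  rw [map_add, fourierL2_fourierOp, fourierL2_fourierOp, fourierL2_fourierOp, mulOp_add ha hb]
  rfl

theorem fourierOp_const_smul {a : Space → Spinor →L[ℂ] Spinor} (ha : IsSymbol a) (c : ℂ) :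
    fourierOp (fun x => c • a x) = c • fourierOp a := by
  ext1 u
  apply fourierL2.injective
  change _ = fourierL2 (c • fourierOp a u)
  rw [map_smul, fourierL2_fourierOp, fourierL2_fourierOp, mulOp_const_smul ha]
  rfl

/-- Locally integrable functions with the same integrals against Schwartz functions agree. -/
theorem ae_eq_of_forall_integral_smul_eq {f g : Space → Spinor}
    (hf : LocallyIntegrable f) (hg : LocallyIntegrable g)
    (h : ∀ φ : 𝓢(Space, ℂ), ∫ x, φ x • f x = ∫ x, φ x • g x) : f =ᵐ[volume] g := by
  refine ae_eq_of_integral_contDiff_smul_eq hf hg fun φ hφ hc => ?_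
  have hc' : HasCompactSupport (Complex.ofRealCLM ∘ φ) := hc.comp_left rfl
  have hs : ContDiff ℝ ∞ (Complex.ofRealCLM ∘ φ) := Complex.ofRealCLM.contDiff.comp hφ
  have := h (hc'.toSchwartzMap hs)
  simpa using this

/-- The Fourier transform is injective on tempered distributions and turns `∂ⱼ` into multiplication
by `2πiξⱼ`. Both sides are then locally integrable functions, for which equality as distributions is
equality almost everywhere. -/
theorem isWeakPartial_iff (j : Fin 3) (u g : L2) : IsWeakPartial j u g ↔
    ∀ᵐ ξ, fourierL2 g ξ = (2 * Real.pi * Complex.I * (ξ j : ℂ)) • fourierL2 u ξ := by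
  have hinner : ∀ ξ : Space, inner ℝ ξ (EuclideanSpace.single j (1 : ℝ) : Space) = ξ j := by
    intro ξ
    rw [EuclideanSpace.inner_single_right]
    simp
  have hT : (fun ξ : Space => ((inner ℝ ξ (EuclideanSpace.single j (1 : ℝ) : Space) : ℝ) : ℂ)).HasTemperateGrowth := by
    fun_prop
  have h0 : IsWeakPartial j u g ↔ ∀ φ : 𝓢(Space, ℂ),
      ∫ ξ, φ ξ • ((2 * Real.pi * Complex.I * (ξ j : ℂ)) • fourierL2 u ξ)
        = ∫ ξ, φ ξ • fourierL2 g ξ := by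
    unfold IsWeakPartial
    have e1 : FourierTransform.fourier (∂_{(EuclideanSpace.single j (1 : ℝ) : Space)} (u : 𝓢'(Space, Spinor)))
        = (2 * Real.pi * Complex.I) • TemperedDistribution.smulLeftCLM Spinor
          (fun ξ => ((inner ℝ ξ (EuclideanSpace.single j (1 : ℝ) : Space) : ℝ) : ℂ)) ((fourierL2 u : L2) : 𝓢'(Space, Spinor)) := by
      rw [TemperedDistribution.fourier_lineDerivOp_eq, Lp.fourier_toTemperedDistribution_eq]
      rfl
    have e2 : FourierTransform.fourier (g : 𝓢'(Space, Spinor)) = ((fourierL2 g : L2) : 𝓢'(Space, Spinor)) := by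
      rw [Lp.fourier_toTemperedDistribution_eq]
      rfl
    have hev : ∀ φ : 𝓢(Space, ℂ), ((2 * Real.pi * Complex.I) • TemperedDistribution.smulLeftCLM
        Spinor (fun ξ => ((inner ℝ ξ (EuclideanSpace.single j (1 : ℝ) : Space) : ℝ) : ℂ))
          ((fourierL2 u : L2) : 𝓢'(Space, Spinor))) φ
        = ∫ ξ, φ ξ • ((2 * Real.pi * Complex.I * (ξ j : ℂ)) • fourierL2 u ξ) := by
      intro φ
      change (2 * Real.pi * Complex.I) • (TemperedDistribution.smulLeftCLM
        Spinor (fun ξ => ((inner ℝ ξ (EuclideanSpace.single j (1 : ℝ) : Space) : ℝ) : ℂ))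
          ((fourierL2 u : L2) : 𝓢'(Space, Spinor))) φ = _
      rw [TemperedDistribution.smulLeftCLM_apply_apply, Lp.toTemperedDistribution_apply,
        ← integral_smul]
      refine integral_congr_ae (ae_of_all _ fun ξ => ?_)
      dsimp only
      rw [SchwartzMap.smulLeftCLM_apply_apply hT, hinner, smul_smul, smul_smul, smul_eq_mul]
      congr 1
      ring
    constructor
    · intro h φ
      have h1 := congrArg FourierTransform.fourier h
      rw [e1, e2] at h1
      have h2 := congrArg (fun T : 𝓢'(Space, Spinor) => T φ) h1
      rw [hev] at h2
      simpa using h2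
    · intro h
      have hinj : Function.Injective
          (FourierTransform.fourier : 𝓢'(Space, Spinor) → 𝓢'(Space, Spinor)) :=
        Function.LeftInverse.injective (g := FourierTransformInv.fourierInv)
          fun f => FourierPair.fourierInv_fourier_eq f
      apply hinj
      rw [e1, e2]
      ext1 φ
      rw [hev, h φ]
      simp
  rw [h0]
  constructor
  · intro h
    refine (ae_eq_of_forall_integral_smul_eq ?_ ?_ h).symm
    · refine (locallyIntegrable_iff).2 fun k hk => ?_
      refine IntegrableOn.continuousOn_smul
        (((Lp.memLp (fourierL2 u)).locallyIntegrable (by norm_num)).integrableOn_isCompact hk)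
        ?_ hk
      fun_prop
    · exact (Lp.memLp _).locallyIntegrable (by norm_num)
  · intro h φ
    refine integral_congr_ae ?_
    filter_upwards [h] with ξ hξ
    rw [hξ]

theorem integral_smul_fourierL2 (u : L2) (φ : 𝓢(Space, ℂ)) :
    ∫ ξ, φ ξ • fourierL2 u ξ = ∫ x, (FourierTransform.fourier φ : 𝓢(Space, ℂ)) x • u x := by
  have h := Lp.fourier_toTemperedDistribution_eq u
  have h2 := congrArg (fun T : 𝓢'(Space, Spinor) => T φ) h
  simp only [TemperedDistribution.fourier_apply, Lp.toTemperedDistribution_apply] at h2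
  exact h2.symm

theorem integrable_schwartz_smul (φ : 𝓢(Space, ℂ)) (u : L2) :
    Integrable (fun x => φ x • u x) :=
  memLp_one_iff_integrable.1 ((Lp.memLp u).smul (φ.memLp 2 volume) (r := 1))

/-- Constant matrices commute with the Fourier transform: after testing against a Schwartz function
they come out of the integral on both sides. -/
theorem fourierOp_const (a : Spinor →L[ℂ] Spinor) :
    fourierOp (fun _ => a) = mulOp (fun _ => a) := by
  ext1 u
  apply fourierL2.injective
  rw [fourierL2_fourierOp]
  apply Lp.ext
  have hloc : ∀ v : L2, LocallyIntegrable v (volume : Measure Space) :=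
    fun v => (Lp.memLp v).locallyIntegrable (by norm_num)
  refine ae_eq_of_forall_integral_smul_eq (hloc _) (hloc _) fun φ => ?_
  rw [integral_smul_fourierL2]
  have e1 : ∫ ξ, φ ξ • mulOp (fun _ => a) (fourierL2 u) ξ = a (∫ ξ, φ ξ • fourierL2 u ξ) := by
    rw [← ContinuousLinearMap.integral_comp_comm _ (integrable_schwartz_smul φ _)]
    refine integral_congr_ae ?_
    filter_upwards [coeFn_mulOp (IsSymbol.const a) (fourierL2 u)] with x hx
    rw [hx, map_smul]
  have e2 : ∫ x, (FourierTransform.fourier φ : 𝓢(Space, ℂ)) x • mulOp (fun _ => a) u x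
      = a (∫ x, (FourierTransform.fourier φ : 𝓢(Space, ℂ)) x • u x) := by
    rw [← ContinuousLinearMap.integral_comp_comm _ (integrable_schwartz_smul _ _)]
    refine integral_congr_ae ?_
    filter_upwards [coeFn_mulOp (IsSymbol.const a) u] with x hx
    rw [hx, map_smul]
  rw [e1, e2, integral_smul_fourierL2]

/-- The pairing of `u` with the plane wave of complex frequency `ζ`. -/
def planeWave (ζ : Fin 3 → ℂ) (x : Space) : ℂ := Complex.exp (-Complex.I * ∑ i, ζ i * (x i : ℂ))

theorem continuous_planeWave (ζ : Fin 3 → ℂ) : Continuous (planeWave ζ) := by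
  unfold planeWave
  fun_prop

theorem fourier_eq_planeWave {F : Type*} [NormedAddCommGroup F] [NormedSpace ℂ F]
    (f : Space → F) (ξ : Space) : FourierTransform.fourier f ξ
      = ∫ x, planeWave (fun i => 2 * Real.pi * (ξ i : ℂ)) x • f x := by
  rw [Real.fourier_eq']
  refine integral_congr_ae (ae_of_all _ fun x => ?_)
  dsimp only [planeWave]
  congr 2
  simp only [PiLp.inner_apply, RCLike.inner_apply, conj_trivial]
  push_cast
  rw [Finset.mul_sum, Finset.sum_mul, Finset.mul_sum]
  refine Finset.sum_congr rfl fun i _ => ?_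
  ring

/-- On integrable elements of `L²`, the Fourier transform is given by the integral. -/
theorem fourierL2_ae_eq {u : L2} (hu : Integrable u (volume : Measure Space)) :
    fourierL2 u =ᵐ[volume] fun ξ => ∫ x, planeWave (fun i => 2 * Real.pi * (ξ i : ℂ)) x • u x := by
  have h0 : (fun ξ : Space => ∫ x, planeWave (fun i => 2 * Real.pi * (ξ i : ℂ)) x • u x)
      = FourierTransform.fourier (u : Space → Spinor) := by
    funext ξ
    rw [fourier_eq_planeWave]
  rw [h0]
  have hcont : Continuous (FourierTransform.fourier (u : Space → Spinor)) :=
    VectorFourier.fourierIntegral_continuous Real.continuous_fourierChar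
      (by exact continuous_inner) hu
  refine ae_eq_of_forall_integral_smul_eq ((Lp.memLp _).locallyIntegrable (by norm_num))
    hcont.locallyIntegrable fun φ => ?_
  rw [integral_smul_fourierL2]
  have h1 := VectorFourier.integral_fourierIntegral_smul_eq_flip (L := innerₗ Space)
    (f := (φ : Space → ℂ)) (g := (u : Space → Spinor)) (μ := volume) (ν := volume)
    Real.continuous_fourierChar (by exact continuous_inner) φ.integrable hu
  rw [flip_innerₗ] at h1
  exact h1

/-- Translation on `L²`. -/
def translate (z : Space) : L2 →L[ℂ] L2 :=
  (Lp.compMeasurePreservingₗᵢ ℂ (fun x : Space => x - z)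
    (measurePreserving_sub_right volume z)).toContinuousLinearMap

theorem coeFn_translate (z : Space) (u : L2) : translate z u =ᵐ[volume] fun x => u (x - z) :=
  Lp.coeFn_compMeasurePreserving _ (measurePreserving_sub_right volume z)

theorem norm_planeWave_real (ξ x : Space) :
    ‖planeWave (fun i => 2 * Real.pi * (ξ i : ℂ)) x‖ = 1 := by
  unfold planeWave
  have : -Complex.I * ∑ i, 2 * Real.pi * (ξ i : ℂ) * (x i : ℂ)
      = ((-∑ i, 2 * Real.pi * ξ i * x i : ℝ) : ℂ) * Complex.I := by
    push_cast
    ring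
  rw [this, Complex.norm_exp_ofReal_mul_I]

theorem planeWave_comm (ξ x : Space) :
    planeWave (fun i => 2 * Real.pi * (ξ i : ℂ)) x
      = planeWave (fun i => 2 * Real.pi * (x i : ℂ)) ξ := by
  unfold planeWave
  congr 2
  refine Finset.sum_congr rfl fun i _ => ?_
  ring

/-- Both sides are continuous in `u`, so it suffices to take Schwartz functions, where the transform
is an integral and the claim is a change of variables. -/
theorem fourierL2_translate (z : Space) (u : L2) :
    fourierL2 (translate z u)
      = mulOp (fun ξ => planeWave (fun i => 2 * Real.pi * (z i : ℂ)) ξ • 1) (fourierL2 u) := by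
  have hs : IsSymbol (fun ξ => planeWave (fun i => 2 * Real.pi * (z i : ℂ)) ξ
      • (1 : Spinor →L[ℂ] Spinor)) :=
    isSymbol_scalar (continuous_planeWave _).stronglyMeasurable
      (fun ξ => (norm_planeWave_real z ξ).le)
  have hd := SchwartzMap.denseRange_toLpCLM (E := Space) (F := Spinor) (p := 2) (by norm_num)
    (μ := volume)
  refine hd.induction_on (p := fun u => fourierL2 (translate z u)
      = mulOp (fun ξ => planeWave (fun i => 2 * Real.pi * (z i : ℂ)) ξ • 1) (fourierL2 u)) u
    (isClosed_eq (by fun_prop) (by fun_prop)) fun φ => ?_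
  have e1 : translate z (φ.toLp 2 volume : L2)
      = ((φ.compSubConstCLM ℝ z).toLp 2 volume : L2) := by
    apply Lp.ext
    have h1 := (measurePreserving_sub_right (volume : Measure Space) z).quasiMeasurePreserving.ae_eq_comp
      (φ.coeFn_toLp 2 volume)
    filter_upwards [coeFn_translate z (φ.toLp 2 volume : L2), h1,
      (φ.compSubConstCLM ℝ z).coeFn_toLp 2 volume] with x hx hx1 hx2
    rw [hx, hx2]
    exact hx1
  change fourierL2 (translate z (φ.toLp 2 volume : L2)) = mulOp _ (fourierL2 (φ.toLp 2 volume : L2))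
  rw [e1]
  have e2 : ∀ ψ : 𝓢(Space, Spinor), fourierL2 (ψ.toLp 2 volume : L2)
      = ((FourierTransform.fourier ψ : 𝓢(Space, Spinor)).toLp 2 volume : L2) :=
    fun ψ => SchwartzMap.toLp_fourier_eq ψ
  rw [e2, e2]
  apply Lp.ext
  filter_upwards [(FourierTransform.fourier (φ.compSubConstCLM ℝ z) : 𝓢(Space, Spinor)).coeFn_toLp 2 volume,
    (FourierTransform.fourier φ : 𝓢(Space, Spinor)).coeFn_toLp 2 volume,
    coeFn_mulOp hs ((FourierTransform.fourier φ : 𝓢(Space, Spinor)).toLp 2 volume : L2)]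
    with ξ h1 h2 h3
  rw [h1, h3, h2, SchwartzMap.fourier_coe, SchwartzMap.fourier_coe, fourier_eq_planeWave,
    fourier_eq_planeWave]
  have e3 : ∫ x, planeWave (fun i => 2 * Real.pi * (ξ i : ℂ)) x • (φ.compSubConstCLM ℝ z) x
      = ∫ x, planeWave (fun i => 2 * Real.pi * (ξ i : ℂ)) (x + z) • φ x := by
    rw [← integral_add_right_eq_self _ z]
    simp
  rw [e3]
  change _ = planeWave (fun i => 2 * Real.pi * (z i : ℂ)) ξ •
    (∫ x, planeWave (fun i => 2 * Real.pi * (ξ i : ℂ)) x • φ x : Spinor)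
  rw [← integral_smul]
  refine integral_congr_ae (ae_of_all _ fun x => ?_)
  dsimp only
  rw [smul_smul, planeWave_comm z ξ]
  congr 1
  unfold planeWave
  rw [← Complex.exp_add]
  congr 1
  simp only [PiLp.add_apply]
  push_cast
  rw [← mul_add, ← Finset.sum_add_distrib]
  congr 1
  refine Finset.sum_congr rfl fun i _ => ?_
  ring

end FourierMultipliers

end DiracResonance

end

noncomputable section

namespace DiracResonance

/-! ### The Dirac operator on the Fourier side -/

section DiracOperator

variable {α : Fin 4 → Matrix (Fin 4) (Fin 4) ℂ} {V : Space → Matrix (Fin 4) (Fin 4) ℂ}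

/-- A `4 × 4` matrix as an operator on spinors. -/
abbrev spinorOp (A : Matrix (Fin 4) (Fin 4) ℂ) : Spinor →L[ℂ] Spinor :=
  Matrix.toEuclideanCLM (n := Fin 4) (𝕜 := ℂ) A

/-- The coefficients `2πξ₁, 2πξ₂, 2πξ₃, 1`. -/
def symbolCoeff (ξ : Space) : Fin 4 → ℝ := Fin.snoc (fun j : Fin 3 => 2 * Real.pi * ξ j) 1

/-- The symbol of the free Dirac operator. -/
def diracSymbol (α : Fin 4 → Matrix (Fin 4) (Fin 4) ℂ) (ξ : Space) : Spinor →L[ℂ] Spinor :=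
  ∑ j : Fin 4, (symbolCoeff ξ j : ℂ) • spinorOp (α j)

theorem diracSymbol_apply (ξ : Space) (v : Spinor) : diracSymbol α ξ v
    = ∑ j : Fin 3, (2 * Real.pi * (ξ j : ℂ)) • spinorOp (α j.castSucc) v + spinorOp (α 3) v := by
  simp only [diracSymbol, Fin.sum_univ_castSucc, symbolCoeff, Fin.snoc_castSucc, Fin.snoc_last]
  simp [show Fin.last 3 = (3 : Fin 4) from rfl]

theorem sum_symbolCoeff_sq (ξ : Space) :
    ∑ j, symbolCoeff ξ j ^ 2 = (2 * Real.pi * ‖ξ‖) ^ 2 + 1 := by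
  simp only [Fin.sum_univ_castSucc, symbolCoeff, Fin.snoc_castSucc, Fin.snoc_last, mul_pow,
    EuclideanSpace.norm_sq_eq, Real.norm_eq_abs, sq_abs]
  simp only [Fin.sum_univ_zero]
  ring

/-- The Clifford relations: adding the double sum to its transpose leaves anticommutators, of which
only the diagonal ones survive. This computes twice the square, and the `2` is cancelled at the end.
-/
theorem diracSymbol_mul_self (hα : IsDiracMatrices α) (ξ : Space) :
    diracSymbol α ξ * diracSymbol α ξ = (((2 * Real.pi * ‖ξ‖) ^ 2 + 1 : ℝ) : ℂ) • 1 := by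
  have hanti : ∀ j k, spinorOp (α j) * spinorOp (α k) + spinorOp (α k) * spinorOp (α j)
      = if j = k then (2 : ℂ) • 1 else 0 := by
    intro j k
    rw [← map_mul, ← map_mul, ← map_add, hα.anticomm j k]
    split_ifs <;> simp
  have h1 : (2 : ℂ) • (diracSymbol α ξ * diracSymbol α ξ)
      = (2 : ℂ) • ((((2 * Real.pi * ‖ξ‖) ^ 2 + 1 : ℝ) : ℂ) • (1 : Spinor →L[ℂ] Spinor)) := by
    have e1 : diracSymbol α ξ * diracSymbol α ξ = ∑ j, ∑ k,
        ((symbolCoeff ξ j : ℂ) * symbolCoeff ξ k) • (spinorOp (α j) * spinorOp (α k)) := by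
      simp only [diracSymbol, Finset.sum_mul_sum, smul_mul_smul_comm]
    have e2 : diracSymbol α ξ * diracSymbol α ξ = ∑ j, ∑ k,
        ((symbolCoeff ξ j : ℂ) * symbolCoeff ξ k) • (spinorOp (α k) * spinorOp (α j)) := by
      rw [e1, Finset.sum_comm]
      refine Finset.sum_congr rfl fun j _ => Finset.sum_congr rfl fun k _ => ?_
      rw [mul_comm]
    refine (two_smul ℂ (diracSymbol α ξ * diracSymbol α ξ)).trans ?_
    nth_rewrite 1 [e1]
    rw [e2, ← Finset.sum_add_distrib]
    have e3 : ∀ j, ∑ k, ((symbolCoeff ξ j : ℂ) * symbolCoeff ξ k) • (spinorOp (α j) * spinorOp (α k))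
        + ∑ k, ((symbolCoeff ξ j : ℂ) * symbolCoeff ξ k) • (spinorOp (α k) * spinorOp (α j))
        = ((symbolCoeff ξ j : ℂ) * symbolCoeff ξ j * 2) • (1 : Spinor →L[ℂ] Spinor) := by
      intro j
      rw [← Finset.sum_add_distrib, Finset.sum_eq_single j]
      · refine (smul_add _ _ _).symm.trans ?_
        rw [hanti, if_pos rfl, smul_smul]
      · intro k _ hk
        refine (smul_add _ _ _).symm.trans ?_
        rw [hanti, if_neg (Ne.symm hk)]
        exact smul_zero _
      · simp
    rw [Finset.sum_congr rfl fun j _ => e3 j, ← Finset.sum_smul, ← sum_symbolCoeff_sq, smul_smul]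
    congr 1
    push_cast
    rw [Finset.mul_sum]
    exact Finset.sum_congr rfl fun j _ => by ring
  exact smul_right_injective _ (two_ne_zero' ℂ) h1

theorem adjoint_diracSymbol (hα : IsDiracMatrices α) (ξ : Space) :
    ContinuousLinearMap.adjoint (diracSymbol α ξ) = diracSymbol α ξ := by
  have hj : ∀ j, ContinuousLinearMap.adjoint (spinorOp (α j)) = spinorOp (α j) := by
    intro j
    have h : star (α j) = α j := hα.isHermitian j
    refine (map_star (Matrix.toEuclideanCLM (n := Fin 4) (𝕜 := ℂ)) (α j)).symm.trans ?_
    rw [h]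
  unfold diracSymbol
  rw [map_sum]
  refine Finset.sum_congr rfl fun j _ => ?_
  rw [map_smulₛₗ, hj, Complex.conj_ofReal]

/-- The symbol is self-adjoint with scalar square, hence a multiple of an isometry. The equality
gives ellipticity as well as the upper bound. -/
theorem norm_diracSymbol_apply_sq (hα : IsDiracMatrices α) (ξ : Space) (v : Spinor) :
    ‖diracSymbol α ξ v‖ ^ 2 = ((2 * Real.pi * ‖ξ‖) ^ 2 + 1) * ‖v‖ ^ 2 := by
  have h1 : inner ℂ (diracSymbol α ξ v) (diracSymbol α ξ v)
      = ((((2 * Real.pi * ‖ξ‖) ^ 2 + 1) * ‖v‖ ^ 2 : ℝ) : ℂ) := by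
    have h2 := ContinuousLinearMap.adjoint_inner_right (diracSymbol α ξ) v (diracSymbol α ξ v)
    have h3 : ContinuousLinearMap.adjoint (diracSymbol α ξ) = diracSymbol α ξ :=
      adjoint_diracSymbol hα ξ
    rw [h3] at h2
    have h4 : diracSymbol α ξ (diracSymbol α ξ v)
        = (((2 * Real.pi * ‖ξ‖) ^ 2 + 1 : ℝ) : ℂ) • v :=
      DFunLike.congr_fun (diracSymbol_mul_self hα ξ) v
    rw [← h2, h4, inner_smul_right, inner_self_eq_norm_sq_to_K]
    push_cast
    rfl
  rw [inner_self_eq_norm_sq_to_K] at h1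
  refine Complex.ofReal_injective (Eq.trans ?_ h1)
  exact Complex.ofReal_pow _ _

theorem norm_diracSymbol_le (hα : IsDiracMatrices α) (ξ : Space) :
    ‖diracSymbol α ξ‖ ≤ Real.sqrt ((2 * Real.pi * ‖ξ‖) ^ 2 + 1) := by
  refine ContinuousLinearMap.opNorm_le_bound _ (Real.sqrt_nonneg _) fun v => ?_
  rw [← Real.sqrt_sq (norm_nonneg v), ← Real.sqrt_mul (by positivity),
    ← norm_diracSymbol_apply_sq hα, Real.sqrt_sq (norm_nonneg _)]

theorem continuous_diracSymbol : Continuous (diracSymbol α) := by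
  have : diracSymbol α = fun ξ : Space =>
      ∑ j : Fin 3, (2 * Real.pi * (ξ j : ℂ)) • spinorOp (α j.castSucc) + spinorOp (α 3) := by
    funext ξ
    ext1 v
    rw [diracSymbol_apply]
    simp
  rw [this]
  fun_prop

/-- The potential as a matrix-valued multiplier. -/
def potentialSymbol (V : Space → Matrix (Fin 4) (Fin 4) ℂ) (x : Space) : Spinor →L[ℂ] Spinor :=
  spinorOp (V x)

theorem IsPotential.continuous (hV : IsPotential V) : Continuous (potentialSymbol V) := by
  have h1 : Continuous V := continuous_matrix fun i j => (hV.smooth i j).continuous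
  exact (LinearMap.continuous_of_finiteDimensional
    (Matrix.toEuclideanCLM (n := Fin 4) (𝕜 := ℂ)).toAlgEquiv.toLinearMap).comp h1

theorem IsPotential.isSymbol (hV : IsPotential V) : IsSymbol (potentialSymbol V) := by
  have hc : HasCompactSupport (potentialSymbol V) :=
    hV.hasCompactSupport.comp_left (g := spinorOp) (map_zero _)
  exact ⟨hV.continuous.stronglyMeasurable,
    hc.exists_bound_of_continuous hV.continuous⟩

theorem fourierL2_mulOp_const (a : Spinor →L[ℂ] Spinor) (u : L2) :
    fourierL2 (mulOp (fun _ => a) u) = mulOp (fun _ => a) (fourierL2 u) := by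
  rw [← fourierOp_const, fourierL2_fourierOp, fourierOp_const]

/-- No separate `H¹` condition is needed on the right: `|D(ξ)v|` dominates every `2π|ξⱼ||v|`, so
`D(ξ)û ∈ L²` already forces all weak derivatives into `L²`. -/
theorem diracGraph_iff (hα : IsDiracMatrices α) (hV : IsPotential V) (u f : L2) :
    DiracGraph α V u f ↔ ∀ᵐ ξ, fourierL2 (f - mulOp (potentialSymbol V) u) ξ
      = diracSymbol α ξ (fourierL2 u ξ) := by
  -- the differential expression in `L²`
  let Du : (Fin 3 → L2) → L2 := fun g =>
    ∑ j : Fin 3, mulOp (fun _ => (-Complex.I) • spinorOp (α j.castSucc)) (g j)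
      + mulOp (fun _ => spinorOp (α 3)) u
  have hDu : ∀ g, (∀ᵐ x, f x = (-Complex.I) • (∑ j : Fin 3,
      Matrix.toEuclideanLin (α j.castSucc) (g j x)) + Matrix.toEuclideanLin (α 3) (u x)
        + Matrix.toEuclideanLin (V x) (u x)) ↔ f - mulOp (potentialSymbol V) u = Du g := by
    intro g
    have h2 : (f - mulOp (potentialSymbol V) u = Du g) ↔
        f =ᵐ[volume] (Du g + mulOp (potentialSymbol V) u : L2) :=
      sub_eq_iff_eq_add.trans Lp.ext_iff
    rw [h2]
    have h1 : (Du g + mulOp (potentialSymbol V) u : L2) =ᵐ[volume] fun x =>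
        (-Complex.I) • (∑ j : Fin 3, Matrix.toEuclideanLin (α j.castSucc) (g j x))
          + Matrix.toEuclideanLin (α 3) (u x) + Matrix.toEuclideanLin (V x) (u x) := by
      have hj : ∀ᵐ x, ∀ j : Fin 3, mulOp (fun _ => (-Complex.I) • spinorOp (α j.castSucc)) (g j) x
          = ((-Complex.I) • spinorOp (α j.castSucc)) (g j x) :=
        ae_all_iff.2 fun j => coeFn_mulOp (IsSymbol.const _) (g j)
      filter_upwards [Lp.coeFn_add (Du g) (mulOp (potentialSymbol V) u),
        Lp.coeFn_add (∑ j : Fin 3, mulOp (fun _ => (-Complex.I) • spinorOp (α j.castSucc)) (g j))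
          (mulOp (fun _ => spinorOp (α 3)) u), coeFn_mulOp hV.isSymbol u,
        coeFn_mulOp (IsSymbol.const (spinorOp (α 3))) u, hj,
        Lp.coeFn_finsetSum Finset.univ
          (fun j : Fin 3 => mulOp (fun _ => (-Complex.I) • spinorOp (α j.castSucc)) (g j))]
        with x a1 a2 a3 a4 a5 a6
      rw [a1, Pi.add_apply, a3, a2, Pi.add_apply, a4, a6, Finset.sum_apply]
      simp only [a5]
      rw [Finset.smul_sum]
      rfl
    exact ⟨fun h => EventuallyEq.trans h h1.symm, fun h => EventuallyEq.trans h h1⟩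
  have hF : ∀ g : Fin 3 → L2, (∀ j, IsWeakPartial j u (g j)) →
      ∀ᵐ ξ, fourierL2 (Du g) ξ = diracSymbol α ξ (fourierL2 u ξ) := by
    intro g hg
    have e1 : fourierL2 (Du g)
        = ∑ j : Fin 3, mulOp (fun _ => (-Complex.I) • spinorOp (α j.castSucc)) (fourierL2 (g j))
          + mulOp (fun _ => spinorOp (α 3)) (fourierL2 u) := by
      simp only [Du, map_add, map_sum, fourierL2_mulOp_const]
    rw [e1]
    have hj : ∀ᵐ x, ∀ j : Fin 3,
        mulOp (fun _ => (-Complex.I) • spinorOp (α j.castSucc)) (fourierL2 (g j)) x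
          = ((-Complex.I) • spinorOp (α j.castSucc)) (fourierL2 (g j) x) :=
      ae_all_iff.2 fun j => coeFn_mulOp (IsSymbol.const _) _
    filter_upwards [Lp.coeFn_add (∑ j : Fin 3, mulOp
        (fun _ => (-Complex.I) • spinorOp (α j.castSucc)) (fourierL2 (g j)))
        (mulOp (fun _ => spinorOp (α 3)) (fourierL2 u)),
      coeFn_mulOp (IsSymbol.const (spinorOp (α 3))) (fourierL2 u), hj,
      Lp.coeFn_finsetSum Finset.univ
        (fun j : Fin 3 => mulOp (fun _ => (-Complex.I) • spinorOp (α j.castSucc)) (fourierL2 (g j))),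
      ae_all_iff.2 fun j => (isWeakPartial_iff j u (g j)).1 (hg j)] with ξ a1 a2 a3 a4 a5
    rw [a1, Pi.add_apply, a2, a4, diracSymbol_apply]
    congr 1
    rw [Finset.sum_apply]
    refine Finset.sum_congr rfl fun j _ => ?_
    rw [a3, a5 j]
    change (-Complex.I) • spinorOp (α j.castSucc)
      ((2 * Real.pi * Complex.I * (ξ j : ℂ)) • fourierL2 u ξ) = _
    rw [map_smul, smul_smul]
    congr 1
    linear_combination (-(2 * Real.pi * (ξ j : ℂ))) * Complex.I_sq
  constructor
  · rintro ⟨g, hg, hf⟩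
    rw [(hDu g).1 hf]
    exact hF g hg
  · intro h
    have hmem : ∀ j : Fin 3, MemLp (fun ξ : Space =>
        (2 * Real.pi * Complex.I * (ξ j : ℂ)) • fourierL2 u ξ) 2 volume := by
      intro j
      refine MemLp.mono (Lp.memLp (fourierL2 (f - mulOp (potentialSymbol V) u))) ?_ ?_
      · have hm : AEStronglyMeasurable
            (fun ξ : Space => 2 * Real.pi * Complex.I * (ξ j : ℂ)) volume :=
          Continuous.aestronglyMeasurable (by fun_prop)
        exact hm.smul (Lp.aestronglyMeasurable _)
      · filter_upwards [h] with ξ hξ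
        rw [hξ]
        refine abs_le_of_sq_le_sq' ?_ (norm_nonneg _) |>.2
        rw [norm_diracSymbol_apply_sq hα, norm_smul, mul_pow]
        gcongr
        have e1 : ‖2 * (Real.pi : ℂ) * Complex.I * (ξ j : ℂ)‖ = 2 * Real.pi * |ξ j| := by
          simp [abs_of_pos Real.pi_pos]
        rw [e1]
        have e2 : |ξ j| ≤ ‖ξ‖ := PiLp.norm_apply_le ξ j
        have e3 : (2 * Real.pi * |ξ j|) ^ 2 ≤ (2 * Real.pi * ‖ξ‖) ^ 2 := by
          have := Real.pi_pos
          gcongr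
        linarith
    let g : Fin 3 → L2 := fun j => fourierL2.symm ((hmem j).toLp _)
    have hg : ∀ j, IsWeakPartial j u (g j) := by
      intro j
      rw [isWeakPartial_iff]
      simp only [g, LinearIsometryEquiv.apply_symm_apply]
      exact (hmem j).coeFn_toLp
    refine ⟨g, hg, (hDu g).2 ?_⟩
    apply fourierL2.injective
    apply Lp.ext
    filter_upwards [h, hF g hg] with ξ h1 h2
    rw [h1, h2]

end DiracOperator

end DiracResonance

end

noncomputable section

namespace DiracResonance

/-! ### The functions `λ` and `κ` on the Riemann surface -/

section SpectralParameters

/-- The momentum `κ = √(λ² - 1)` in the global coordinate `w = λ + κ`. -/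
def momentum (w : ℂ) : ℂ := (w - w⁻¹) / 2

theorem momentum_sq {w : ℂ} (hw : w ≠ 0) : momentum w ^ 2 = spectralParam w ^ 2 - 1 := by
  unfold momentum spectralParam
  field_simp
  ring

theorem momentum_im (w : ℂ) : (momentum w).im = w.im * (1 + (Complex.normSq w)⁻¹) / 2 := by
  have h : (momentum w).im = (w.im - (w⁻¹).im) / 2 := by
    unfold momentum
    rw [show (2 : ℂ) = ((2 : ℝ) : ℂ) by norm_num, Complex.div_ofReal_im, Complex.sub_im]
  rw [h, Complex.inv_im]
  ring

theorem momentum_im_pos {w : ℂ} (hw : 0 < w.im) : 0 < (momentum w).im := by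
  rw [momentum_im]
  have := Complex.normSq_nonneg w
  positivity

/-- From `λ² = κ² + 1`. It allows the later estimates to be expressed in terms of `|κ|` alone. -/
theorem norm_spectralParam_le {w : ℂ} (hw : w ≠ 0) : ‖spectralParam w‖ ≤ ‖momentum w‖ + 1 := by
  have h := momentum_sq hw
  have h1 : ‖spectralParam w‖ ^ 2 ≤ ‖momentum w‖ ^ 2 + 1 := by
    rw [← norm_pow, show spectralParam w ^ 2 = momentum w ^ 2 + 1 by rw [h]; ring, ← norm_pow]
    exact (norm_add_le _ _).trans (by simp)
  nlinarith [norm_nonneg (momentum w), norm_nonneg (spectralParam w)]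

theorem analyticAt_momentum {w : ℂ} (hw : w ≠ 0) : AnalyticAt ℂ momentum w :=
  (analyticAt_id.sub (analyticAt_inv hw)).div_const

theorem analyticAt_spectralParam {w : ℂ} (hw : w ≠ 0) : AnalyticAt ℂ spectralParam w :=
  (analyticAt_id.add (analyticAt_inv hw)).div_const

end SpectralParameters

/-! ### The free resolvent and the resolvent identities -/

section FreeResolvent

variable {α : Fin 4 → Matrix (Fin 4) (Fin 4) ℂ} {V : Space → Matrix (Fin 4) (Fin 4) ℂ}

/-- The frequency `|2πξ|`. -/
def freq (ξ : Space) : ℝ := 2 * Real.pi * ‖ξ‖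

theorem freq_nonneg (ξ : Space) : 0 ≤ freq ξ := by
  have := Real.pi_pos
  unfold freq
  positivity

theorem continuous_freq : Continuous freq := by
  unfold freq
  fun_prop

theorem norm_diracSymbol_le_freq (hα : IsDiracMatrices α) (ξ : Space) :
    ‖diracSymbol α ξ‖ ≤ freq ξ + 1 := by
  refine (norm_diracSymbol_le hα ξ).trans (Real.sqrt_le_iff.2 ⟨?_, ?_⟩)
  · linarith [freq_nonneg ξ]
  · have := freq_nonneg ξ
    change freq ξ ^ 2 + 1 ≤ _
    nlinarith

/-- `D(ξ) + λ`. -/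
def shiftedSymbol (α : Fin 4 → Matrix (Fin 4) (Fin 4) ℂ) (z : ℂ) (ξ : Space) :
    Spinor →L[ℂ] Spinor := diracSymbol α ξ + z • 1

theorem norm_shiftedSymbol_le (hα : IsDiracMatrices α) (z : ℂ) (ξ : Space) :
    ‖shiftedSymbol α z ξ‖ ≤ freq ξ + 1 + ‖z‖ := by
  refine (norm_add_le _ _).trans (add_le_add (norm_diracSymbol_le_freq hα ξ) ?_)
  rw [norm_smul z (1 : Spinor →L[ℂ] Spinor), norm_one, mul_one]

theorem continuous_shiftedSymbol (z : ℂ) : Continuous (shiftedSymbol α z) :=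
  continuous_diracSymbol.add continuous_const

theorem norm_smul_shiftedSymbol_le (hα : IsDiracMatrices α) {m z : ℂ} {ξ : Space} {a b : ℝ}
    (h1 : freq ξ * ‖m‖ ≤ a) (h2 : ‖m‖ ≤ b) : ‖m • shiftedSymbol α z ξ‖ ≤ a + (1 + ‖z‖) * b := by
  rw [norm_smul]
  have h := mul_le_mul_of_nonneg_left (norm_shiftedSymbol_le hα z ξ) (norm_nonneg m)
  have h3 := mul_le_mul_of_nonneg_left h2 (show 0 ≤ 1 + ‖z‖ by positivity)
  nlinarith

/-- `(D - λ)(D + λ) = |2πξ|² + 1 - λ² = |2πξ|² - κ²`, which reduces the Dirac resolvent to the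
scalar Helmholtz resolvent. -/
theorem shiftedSymbol_mul (hα : IsDiracMatrices α) {w : ℂ} (hw : w ≠ 0) (ξ : Space) (v : Spinor) :
    shiftedSymbol α (-spectralParam w) ξ (shiftedSymbol α (spectralParam w) ξ v)
      = ((freq ξ : ℂ) ^ 2 - momentum w ^ 2) • v := by
  have h4 : diracSymbol α ξ (diracSymbol α ξ v) = ((freq ξ ^ 2 + 1 : ℝ) : ℂ) • v :=
    DFunLike.congr_fun (diracSymbol_mul_self hα ξ) v
  have e : ∀ (z : ℂ) (x : Spinor), shiftedSymbol α z ξ x = diracSymbol α ξ x + z • x :=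
    fun z x => rfl
  rw [e, e, map_add, map_smul, h4, momentum_sq hw]
  push_cast
  module

theorem shiftedSymbol_comm (z z' : ℂ) (ξ : Space) (v : Spinor) :
    shiftedSymbol α z ξ (shiftedSymbol α z' ξ v) = shiftedSymbol α z' ξ (shiftedSymbol α z ξ v) := by
  have e : ∀ (z : ℂ) (x : Spinor), shiftedSymbol α z ξ x = diracSymbol α ξ x + z • x :=
    fun z x => rfl
  simp only [e, map_add, map_smul]
  module

theorem norm_sq_sub_sq_ge {κ : ℂ} (hκ : 0 < κ.im) (p : ℝ) :
    κ.im ≤ ‖(p : ℂ) - κ‖ ∧ κ.im ≤ ‖(p : ℂ) + κ‖ := by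
  constructor
  · refine le_trans ?_ (Complex.abs_im_le_norm _)
    simp [abs_of_pos hκ]
  · refine le_trans ?_ (Complex.abs_im_le_norm _)
    simp [abs_of_pos hκ]

theorem sq_sub_sq_ne_zero {κ : ℂ} (hκ : 0 < κ.im) (p : ℝ) : (p : ℂ) ^ 2 - κ ^ 2 ≠ 0 := by
  obtain ⟨h1, h2⟩ := norm_sq_sub_sq_ge hκ p
  rw [show (p : ℂ) ^ 2 - κ ^ 2 = (p - κ) * (p + κ) by ring]
  exact mul_ne_zero (norm_pos_iff.1 (hκ.trans_le h1)) (norm_pos_iff.1 (hκ.trans_le h2))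

theorem norm_inv_sq_sub_sq_le {κ : ℂ} (hκ : 0 < κ.im) (p : ℝ) :
    ‖((p : ℂ) ^ 2 - κ ^ 2)⁻¹‖ ≤ 1 / κ.im ^ 2 := by
  obtain ⟨h1, h2⟩ := norm_sq_sub_sq_ge hκ p
  rw [show (p : ℂ) ^ 2 - κ ^ 2 = (p - κ) * (p + κ) by ring, norm_inv, norm_mul, ← one_div, sq]
  gcongr

/-- `2p ≤ |p - κ| + |p + κ|`, and each of the two factors is at least `Im κ`. -/
theorem mul_norm_inv_sq_sub_sq_le {κ : ℂ} (hκ : 0 < κ.im) {p : ℝ} (hp : 0 ≤ p) :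
    p * ‖((p : ℂ) ^ 2 - κ ^ 2)⁻¹‖ ≤ 1 / κ.im := by
  obtain ⟨h1, h2⟩ := norm_sq_sub_sq_ge hκ p
  have ha : 0 < ‖(p : ℂ) - κ‖ := hκ.trans_le h1
  have hb : 0 < ‖(p : ℂ) + κ‖ := hκ.trans_le h2
  have h3 : 2 * p ≤ ‖(p : ℂ) - κ‖ + ‖(p : ℂ) + κ‖ := by
    have := norm_add_le ((p : ℂ) - κ) (p + κ)
    rw [show (p : ℂ) - κ + (p + κ) = ((2 * p : ℝ) : ℂ) by push_cast; ring, Complex.norm_real,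
      Real.norm_of_nonneg (by positivity)] at this
    exact this
  rw [show (p : ℂ) ^ 2 - κ ^ 2 = (p - κ) * (p + κ) by ring, norm_inv, norm_mul, ← div_eq_mul_inv,
    div_le_div_iff₀ (by positivity) hκ, one_mul]
  nlinarith [mul_le_mul_of_nonneg_left h1 hb.le, mul_le_mul_of_nonneg_left h2 ha.le,
    mul_le_mul_of_nonneg_right h3 hκ.le]

/-- The symbol of the free resolvent. -/
def freeSymbol (α : Fin 4 → Matrix (Fin 4) (Fin 4) ℂ) (w : ℂ) (ξ : Space) :
    Spinor →L[ℂ] Spinor :=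
  ((freq ξ : ℂ) ^ 2 - momentum w ^ 2)⁻¹ • shiftedSymbol α (spectralParam w) ξ

theorem norm_freeSymbol_le (hα : IsDiracMatrices α) {w : ℂ} (hw : 0 < w.im) (ξ : Space) :
    ‖freeSymbol α w ξ‖ ≤ 1 / (momentum w).im + (1 + ‖spectralParam w‖) * (1 / (momentum w).im ^ 2) :=
  norm_smul_shiftedSymbol_le hα (mul_norm_inv_sq_sub_sq_le (momentum_im_pos hw) (freq_nonneg ξ))
    (norm_inv_sq_sub_sq_le (momentum_im_pos hw) _)

theorem continuous_freeSymbol {w : ℂ} (hw : 0 < w.im) : Continuous (freeSymbol α w) := by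
  refine Continuous.smul (Continuous.inv₀ ?_ fun ξ => sq_sub_sq_ne_zero (momentum_im_pos hw) _)
    (continuous_shiftedSymbol _)
  have := continuous_freq
  fun_prop

theorem isSymbol_freeSymbol (hα : IsDiracMatrices α) {w : ℂ} (hw : 0 < w.im) :
    IsSymbol (freeSymbol α w) :=
  ⟨(continuous_freeSymbol hw).stronglyMeasurable, _, norm_freeSymbol_le hα hw⟩

/-- The free resolvent on the physical sheet. -/
def freeResolvent (α : Fin 4 → Matrix (Fin 4) (Fin 4) ℂ) (w : ℂ) : L2 →L[ℂ] L2 :=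
  fourierOp (freeSymbol α w)

theorem ne_zero_of_im_pos {w : ℂ} (hw : 0 < w.im) : w ≠ 0 := by
  rintro rfl
  simp at hw

/-- The Lippmann–Schwinger form of `(D - λ)u = f`, with `V` moved to the right-hand side; pointwise
in `ξ` it is the inversion of `D(ξ) - λ` by `shiftedSymbol_mul`. -/
theorem diracGraph_iff_freeResolvent (hα : IsDiracMatrices α) (hV : IsPotential V) {w : ℂ}
    (hw : 0 < w.im) (u f : L2) : DiracGraph α V u (f + spectralParam w • u) ↔
      u = freeResolvent α w (f - mulOp (potentialSymbol V) u) := by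
  set z := spectralParam w
  set g := f - mulOp (potentialSymbol V) u
  have hw0 := ne_zero_of_im_pos hw
  rw [diracGraph_iff hα hV, show f + z • u - mulOp (potentialSymbol V) u = g + z • u by
    simp only [g]; abel]
  have h1 : (u = freeResolvent α w g) ↔
      ∀ᵐ ξ, fourierL2 u ξ = freeSymbol α w ξ (fourierL2 g ξ) := by
    rw [← fourierL2.injective.eq_iff, freeResolvent, fourierL2_fourierOp, Lp.ext_iff]
    exact ⟨fun h => EventuallyEq.trans h (coeFn_mulOp (isSymbol_freeSymbol hα hw) _),
      fun h => EventuallyEq.trans h (coeFn_mulOp (isSymbol_freeSymbol hα hw) _).symm⟩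
  rw [h1]
  have h2 : ∀ᵐ ξ, fourierL2 (g + z • u) ξ = fourierL2 g ξ + z • fourierL2 u ξ := by
    rw [map_add, map_smul]
    filter_upwards [Lp.coeFn_add (fourierL2 g) (z • fourierL2 u),
      Lp.coeFn_smul z (fourierL2 u)] with ξ a b
    rw [a, Pi.add_apply, b, Pi.smul_apply]
  have e : ∀ (z : ℂ) (ξ : Space) (x : Spinor), shiftedSymbol α z ξ x = diracSymbol α ξ x + z • x :=
    fun z ξ x => rfl
  refine eventually_congr ?_
  filter_upwards [h2] with ξ hξ
  have hne := sq_sub_sq_ne_zero (momentum_im_pos hw) (freq ξ)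
  have e1 : ∀ x, freeSymbol α w ξ x
      = ((freq ξ : ℂ) ^ 2 - momentum w ^ 2)⁻¹ • shiftedSymbol α z ξ x := fun x => rfl
  rw [hξ, e1]
  constructor
  · intro h
    have h3 : fourierL2 g ξ = shiftedSymbol α (-z) ξ (fourierL2 u ξ) := by
      rw [e, ← h]
      module
    rw [h3, shiftedSymbol_comm, shiftedSymbol_mul hα hw0, smul_smul, inv_mul_cancel₀ hne, one_smul]
  · intro h
    have h3 : shiftedSymbol α (-z) ξ (fourierL2 u ξ) = fourierL2 g ξ := by
      rw [h, map_smul, shiftedSymbol_mul hα hw0, smul_smul, inv_mul_cancel₀ hne, one_smul]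
    rw [← h3, e]
    module

theorem IsResolvent.eq_sub (hα : IsDiracMatrices α) (hV : IsPotential V) {w : ℂ}
    (hw : 0 < w.im) {R : L2 →L[ℂ] L2} (hR : IsResolvent α V (spectralParam w) R) :
    R = freeResolvent α w - freeResolvent α w * mulOp (potentialSymbol V) * R := by
  ext1 f
  have h := (diracGraph_iff_freeResolvent hα hV hw (R f) f).1 (hR.1 f)
  rw [map_sub] at h
  exact h

theorem IsResolvent.freeResolvent_eq (hα : IsDiracMatrices α) (hV : IsPotential V) {w : ℂ}
    (hw : 0 < w.im) {R : L2 →L[ℂ] L2} (hR : IsResolvent α V (spectralParam w) R) :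
    freeResolvent α w = R + R * mulOp (potentialSymbol V) * freeResolvent α w := by
  ext1 f
  have h := hR.2 (freeResolvent α w f) _ ((diracGraph_iff_freeResolvent hα hV hw
    (freeResolvent α w f) (f + mulOp (potentialSymbol V) (freeResolvent α w f))).2 (by simp))
  rw [add_sub_cancel_right, map_add] at h
  exact h.symm

/-- `R = R₀ (1 + V R₀)⁻¹` by a Neumann series. It supplies points of the physical sheet at which
every continuation is prescribed. -/
theorem exists_isResolvent (hα : IsDiracMatrices α) (hV : IsPotential V) {w : ℂ}
    (hw : 0 < w.im) (h : ‖mulOp (potentialSymbol V) * freeResolvent α w‖ < 1) :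
    ∃ R, IsResolvent α V (spectralParam w) R := by
  set A := mulOp (potentialSymbol V) * freeResolvent α w
  have hu : IsUnit (1 + A) := by
    have := isUnit_one_sub_of_norm_lt_one (x := -A) (by rwa [norm_neg])
    rwa [sub_neg_eq_add] at this
  obtain ⟨N, hN⟩ := hu.exists_right_inv
  have hN' : N * (1 + A) = 1 := by
    obtain ⟨N', hN'⟩ := hu.exists_left_inv
    have : N' = N := by
      calc N' = N' * ((1 + A) * N) := by rw [hN, mul_one]
        _ = N := by rw [← mul_assoc, hN', one_mul]
    rw [← this, hN']
  refine ⟨freeResolvent α w * N, fun f => ?_, fun u f hf => ?_⟩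
  · rw [diracGraph_iff_freeResolvent hα hV hw]
    have h1 : N f + A (N f) = f := DFunLike.congr_fun hN f
    have h2 : f - mulOp (potentialSymbol V) ((freeResolvent α w * N) f) = N f :=
      sub_eq_iff_eq_add.2 h1.symm
    rw [h2]
    rfl
  · set g := f - spectralParam w • u with hg
    rw [show f = g + spectralParam w • u by rw [hg]; abel,
      diracGraph_iff_freeResolvent hα hV hw] at hf
    have h1 : (1 + A) (g - mulOp (potentialSymbol V) u) = g := by
      change g - mulOp (potentialSymbol V) u + mulOp (potentialSymbol V)
        (freeResolvent α w (g - mulOp (potentialSymbol V) u)) = g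
      rw [← hf]
      abel
    have h2 : N g = g - mulOp (potentialSymbol V) u := by
      conv_lhs => rw [← h1]
      exact DFunLike.congr_fun hN' _
    change freeResolvent α w (N g) = u
    rw [h2, ← hf]

end FreeResolvent

end DiracResonance

end

noncomputable section

namespace DiracResonance

/-! ### Scalar wave integrals `∫₀ᵀ g(t) sin(pt)/p dt` -/

section WaveProfiles

/-- The fundamental solution `t ↦ sin (pt) / p` of the wave equation at frequency `p`. -/
def waveSin (p t : ℝ) : ℝ := t * Real.sinc (p * t)

theorem waveSin_zero_right (p : ℝ) : waveSin p 0 = 0 := by simp [waveSin]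

theorem mul_waveSin (p t : ℝ) : p * waveSin p t = Real.sin (p * t) := by
  unfold waveSin
  rcases eq_or_ne (p * t) 0 with h | h
  · rw [h, Real.sinc_zero, Real.sin_zero, mul_one, h]
  · rw [Real.sinc_of_ne_zero h, ← mul_assoc, mul_div_cancel₀ _ h]

theorem waveSin_eq_div {p : ℝ} (hp : p ≠ 0) (t : ℝ) : waveSin p t = Real.sin (p * t) / p := by
  rw [← mul_waveSin]
  field_simp

theorem continuous_waveSin : Continuous fun x : ℝ × ℝ => waveSin x.1 x.2 := by
  unfold waveSin
  exact continuous_snd.mul (Real.continuous_sinc.comp (by fun_prop))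

theorem hasDerivAt_waveSin (p t : ℝ) : HasDerivAt (waveSin p) (Real.cos (p * t)) t := by
  rcases eq_or_ne p 0 with rfl | hp
  · have : waveSin 0 = id := by
      funext s
      simp [waveSin]
    rw [this]
    simpa using hasDerivAt_id t
  · have h1 : waveSin p = fun s => Real.sin (p * s) / p := funext (waveSin_eq_div hp)
    rw [h1]
    have h2 := (((hasDerivAt_id t).const_mul p).sin).div_const p
    refine h2.congr_deriv ?_
    simp only [id]
    field_simp

theorem abs_waveSin_le (p : ℝ) {t : ℝ} (ht : 0 ≤ t) : |waveSin p t| ≤ t := by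
  unfold waveSin
  rw [abs_mul, abs_of_nonneg ht]
  exact mul_le_of_le_one_right ht (Real.abs_sinc_le_one _)

theorem mul_abs_waveSin_le {p : ℝ} (hp : 0 ≤ p) (t : ℝ) : p * |waveSin p t| ≤ 1 := by
  rw [← abs_of_nonneg hp, ← abs_mul, abs_of_nonneg hp, mul_waveSin]
  exact Real.abs_sin_le_one _

/-- Superposition of waves with profile `g` up to time `T`. -/
def profileSymbol (T : ℝ) (g : ℝ → ℂ) (p : ℝ) : ℂ := ∫ t in (0 : ℝ)..T, g t * (waveSin p t : ℂ)

theorem continuous_profileSymbol (T : ℝ) {g : ℝ → ℂ} (hg : Continuous g) :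
    Continuous (profileSymbol T g) := by
  refine intervalIntegral.continuous_parametric_intervalIntegral_of_continuous' ?_ _ _
  exact (hg.comp continuous_snd).mul (Complex.continuous_ofReal.comp continuous_waveSin)

theorem intervalIntegrable_profile {g : ℝ → ℂ} (hg : Continuous g) (p a b : ℝ) :
    IntervalIntegrable (fun t => g t * (waveSin p t : ℂ)) volume a b := by
  refine Continuous.intervalIntegrable (hg.mul (Complex.continuous_ofReal.comp ?_)) _ _
  exact continuous_waveSin.comp (by fun_prop : Continuous fun t : ℝ => (p, t))

theorem profileSymbol_congr {T : ℝ} (hT : 0 ≤ T) {g g' : ℝ → ℂ} (h : ∀ t ∈ Set.Icc 0 T, g t = g' t) :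
    profileSymbol T g = profileSymbol T g' := by
  funext p
  refine intervalIntegral.integral_congr fun t ht => ?_
  rw [Set.uIcc_of_le hT] at ht
  exact congrArg (· * (waveSin p t : ℂ)) (h t ht)

theorem norm_profileSymbol_le {T : ℝ} (hT : 0 ≤ T) {g : ℝ → ℂ} {G : ℝ}
    (hG : ∀ t ∈ Set.Icc 0 T, ‖g t‖ ≤ G) (p : ℝ) : ‖profileSymbol T g p‖ ≤ G * T ^ 2 := by
  have h0 : 0 ≤ G := (norm_nonneg _).trans (hG 0 ⟨le_rfl, hT⟩)
  have := intervalIntegral.norm_integral_le_of_norm_le_const (a := 0) (b := T) (C := G * T)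
    (f := fun t => g t * (waveSin p t : ℂ)) (fun t ht => by
      rw [Set.uIoc_of_le hT] at ht
      rw [norm_mul, Complex.norm_real, Real.norm_eq_abs]
      have h1 := abs_waveSin_le p ht.1.le
      exact mul_le_mul (hG t ⟨ht.1.le, ht.2⟩) (h1.trans ht.2) (abs_nonneg _) h0)
  rw [sub_zero, abs_of_nonneg hT] at this
  unfold profileSymbol
  linarith [this, show G * T * T = G * T ^ 2 by ring]

theorem mul_norm_profileSymbol_le {T : ℝ} (hT : 0 ≤ T) {g : ℝ → ℂ} {G : ℝ}
    (hG : ∀ t ∈ Set.Icc 0 T, ‖g t‖ ≤ G) {p : ℝ} (hp : 0 ≤ p) :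
    p * ‖profileSymbol T g p‖ ≤ G * T := by
  have h0 : 0 ≤ G := (norm_nonneg _).trans (hG 0 ⟨le_rfl, hT⟩)
  have := intervalIntegral.norm_integral_le_of_norm_le_const (a := 0) (b := T) (C := G)
    (f := fun t => (p : ℂ) * (g t * (waveSin p t : ℂ))) (fun t ht => by
      rw [Set.uIoc_of_le hT] at ht
      rw [norm_mul, norm_mul, Complex.norm_real, Complex.norm_real, Real.norm_eq_abs,
        Real.norm_eq_abs, abs_of_nonneg hp]
      have h1 := mul_abs_waveSin_le hp t
      have h2 := hG t ⟨ht.1.le, ht.2⟩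
      calc p * (‖g t‖ * |waveSin p t|) = ‖g t‖ * (p * |waveSin p t|) := by ring
        _ ≤ G * 1 := mul_le_mul h2 h1 (by positivity) h0
        _ = G := mul_one G)
  rw [sub_zero, abs_of_nonneg hT, intervalIntegral.integral_const_mul, norm_mul,
    Complex.norm_real, Real.norm_of_nonneg hp] at this
  exact this

theorem profileSymbol_sub (T : ℝ) {g g' : ℝ → ℂ} (hg : Continuous g) (hg' : Continuous g')
    (p : ℝ) : profileSymbol T (fun t => g t - g' t) p
      = profileSymbol T g p - profileSymbol T g' p := by
  unfold profileSymbol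
  rw [← intervalIntegral.integral_sub (intervalIntegrable_profile hg p _ _)
    (intervalIntegrable_profile hg' p _ _)]
  exact intervalIntegral.integral_congr fun t _ => sub_mul _ _ _

/-- The profile `t ↦ e^{iκt}`. -/
def expProfile (κ : ℂ) (t : ℝ) : ℂ := Complex.exp (κ * (Complex.I * t))

theorem continuous_expProfile (κ : ℂ) : Continuous (expProfile κ) := by
  unfold expProfile
  fun_prop

theorem norm_expProfile (κ : ℂ) (t : ℝ) : ‖expProfile κ t‖ = Real.exp (-(κ.im * t)) := by
  unfold expProfile
  rw [Complex.norm_exp]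
  congr 1
  simp

theorem norm_expProfile_le_one {κ : ℂ} (hκ : 0 ≤ κ.im) {t : ℝ} (ht : 0 ≤ t) :
    ‖expProfile κ t‖ ≤ 1 := by
  rw [norm_expProfile]
  exact Real.exp_le_one_iff.2 (by have := mul_nonneg hκ ht; linarith)

theorem norm_expProfile_le (κ : ℂ) {t T : ℝ} (ht : t ∈ Set.Icc 0 T) :
    ‖expProfile κ t‖ ≤ Real.exp (‖κ‖ * T) := by
  rw [norm_expProfile]
  refine Real.exp_le_exp.2 ?_
  have h1 := (abs_le.1 (Complex.abs_im_le_norm κ)).1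
  nlinarith [norm_nonneg κ, ht.1, ht.2, mul_le_mul_of_nonneg_left ht.2 (norm_nonneg κ),
    mul_le_mul_of_nonneg_right h1 ht.1]

theorem hasDerivAt_expProfile (κ : ℂ) (t : ℝ) :
    HasDerivAt (expProfile κ) (expProfile κ t * (κ * Complex.I)) t := by
  have h : HasDerivAt (fun s : ℝ => κ * (Complex.I * (s : ℂ))) (κ * Complex.I) t := by
    simpa using ((Complex.ofRealCLM.hasDerivAt (x := t)).const_mul Complex.I).const_mul κ
  exact h.cexp

/-- The primitive of `e^{iκt} sin (pt) (p² - κ²) / p`. -/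
def wavePrimitive (κ : ℂ) (p t : ℝ) : ℂ :=
  expProfile κ t * (Complex.I * κ * waveSin p t - Real.cos (p * t))

theorem hasDerivAt_wavePrimitive (κ : ℂ) (p t : ℝ) :
    HasDerivAt (wavePrimitive κ p)
      (((p : ℂ) ^ 2 - κ ^ 2) * (expProfile κ t * (waveSin p t : ℂ))) t := by
  have h1 : HasDerivAt (fun s => (waveSin p s : ℂ)) (Real.cos (p * t) : ℂ) t :=
    (hasDerivAt_waveSin p t).ofReal_comp
  have h2 : HasDerivAt (fun s : ℝ => ((Real.cos (p * s) : ℝ) : ℂ))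
      ((-(p * Real.sin (p * t)) : ℝ) : ℂ) t := by
    refine HasDerivAt.ofReal_comp ?_
    exact (((hasDerivAt_id t).const_mul p).cos).congr_deriv (by simp only [id]; ring)
  refine ((hasDerivAt_expProfile κ t).fun_mul
    ((h1.const_mul (Complex.I * κ)).fun_sub h2)).congr_deriv ?_
  rw [← mul_waveSin]
  push_cast
  linear_combination (κ ^ 2 * expProfile κ t * waveSin p t) * Complex.I_sq

/-- Apart from the factor `p² - κ²`, the truncated integral differs from the resolvent symbol only
by a boundary term at time `T`, which tends to zero as `T → ∞` when `Im κ > 0`. -/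
theorem profileSymbol_expProfile_eq (T : ℝ) (κ : ℂ) (p : ℝ) :
    ((p : ℂ) ^ 2 - κ ^ 2) * profileSymbol T (expProfile κ) p = wavePrimitive κ p T + 1 := by
  have h := intervalIntegral.integral_eq_sub_of_hasDerivAt (a := 0) (b := T)
    (fun t _ => hasDerivAt_wavePrimitive κ p t)
    ((intervalIntegrable_profile (continuous_expProfile κ) p 0 T).const_mul _)
  rw [intervalIntegral.integral_const_mul] at h
  unfold profileSymbol
  rw [h]
  simp [wavePrimitive, waveSin_zero_right, expProfile]

theorem norm_intervalIntegral_expProfile_mul_le {T : ℝ} (hT : 0 ≤ T) {κ : ℂ} (hκ : 0 ≤ κ.im)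
    (p : ℝ) : ‖∫ t in (0 : ℝ)..T, expProfile κ t * (Real.cos (p * t) : ℂ)‖ ≤ T := by
  have := intervalIntegral.norm_integral_le_of_norm_le_const (a := 0) (b := T) (C := 1)
    (f := fun t => expProfile κ t * (Real.cos (p * t) : ℂ)) (fun t ht => by
      rw [Set.uIoc_of_le hT] at ht
      rw [norm_mul, Complex.norm_real]
      exact mul_le_one₀ (norm_expProfile_le_one hκ ht.1.le) (norm_nonneg _)
        (Real.abs_cos_le_one _))
  rwa [sub_zero, abs_of_nonneg hT, one_mul] at this

theorem intervalIntegrable_expProfile_cos (κ : ℂ) (p a b : ℝ) :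
    IntervalIntegrable (fun t : ℝ => expProfile κ t * (Real.cos (p * t) : ℂ)) volume a b :=
  Continuous.intervalIntegrable ((continuous_expProfile κ).mul (by fun_prop)) _ _

/-- Integration by parts in `e^{iκt}` gains a factor `κ`, uniformly for `Im κ ≥ 0`. This pays for
the factor `λ` in `D + λ`. -/
theorem norm_mul_norm_profileSymbol_le {T : ℝ} (hT : 0 ≤ T) {κ : ℂ} (hκ : 0 ≤ κ.im) (p : ℝ) :
    ‖κ‖ * ‖profileSymbol T (expProfile κ) p‖ ≤ 2 * T := by
  have hd : ∀ t, HasDerivAt (fun s => expProfile κ s * (waveSin p s : ℂ))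
      (κ * Complex.I * (expProfile κ t * (waveSin p t : ℂ))
        + expProfile κ t * (Real.cos (p * t) : ℂ)) t := by
    intro t
    refine ((hasDerivAt_expProfile κ t).fun_mul
      (hasDerivAt_waveSin p t).ofReal_comp).congr_deriv ?_
    ring
  have hi1 := (intervalIntegrable_profile (continuous_expProfile κ) p 0 T).const_mul (κ * Complex.I)
  have hi2 := intervalIntegrable_expProfile_cos κ p 0 T
  have h := intervalIntegral.integral_eq_sub_of_hasDerivAt (a := 0) (b := T)
    (fun t _ => hd t) (hi1.add hi2)
  rw [intervalIntegral.integral_add hi1 hi2, intervalIntegral.integral_const_mul,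
    waveSin_zero_right] at h
  have h2 : κ * Complex.I * profileSymbol T (expProfile κ) p
      = expProfile κ T * (waveSin p T : ℂ)
        - ∫ t in (0 : ℝ)..T, expProfile κ t * (Real.cos (p * t) : ℂ) := by
    unfold profileSymbol
    rw [eq_sub_iff_add_eq, h]
    simp
  have h3 : ‖κ‖ * ‖profileSymbol T (expProfile κ) p‖
      = ‖κ * Complex.I * profileSymbol T (expProfile κ) p‖ := by simp
  rw [h3, h2]
  refine (norm_sub_le _ _).trans ?_
  have h4 : ‖expProfile κ T * (waveSin p T : ℂ)‖ ≤ T := by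
    rw [norm_mul, Complex.norm_real, Real.norm_eq_abs]
    exact (mul_le_of_le_one_left (abs_nonneg _) (norm_expProfile_le_one hκ hT)).trans
      (abs_waveSin_le p hT)
  linarith [norm_intervalIntegral_expProfile_mul_le hT hκ p]

/-- Integration by parts in `sin(pt)/p` gains `p²` at the price of one power of `κ`. It is the
source of the decay `(1 + |κ|)/|ξ|` of the full symbol. -/
theorem sq_mul_norm_profileSymbol_le {T : ℝ} (hT : 0 ≤ T) {κ : ℂ} (hκ : 0 ≤ κ.im) (p : ℝ) :
    p ^ 2 * ‖profileSymbol T (expProfile κ) p‖ ≤ 2 + ‖κ‖ * T := by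
  have hd : ∀ t, HasDerivAt (fun s : ℝ => expProfile κ s * ((Real.cos (p * s) : ℝ) : ℂ))
      (κ * Complex.I * (expProfile κ t * (Real.cos (p * t) : ℂ))
        - (p : ℂ) ^ 2 * (expProfile κ t * (waveSin p t : ℂ))) t := by
    intro t
    have h2 : HasDerivAt (fun s : ℝ => ((Real.cos (p * s) : ℝ) : ℂ))
        ((-(p * Real.sin (p * t)) : ℝ) : ℂ) t := by
      refine HasDerivAt.ofReal_comp ?_
      exact (((hasDerivAt_id t).const_mul p).cos).congr_deriv (by simp only [id]; ring)
    refine ((hasDerivAt_expProfile κ t).fun_mul h2).congr_deriv ?_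
    rw [← mul_waveSin]
    push_cast
    ring
  have hi1 := (intervalIntegrable_profile (continuous_expProfile κ) p 0 T).const_mul ((p : ℂ) ^ 2)
  have hi2 := (intervalIntegrable_expProfile_cos κ p 0 T).const_mul (κ * Complex.I)
  have h := intervalIntegral.integral_eq_sub_of_hasDerivAt (a := 0) (b := T)
    (fun t _ => hd t) (hi2.sub hi1)
  rw [intervalIntegral.integral_sub hi2 hi1, intervalIntegral.integral_const_mul,
    intervalIntegral.integral_const_mul] at h
  have h2 : (p : ℂ) ^ 2 * profileSymbol T (expProfile κ) p
      = κ * Complex.I * (∫ t in (0 : ℝ)..T, expProfile κ t * (Real.cos (p * t) : ℂ))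
        - (expProfile κ T * (Real.cos (p * T) : ℂ) - expProfile κ 0 * (Real.cos (p * 0) : ℂ)) := by
    unfold profileSymbol
    rw [← h]
    ring
  have h3 : p ^ 2 * ‖profileSymbol T (expProfile κ) p‖
      = ‖(p : ℂ) ^ 2 * profileSymbol T (expProfile κ) p‖ := by simp
  have h4 : ∀ t, 0 ≤ t → ‖expProfile κ t * (Real.cos (p * t) : ℂ)‖ ≤ 1 := by
    intro t ht
    rw [norm_mul, Complex.norm_real]
    exact mul_le_one₀ (norm_expProfile_le_one hκ ht) (norm_nonneg _) (Real.abs_cos_le_one _)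
  rw [h3, h2]
  refine (norm_sub_le _ _).trans ?_
  have h5 := norm_sub_le (expProfile κ T * (Real.cos (p * T) : ℂ))
    (expProfile κ 0 * (Real.cos (p * 0) : ℂ))
  have h6 : ‖κ * Complex.I * ∫ t in (0 : ℝ)..T, expProfile κ t * (Real.cos (p * t) : ℂ)‖
      ≤ ‖κ‖ * T := by
    rw [norm_mul, norm_mul, Complex.norm_I, mul_one]
    exact mul_le_mul_of_nonneg_left (norm_intervalIntegral_expProfile_mul_le hT hκ p)
      (norm_nonneg _)
  linarith [h4 T hT, h4 0 le_rfl]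

theorem norm_wavePrimitive_le {T : ℝ} (hT : 0 ≤ T) {κ : ℂ} (hκ : 0 ≤ κ.im) (p : ℝ) :
    ‖wavePrimitive κ p T‖ ≤ ‖κ‖ * T * Real.exp (-(κ.im * T)) + 1 := by
  unfold wavePrimitive
  rw [mul_sub]
  refine (norm_sub_le _ _).trans (add_le_add ?_ ?_)
  · rw [norm_mul, norm_mul, norm_mul, Complex.norm_I, one_mul, norm_expProfile, Complex.norm_real,
      Real.norm_eq_abs, mul_comm]
    gcongr
    exact abs_waveSin_le p hT
  · rw [norm_mul, Complex.norm_real]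
    exact mul_le_one₀ (norm_expProfile_le_one hκ hT) (norm_nonneg _) (Real.abs_cos_le_one _)

/-- On the imaginary axis the truncated resolvent is as small as the full resolvent. -/
theorem norm_profileSymbol_le_of_norm_eq_im {T : ℝ} (hT : 0 ≤ T) {κ : ℂ} (hκ : 0 < κ.im)
    (h : ‖κ‖ = κ.im) {p : ℝ} (hp : 0 ≤ p) :
    ‖profileSymbol T (expProfile κ) p‖ ≤ 3 / κ.im ^ 2 ∧
      p * ‖profileSymbol T (expProfile κ) p‖ ≤ 3 / κ.im := by
  have h1 : ‖wavePrimitive κ p T + 1‖ ≤ 3 := by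
    refine (norm_add_le _ _).trans ?_
    have h2 := norm_wavePrimitive_le hT hκ.le p
    -- `x e^{-x} ≤ 1` with `x = T Im κ`. Here `|κ| = Im κ` is needed: elsewhere `|κ|T` would not be
    -- absorbed by the exponential.
    have h3 : ‖κ‖ * T * Real.exp (-(κ.im * T)) ≤ 1 := by
      rw [h]
      refine (Real.mul_exp_neg_le_exp_neg_one _).trans (Real.exp_le_one_iff.2 (by norm_num))
    rw [norm_one]
    linarith
  have h4 : profileSymbol T (expProfile κ) p
      = ((p : ℂ) ^ 2 - κ ^ 2)⁻¹ * (wavePrimitive κ p T + 1) := by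
    rw [← profileSymbol_expProfile_eq, inv_mul_cancel_left₀ (sq_sub_sq_ne_zero hκ p)]
  rw [h4, norm_mul]
  have h5 := norm_inv_sq_sub_sq_le hκ p
  have h6 := mul_norm_inv_sq_sub_sq_le hκ hp
  constructor
  · calc _ ≤ 1 / κ.im ^ 2 * 3 := mul_le_mul h5 h1 (norm_nonneg _) (by positivity)
      _ = _ := by ring
  · rw [← mul_assoc]
    calc _ ≤ 1 / κ.im * 3 := mul_le_mul h6 h1 (norm_nonneg _) (by positivity)
      _ = _ := by ring

end WaveProfiles

/-! ### The truncated free resolvent and its analyticity -/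

section Propagator

variable {α : Fin 4 → Matrix (Fin 4) (Fin 4) ℂ}

/-- The operator with symbol `∫₀ᵀ g(t) sin (pt) / p dt • a(ξ)`, as a function of the profile. -/
def profileOp {T : ℝ} (hT : 0 ≤ T) {a : Space → Spinor →L[ℂ] Spinor} (ha : Continuous a)
    (hb : ∀ ξ, ‖a ξ‖ ≤ freq ξ + 1) : C(Set.Icc (0 : ℝ) T, ℂ) →L[ℂ] (L2 →L[ℂ] L2) :=
  have hg : ∀ g : C(Set.Icc (0 : ℝ) T, ℂ), Continuous (Set.IccExtend hT g) :=
    fun g => g.continuous.Icc_extend'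
  have hn : ∀ (g : C(Set.Icc (0 : ℝ) T, ℂ)) (ξ : Space),
      ‖profileSymbol T (Set.IccExtend hT g) (freq ξ) • a ξ‖ ≤ (T + T ^ 2) * ‖g‖ := by
    intro g ξ
    have h1 : ∀ t ∈ Set.Icc 0 T, ‖Set.IccExtend hT g t‖ ≤ ‖g‖ := fun t _ => g.norm_coe_le_norm _
    have h2 := norm_profileSymbol_le hT h1 (freq ξ)
    have h3 := mul_norm_profileSymbol_le hT h1 (freq_nonneg ξ)
    rw [norm_smul]
    nlinarith [mul_le_mul_of_nonneg_left (hb ξ)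
      (norm_nonneg (profileSymbol T (Set.IccExtend hT g) (freq ξ)))]
  have hs : ∀ g : C(Set.Icc (0 : ℝ) T, ℂ),
      IsSymbol (fun ξ => profileSymbol T (Set.IccExtend hT g) (freq ξ) • a ξ) := fun g =>
    ⟨(((continuous_profileSymbol T (hg g)).comp continuous_freq).smul ha).stronglyMeasurable,
      _, hn g⟩
  LinearMap.mkContinuous
    { toFun := fun g => fourierOp fun ξ => profileSymbol T (Set.IccExtend hT g) (freq ξ) • a ξ
      map_add' := fun g g' => by
        rw [← fourierOp_add (hs g) (hs g')]
        congr 1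
        funext ξ
        refine Eq.trans ?_ (add_smul _ _ (a ξ))
        congr 1
        unfold profileSymbol
        rw [← intervalIntegral.integral_add (intervalIntegrable_profile (hg g) _ _ _)
          (intervalIntegrable_profile (hg g') _ _ _)]
        exact intervalIntegral.integral_congr fun t _ => add_mul _ _ _
      map_smul' := fun c g => by
        rw [RingHom.id_apply, ← fourierOp_const_smul (hs g) c]
        congr 1
        funext ξ
        rw [smul_smul]
        congr 1
        unfold profileSymbol
        rw [← intervalIntegral.integral_const_mul]
        exact intervalIntegral.integral_congr fun t _ => mul_assoc _ _ _ } (T + T ^ 2)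
    fun g => ContinuousLinearMap.opNorm_le_bound _ (by positivity) fun u =>
      norm_fourierOp_apply_le (hs g).1 (hn g) u

/-- The curve of profiles `κ ↦ e^{iκt}` in `C([0, T])`. -/
def expCurve (T : ℝ) (κ : ℂ) : C(Set.Icc (0 : ℝ) T, ℂ) :=
  NormedSpace.exp (κ • (⟨fun t => Complex.I * (t : ℝ), by fun_prop⟩ : C(Set.Icc (0 : ℝ) T, ℂ)))

theorem expCurve_apply (T : ℝ) (κ : ℂ) (t : Set.Icc (0 : ℝ) T) :
    expCurve T κ t = expProfile κ t := by
  have h := NormedSpace.map_exp (ContinuousMap.evalAlgHom ℂ ℂ t)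
    (continuous_eval_const t)
    (κ • (⟨fun t => Complex.I * (t : ℝ), by fun_prop⟩ : C(Set.Icc (0 : ℝ) T, ℂ)))
  refine h.trans ?_
  rw [← Complex.exp_eq_exp_ℂ]
  rfl

theorem analyticAt_expCurve (T : ℝ) (κ : ℂ) : AnalyticAt ℂ (expCurve T) κ := by
  unfold expCurve
  exact (NormedSpace.exp_analytic _).comp (analyticAt_id.smul analyticAt_const)

/-- The symbol of the resolvent truncated to times `≤ T`. -/
def propagatorSymbol (α : Fin 4 → Matrix (Fin 4) (Fin 4) ℂ) (T : ℝ) (κ z : ℂ) (ξ : Space) :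
    Spinor →L[ℂ] Spinor :=
  profileSymbol T (expProfile κ) (freq ξ) • shiftedSymbol α z ξ

/-- The free resolvent truncated to times `≤ T`. -/
def propagator (α : Fin 4 → Matrix (Fin 4) (Fin 4) ℂ) (T : ℝ) (κ z : ℂ) : L2 →L[ℂ] L2 :=
  fourierOp (propagatorSymbol α T κ z)

theorem continuous_propagatorSymbol (T : ℝ) (κ z : ℂ) : Continuous (propagatorSymbol α T κ z) :=
  ((continuous_profileSymbol T (continuous_expProfile κ)).comp continuous_freq).smul
    (continuous_shiftedSymbol z)

theorem norm_propagatorSymbol_le_exp (hα : IsDiracMatrices α) {T : ℝ} (hT : 0 ≤ T) (κ z : ℂ)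
    (ξ : Space) : ‖propagatorSymbol α T κ z ξ‖
      ≤ Real.exp (‖κ‖ * T) * T + (1 + ‖z‖) * (Real.exp (‖κ‖ * T) * T ^ 2) :=
  norm_smul_shiftedSymbol_le hα
    (mul_norm_profileSymbol_le hT (fun _ ht => norm_expProfile_le κ ht) (freq_nonneg ξ))
    (norm_profileSymbol_le hT (fun _ ht => norm_expProfile_le κ ht) _)

theorem isSymbol_propagatorSymbol (hα : IsDiracMatrices α) {T : ℝ} (hT : 0 ≤ T) (κ z : ℂ) :
    IsSymbol (propagatorSymbol α T κ z) :=
  ⟨(continuous_propagatorSymbol T κ z).stronglyMeasurable, _,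
    norm_propagatorSymbol_le_exp hα hT κ z⟩

/-- With `m` the modulus of the scalar symbol and `p` the frequency, `pm ≤ T`, `2m ≤ 2T²` and `|κ|m
≤ 2T`. Their sum no longer depends on `κ`, although the symbol contains `λ`. -/
theorem norm_propagatorSymbol_le (hα : IsDiracMatrices α) {T : ℝ} (hT : 0 ≤ T) {κ z : ℂ}
    (hκ : 0 ≤ κ.im) (hz : ‖z‖ ≤ ‖κ‖ + 1) (ξ : Space) :
    ‖propagatorSymbol α T κ z ξ‖ ≤ 3 * T + 2 * T ^ 2 := by
  have h1 : ∀ t ∈ Set.Icc 0 T, ‖expProfile κ t‖ ≤ 1 := fun t ht => norm_expProfile_le_one hκ ht.1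
  have h2 := norm_profileSymbol_le hT h1 (freq ξ)
  have h3 := mul_norm_profileSymbol_le hT h1 (freq_nonneg ξ)
  have h4 := norm_mul_norm_profileSymbol_le hT hκ (freq ξ)
  unfold propagatorSymbol
  rw [norm_smul]
  have h5 := mul_le_mul_of_nonneg_left ((norm_shiftedSymbol_le hα z ξ).trans (add_le_add_right hz _))
    (norm_nonneg (profileSymbol T (expProfile κ) (freq ξ)))
  nlinarith

theorem freq_mul_norm_propagatorSymbol_le (hα : IsDiracMatrices α) {T : ℝ} (hT : 0 ≤ T) {κ z : ℂ}
    (hκ : 0 ≤ κ.im) (hz : ‖z‖ ≤ ‖κ‖ + 1) (ξ : Space) :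
    freq ξ * ‖propagatorSymbol α T κ z ξ‖ ≤ 2 * (1 + T) * (1 + ‖κ‖) := by
  have h1 : ∀ t ∈ Set.Icc 0 T, ‖expProfile κ t‖ ≤ 1 := fun t ht => norm_expProfile_le_one hκ ht.1
  have h3 := mul_norm_profileSymbol_le hT h1 (freq_nonneg ξ)
  have h4 := sq_mul_norm_profileSymbol_le hT hκ (freq ξ)
  have h0 := freq_nonneg ξ
  unfold propagatorSymbol
  rw [norm_smul]
  set m := ‖profileSymbol T (expProfile κ) (freq ξ)‖
  have hm : 0 ≤ m := norm_nonneg _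
  have h5 : freq ξ * (m * ‖shiftedSymbol α z ξ‖) ≤ freq ξ * (m * (freq ξ + 1 + (‖κ‖ + 1))) := by
    gcongr
    exact (norm_shiftedSymbol_le hα z ξ).trans (add_le_add_right hz _)
  have h6 : (freq ξ * m) * (2 + ‖κ‖) ≤ 1 * T * (2 + ‖κ‖) :=
    mul_le_mul_of_nonneg_right h3 (by positivity)
  nlinarith [norm_nonneg κ]

theorem norm_propagator_le {T : ℝ} {κ z : ℂ} {C : ℝ} (hC : 0 ≤ C)
    (h : ∀ ξ, ‖propagatorSymbol α T κ z ξ‖ ≤ C) : ‖propagator α T κ z‖ ≤ C :=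
  ContinuousLinearMap.opNorm_le_bound _ hC fun u =>
    norm_fourierOp_apply_le (continuous_propagatorSymbol T κ z).stronglyMeasurable h u

theorem norm_one_le_freq_add_one (ξ : Space) : ‖(1 : Spinor →L[ℂ] Spinor)‖ ≤ freq ξ + 1 := by
  rw [norm_one]
  linarith [freq_nonneg ξ]

/-- Factors the dependence on `κ` through the analytic curve `κ ↦ e^{iκt}` in `C([0, T])` followed
by bounded linear maps. Analyticity in operator norm is then immediate. -/
theorem propagator_eq_profileOp (hα : IsDiracMatrices α) {T : ℝ} (hT : 0 ≤ T) (κ z : ℂ) :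
    propagator α T κ z
      = profileOp hT continuous_diracSymbol (norm_diracSymbol_le_freq hα) (expCurve T κ)
        + z • profileOp hT continuous_const norm_one_le_freq_add_one (expCurve T κ) := by
  have h1 : profileSymbol T (Set.IccExtend hT (expCurve T κ)) = profileSymbol T (expProfile κ) := by
    refine profileSymbol_congr hT fun t ht => ?_
    rw [Set.IccExtend_of_mem hT _ ht, expCurve_apply]
  have e : ∀ (a : Space → Spinor →L[ℂ] Spinor) (ha : Continuous a)
      (hb : ∀ ξ, ‖a ξ‖ ≤ freq ξ + 1), profileOp hT ha hb (expCurve T κ)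
        = fourierOp fun ξ => profileSymbol T (expProfile κ) (freq ξ) • a ξ := by
    intro a ha hb
    rw [← h1]
    rfl
  have hs : ∀ (a : Space → Spinor →L[ℂ] Spinor) (ha : Continuous a)
      (hb : ∀ ξ, ‖a ξ‖ ≤ freq ξ + 1),
      IsSymbol fun ξ => profileSymbol T (expProfile κ) (freq ξ) • a ξ := by
    intro a ha hb
    refine ⟨(((continuous_profileSymbol T (continuous_expProfile κ)).comp
      continuous_freq).smul ha).stronglyMeasurable,
      Real.exp (‖κ‖ * T) * T + Real.exp (‖κ‖ * T) * T ^ 2, fun ξ => ?_⟩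
    have h2 := mul_norm_profileSymbol_le hT (fun _ ht => norm_expProfile_le κ ht) (freq_nonneg ξ)
    have h3 := norm_profileSymbol_le hT (fun _ ht => norm_expProfile_le κ ht) (freq ξ)
    rw [norm_smul]
    nlinarith [mul_le_mul_of_nonneg_left (hb ξ)
      (norm_nonneg (profileSymbol T (expProfile κ) (freq ξ)))]
  rw [e, e, ← fourierOp_const_smul (hs _ continuous_const norm_one_le_freq_add_one),
    ← fourierOp_add (hs _ continuous_diracSymbol (norm_diracSymbol_le_freq hα))]
  · unfold propagator
    congr 1
    funext ξ
    unfold propagatorSymbol shiftedSymbol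
    rw [smul_add, smul_comm z]
  · exact (hs _ continuous_const norm_one_le_freq_add_one).smul (b := fun _ => z)
      stronglyMeasurable_const (fun _ => le_rfl)

theorem analyticAt_propagator (hα : IsDiracMatrices α) {T : ℝ} (hT : 0 ≤ T) {w : ℂ} (hw : w ≠ 0) :
    AnalyticAt ℂ (fun w => propagator α T (momentum w) (spectralParam w)) w := by
  simp only [propagator_eq_profileOp hα hT]
  have h1 : AnalyticAt ℂ (fun w => expCurve T (momentum w)) w :=
    (analyticAt_expCurve T _).comp (analyticAt_momentum hw)
  exact (((profileOp hT _ _).analyticAt _).comp h1).add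
    ((analyticAt_spectralParam hw).smul (((profileOp hT _ _).analyticAt _).comp h1))

end Propagator

end DiracResonance

end

noncomputable section

namespace DiracResonance

/-! ### Integrals of plane waves over the unit sphere -/

section PolarCoordinates

/-- The unit sphere of `ℝ³`. -/
abbrev UnitSphere : Type := Metric.sphere (0 : Space) 1

/-- The surface measure of the unit sphere. -/
abbrev sphereMeasure : Measure UnitSphere := (volume : Measure Space).toSphere

theorem integral_polar {F : Type*} [NormedAddCommGroup F] [NormedSpace ℝ F]
    {f : Space → F} (hf : Integrable f) :
    ∫ x, f x = ∫ r in Set.Ioi (0 : ℝ), r ^ 2 • ∫ θ, f (r • (θ : Space)) ∂sphereMeasure := by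
  have hmp := (volume : Measure Space).measurePreserving_homeomorphUnitSphereProd
  have hemb := (Homeomorph.measurableEmbedding (homeomorphUnitSphereProd Space))
  let G : UnitSphere × Set.Ioi (0 : ℝ) → F := fun q => f ((q.2 : ℝ) • (q.1 : Space))
  have hG : ∀ x : ({(0 : Space)}ᶜ : Set Space), G (homeomorphUnitSphereProd Space x) = f x := by
    intro x
    change f (((homeomorphUnitSphereProd Space x).2 : ℝ) • ((homeomorphUnitSphereProd Space x).1 : Space)) = _
    rw [← homeomorphUnitSphereProd_symm_apply_coe, Homeomorph.symm_apply_apply]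
  have h1 : ∫ x, f x = ∫ q, G q ∂(sphereMeasure.prod (Measure.volumeIoiPow 2)) := by
    have h := hmp.integral_comp hemb G
    simp only [hG] at h
    rw [integral_subtype_comap (measurableSet_singleton _).compl f,
      restrict_compl_singleton] at h
    rw [h, finrank_euclideanSpace_fin]
  have hGi : Integrable G (sphereMeasure.prod (Measure.volumeIoiPow 2)) := by
    have h := hmp.integrable_comp_emb (g := G) hemb
    rw [finrank_euclideanSpace_fin] at h
    refine h.1 ?_
    have e : G ∘ homeomorphUnitSphereProd Space = f ∘ Subtype.val := funext hG
    rw [e, ← integrableOn_iff_comap_subtypeVal (measurableSet_singleton _).compl]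
    exact hf.integrableOn
  rw [h1, integral_prod_symm _ hGi]
  simp only [Measure.volumeIoiPow, ENNReal.ofReal]
  rw [integral_withDensity_eq_integral_smul (measurable_subtype_coe.pow_const _).real_toNNReal,
    integral_subtype_comap measurableSet_Ioi fun a : ℝ => Real.toNNReal (a ^ 2) •
      ∫ θ, f (a • (θ : Space)) ∂sphereMeasure]
  refine setIntegral_congr_fun measurableSet_Ioi fun x hx => ?_
  rw [NNReal.smul_def, Real.coe_toNNReal _ (sq_nonneg _)]

/-- The moments of the half-line Gaussian. -/
def gaussMoment (n : ℕ) : ℝ := ∫ x in Set.Ioi (0 : ℝ), x ^ n * Real.exp (-x ^ 2)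

theorem gaussMoment_eq (n : ℕ) : gaussMoment n = 1 / 2 * Real.Gamma (((n : ℝ) + 1) / 2) := by
  have h := integral_rpow_mul_exp_neg_rpow (p := 2) (q := n) two_pos
    (by have : (0 : ℝ) ≤ n := n.cast_nonneg
        linarith)
  rw [← h]
  refine setIntegral_congr_fun measurableSet_Ioi fun x _ => ?_
  simp only [Real.rpow_natCast, Real.rpow_two]

theorem gaussMoment_pos (n : ℕ) : 0 < gaussMoment n := by
  rw [gaussMoment_eq]
  have := Real.Gamma_pos_of_pos (s := ((n : ℝ) + 1) / 2) (by positivity)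
  positivity

theorem gaussMoment_add_two (n : ℕ) : gaussMoment (n + 2) = (n + 1) / 2 * gaussMoment n := by
  rw [gaussMoment_eq, gaussMoment_eq]
  have : ((n + 2 : ℕ) + 1 : ℝ) / 2 = ((n : ℝ) + 1) / 2 + 1 := by push_cast; ring
  rw [this, Real.Gamma_add_one (by positivity)]
  ring

theorem integrable_pow_mul_gauss (n : ℕ) : Integrable fun x : ℝ => x ^ n * Real.exp (-x ^ 2) := by
  have h := integrable_rpow_mul_exp_neg_mul_sq (b := 1) one_pos (s := n)
    (by have : (0 : ℝ) ≤ n := n.cast_nonneg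
        linarith)
  simpa [Real.rpow_natCast] using h

theorem integral_pow_mul_gauss (n : ℕ) :
    ∫ x : ℝ, x ^ n * Real.exp (-x ^ 2) = (1 + (-1) ^ n) * gaussMoment n := by
  have hi := integrable_pow_mul_gauss n
  rw [← intervalIntegral.integral_Iic_add_Ioi (b := 0) hi.integrableOn hi.integrableOn]
  have h := integral_comp_neg_Ioi 0 fun x : ℝ => x ^ n * Real.exp (-x ^ 2)
  rw [neg_zero] at h
  rw [← h]
  have e : ∀ x : ℝ, (-x) ^ n * Real.exp (-(-x) ^ 2) = (-1) ^ n * (x ^ n * Real.exp (-x ^ 2)) := by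
    intro x
    rw [neg_pow x n, neg_sq, mul_assoc]
  simp only [e]
  rw [integral_const_mul]
  unfold gaussMoment
  ring

theorem integral_coord_pow_mul_gauss (n : ℕ) :
    ∫ x : Space, x 0 ^ n * Real.exp (-‖x‖ ^ 2) = Real.pi * ((1 + (-1) ^ n) * gaussMoment n) := by
  rw [← (PiLp.volume_preserving_toLp (Fin 3)).integral_comp
    (MeasurableEquiv.toLp 2 (Fin 3 → ℝ)).measurableEmbedding]
  let f : Fin 3 → ℝ → ℝ := Fin.cons (fun x => x ^ n * Real.exp (-x ^ 2))
    fun _ x => Real.exp (-x ^ 2)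
  have h1 : ∀ y : Fin 3 → ℝ, (WithLp.toLp 2 y : Space) 0 ^ n
      * Real.exp (-‖(WithLp.toLp 2 y : Space)‖ ^ 2) = ∏ i, f i (y i) := by
    intro y
    rw [EuclideanSpace.norm_sq_eq, Fin.sum_univ_three, Fin.prod_univ_three]
    simp only [f, Real.norm_eq_abs, sq_abs]
    change _ = (y 0 ^ n * Real.exp (-y 0 ^ 2)) * Real.exp (-y 1 ^ 2) * Real.exp (-y 2 ^ 2)
    rw [mul_assoc, mul_assoc, ← Real.exp_add, ← Real.exp_add]
    congr 2
    ring
  simp only [h1]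
  rw [integral_fin_nat_prod_volume_eq_prod, Fin.prod_univ_three]
  change (∫ x : ℝ, x ^ n * Real.exp (-x ^ 2)) * (∫ x : ℝ, Real.exp (-x ^ 2))
    * (∫ x : ℝ, Real.exp (-x ^ 2)) = _
  have h2 : ∫ x : ℝ, Real.exp (-x ^ 2) = Real.sqrt Real.pi := by
    have := integral_gaussian 1
    simpa using this
  rw [h2, integral_pow_mul_gauss, mul_assoc, Real.mul_self_sqrt Real.pi_pos.le, mul_comm]

theorem integral_inner_pow_mul_gauss (n : ℕ) (z : Space) :
    ∫ x : Space, inner ℝ x z ^ n * Real.exp (-‖x‖ ^ 2)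
      = ‖z‖ ^ n * (Real.pi * ((1 + (-1) ^ n) * gaussMoment n)) := by
  set e : Space := EuclideanSpace.single 0 ‖z‖ with he
  have hn : ‖e‖ = ‖z‖ := by simp [he]
  -- A reflection exchanging `z` with a multiple of the first basis vector reduces the claim to a
  -- coordinate power.
  set R : Space ≃ₗᵢ[ℝ] Space := (Submodule.span ℝ {e - z})ᗮ.reflection
  have hR : R e = z := Submodule.reflection_sub hn
  have h1 := R.measurePreserving.integral_comp R.toHomeomorph.measurableEmbedding
    fun x : Space => inner ℝ x z ^ n * Real.exp (-‖x‖ ^ 2)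
  rw [← h1]
  have h2 : ∀ x : Space, inner ℝ (R x) z ^ n * Real.exp (-‖R x‖ ^ 2)
      = ‖z‖ ^ n * (x 0 ^ n * Real.exp (-‖x‖ ^ 2)) := by
    intro x
    conv_lhs => rw [← hR]
    rw [R.inner_map_map, R.norm_map, he, EuclideanSpace.inner_single_right]
    simp only [conj_trivial]
    rw [mul_pow, mul_assoc]
  simp only [h2]
  rw [integral_const_mul, integral_coord_pow_mul_gauss]

theorem integrable_inner_pow_mul_gauss (n : ℕ) (z : Space) :
    Integrable fun x : Space => inner ℝ x z ^ n * Real.exp (-‖x‖ ^ 2) := by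
  have h1 : Integrable fun x : Space => ‖x‖ ^ n * Real.exp (-‖x‖ ^ 2) := by
    refine (integrable_fun_norm_addHaar (volume : Measure Space)
      (f := fun r => r ^ n * Real.exp (-r ^ 2))).2 ?_
    rw [finrank_euclideanSpace_fin]
    refine (integrable_pow_mul_gauss (2 + n)).integrableOn.congr_fun (fun x _ => ?_)
      measurableSet_Ioi
    simp only [smul_eq_mul]
    rw [pow_add, mul_assoc]
  refine (h1.const_mul (‖z‖ ^ n)).mono' (Continuous.aestronglyMeasurable (by fun_prop))
    (ae_of_all _ fun x => ?_)
  rw [norm_mul, norm_pow, Real.norm_of_nonneg (Real.exp_pos _).le, ← mul_assoc, ← mul_pow]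
  gcongr
  rw [mul_comm]
  exact norm_inner_le_norm x z

/-- Archimedes: a coordinate is uniformly distributed under the surface measure. The moments follow
by evaluating a Gaussian integral in Cartesian and in polar coordinates and dividing by the radial
moment. -/
theorem integral_sphere_inner_pow (n : ℕ) (z : Space) :
    ∫ θ : UnitSphere, inner ℝ (θ : Space) z ^ n ∂sphereMeasure
      = 2 * Real.pi * ∫ s in (-1 : ℝ)..1, (‖z‖ * s) ^ n := by
  have h1 := integral_polar (integrable_inner_pow_mul_gauss n z)
  rw [integral_inner_pow_mul_gauss] at h1
  have h2 : ∫ r in Set.Ioi (0 : ℝ), r ^ 2 • ∫ θ : UnitSphere,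
      inner ℝ (r • (θ : Space)) z ^ n * Real.exp (-‖r • (θ : Space)‖ ^ 2) ∂sphereMeasure
      = gaussMoment (n + 2) * ∫ θ : UnitSphere, inner ℝ (θ : Space) z ^ n ∂sphereMeasure := by
    unfold gaussMoment
    rw [← integral_mul_const]
    refine setIntegral_congr_fun measurableSet_Ioi fun r hr => ?_
    have h3 : ∀ θ : UnitSphere, inner ℝ (r • (θ : Space)) z ^ n
        * Real.exp (-‖r • (θ : Space)‖ ^ 2)
        = (r ^ n * Real.exp (-r ^ 2)) * inner ℝ (θ : Space) z ^ n := by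
      intro θ
      have hθ : ‖(θ : Space)‖ = 1 := by simpa using θ.2
      rw [norm_smul, hθ, mul_one, Real.norm_eq_abs, sq_abs, real_inner_smul_left, mul_pow]
      ring
    simp only [h3]
    rw [integral_const_mul, smul_eq_mul, pow_add]
    ring
  rw [h2, gaussMoment_add_two] at h1
  have h4 : ∫ s in (-1 : ℝ)..1, (‖z‖ * s) ^ n = ‖z‖ ^ n * ((1 + (-1) ^ n) / (n + 1)) := by
    simp only [mul_pow]
    rw [intervalIntegral.integral_const_mul, integral_pow]
    congr 2
    rw [one_pow, pow_succ]
    ring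
  rw [h4]
  have h5 := gaussMoment_pos n
  have h6 : (0 : ℝ) < n + 1 := by positivity
  field_simp
  have h7 : gaussMoment n * (‖z‖ ^ n * (Real.pi * (1 + (-1) ^ n)) * 2)
      = gaussMoment n * ((n + 1) * ∫ θ : UnitSphere, inner ℝ (θ : Space) z ^ n ∂sphereMeasure) := by
    linear_combination 2 * h1
  have h8 := mul_left_cancel₀ h5.ne' h7
  linear_combination -h8

theorem hasSum_integral_exp {X : Type*} [MeasurableSpace X] (ν : Measure X) [IsFiniteMeasure ν]
    {s : X → ℝ} (hs : AEStronglyMeasurable s ν) {B : ℝ} (hB : ∀ᵐ x ∂ν, |s x| ≤ B) (c : ℂ) :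
    HasSum (fun n : ℕ => c ^ n / n.factorial * ((∫ x, s x ^ n ∂ν : ℝ) : ℂ))
      (∫ x, Complex.exp (c * s x) ∂ν) := by
  have h := hasSum_integral_of_dominated_convergence (μ := ν)
    (F := fun (n : ℕ) x => (c * s x) ^ n / n.factorial) (f := fun x => Complex.exp (c * s x))
    (fun (n : ℕ) _ => (‖c‖ * B) ^ n / n.factorial) ?_ ?_ ?_ ?_ ?_
  · have e : ∀ n : ℕ, ∫ x, (c * (s x : ℂ)) ^ n / n.factorial ∂ν
        = c ^ n / n.factorial * ((∫ x, s x ^ n ∂ν : ℝ) : ℂ) := by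
      intro n
      rw [← integral_complex_ofReal, ← integral_const_mul]
      refine integral_congr_ae (ae_of_all _ fun x => ?_)
      dsimp only
      push_cast
      ring
    simpa only [e] using h
  · intro n
    have := (Complex.continuous_ofReal.comp_aestronglyMeasurable hs)
    have h2 : Continuous fun y : ℂ => (c * y) ^ n / n.factorial := by fun_prop
    exact h2.comp_aestronglyMeasurable this
  · intro n
    filter_upwards [hB] with x hx
    rw [norm_div, norm_pow, norm_mul, Complex.norm_real, Complex.norm_natCast]
    gcongr
    exact hx
  · exact ae_of_all _ fun _ => Real.summable_pow_div_factorial _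
  · exact integrable_const _
  · refine ae_of_all _ fun x => ?_
    rw [Complex.exp_eq_exp_ℂ]
    exact NormedSpace.expSeries_div_hasSum_exp _

/-- Both sides are power series in `c`, with the same coefficients by the moment formula. -/
theorem integral_sphere_exp (c : ℂ) (z : Space) :
    ∫ θ : UnitSphere, Complex.exp (c * (inner ℝ (θ : Space) z : ℝ)) ∂sphereMeasure
      = 2 * Real.pi * ∫ s in (-1 : ℝ)..1, Complex.exp (c * (‖z‖ * s : ℝ)) := by
  have h1 := hasSum_integral_exp sphereMeasure
    (s := fun θ : UnitSphere => inner ℝ (θ : Space) z) (B := ‖z‖)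
    (Continuous.aestronglyMeasurable (by fun_prop))
    (ae_of_all _ fun θ => by
      have h := norm_inner_le_norm (𝕜 := ℝ) (θ : Space) z
      have hθ : ‖(θ : Space)‖ = 1 := by simpa using θ.2
      rwa [hθ, one_mul] at h) c
  have h2 := hasSum_integral_exp (volume.restrict (Set.Ioc (-1 : ℝ) 1))
    (s := fun s => ‖z‖ * s) (B := ‖z‖) (Continuous.aestronglyMeasurable (by fun_prop))
    ((ae_restrict_iff' measurableSet_Ioc).2 (ae_of_all _ fun s hs => by
      rw [abs_mul, abs_norm]
      exact mul_le_of_le_one_right (norm_nonneg _) (abs_le.2 ⟨hs.1.le, hs.2⟩))) c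
  rw [intervalIntegral.integral_of_le (by norm_num)]
  refine h1.unique ?_
  have h3 := h2.mul_left (2 * (Real.pi : ℂ))
  have e : ∀ n : ℕ, 2 * (Real.pi : ℂ) * (c ^ n / n.factorial
      * ((∫ s in Set.Ioc (-1 : ℝ) 1, (‖z‖ * s) ^ n : ℝ) : ℂ))
      = c ^ n / n.factorial
        * ((∫ θ : UnitSphere, inner ℝ (θ : Space) z ^ n ∂sphereMeasure : ℝ) : ℂ) := by
    intro n
    rw [integral_sphere_inner_pow, intervalIntegral.integral_of_le (by norm_num)]
    push_cast
    ring
  simpa only [e] using h3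

theorem mul_integral_sphere_exp (κ : ℂ) (z : Space) :
    κ * ‖z‖ * ∫ θ : UnitSphere, Complex.exp (Complex.I * κ * (inner ℝ (θ : Space) z : ℝ)) ∂sphereMeasure
      = 4 * Real.pi * Complex.sin (κ * ‖z‖) := by
  rw [integral_sphere_exp]
  rcases eq_or_ne (κ * ‖z‖) 0 with h | h
  · rw [h]
    simp
  · have e : ∀ s : ℝ, Complex.exp (Complex.I * κ * ((‖z‖ * s : ℝ) : ℂ))
        = Complex.exp (Complex.I * (κ * ‖z‖) * s) := by
      intro s
      congr 1
      push_cast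
      ring
    simp only [e]
    rw [integral_exp_mul_complex (mul_ne_zero Complex.I_ne_zero h), Complex.sin]
    set x := κ * (‖z‖ : ℂ)
    push_cast
    rw [show Complex.I * x * 1 = x * Complex.I by ring, show Complex.I * x * (-1) = -x * Complex.I by ring]
    field_simp
    linear_combination (4 * (Complex.exp (x * Complex.I) - Complex.exp (-(x * Complex.I)))) * Complex.I_sq

theorem integral_sphere_planeWave (r : ℝ) (ξ : Space) :
    ∫ θ : UnitSphere, Complex.exp (-(2 * Real.pi * r) * Complex.I * (inner ℝ (θ : Space) ξ : ℝ))
      ∂sphereMeasure = 4 * Real.pi * (Real.sinc (freq ξ * r) : ℝ) := by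
  rcases eq_or_ne (freq ξ * r) 0 with h | h
  · have h' : ‖ξ‖ = 0 ∨ r = 0 := by
      have := Real.pi_pos
      unfold freq at h
      rcases mul_eq_zero.1 h with h | h
      · left
        rcases mul_eq_zero.1 h with h | h
        · exact absurd h (by positivity)
        · exact h
      · exact Or.inr h
    rw [h, integral_sphere_exp]
    have e : ∀ s : ℝ, Complex.exp (-(2 * Real.pi * r) * Complex.I * ((‖ξ‖ * s : ℝ) : ℂ)) = 1 := by
      intro s
      rcases h' with h' | h' <;> simp [h']
    simp only [e]
    simp
    norm_num
    ring
  · have h1 := mul_integral_sphere_exp (-(2 * Real.pi * r)) ξ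
    rw [Real.sinc_of_ne_zero h]
    have e : (-(2 * Real.pi * r) : ℂ) * ‖ξ‖ = -((freq ξ * r : ℝ) : ℂ) := by
      unfold freq
      push_cast
      ring
    rw [e, Complex.sin_neg, ← Complex.ofReal_sin] at h1
    have h2 : ((freq ξ * r : ℝ) : ℂ) ≠ 0 := by exact_mod_cast h
    have e2 : ∀ θ : UnitSphere, Complex.I * (-(2 * Real.pi * r) : ℂ) * (inner ℝ (θ : Space) ξ : ℝ)
        = -(2 * Real.pi * r) * Complex.I * (inner ℝ (θ : Space) ξ : ℝ) := fun θ => by ring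
    simp only [e2] at h1
    rw [Complex.ofReal_div]
    rw [mul_div_assoc', eq_div_iff h2]
    linear_combination -h1

end PolarCoordinates

end DiracResonance

end

noncomputable section

namespace DiracResonance

/-! ### Fourier transforms of radial kernels -/

section RadialKernels

/-- The plane wave `e^{-2πi z·ξ}`. -/
abbrev realWave (z ξ : Space) : ℂ := planeWave (fun i => 2 * Real.pi * (z i : ℂ)) ξ

theorem planeWave_smul_eq_exp (r : ℝ) (θ ξ : Space) :
    realWave ξ (r • θ) = Complex.exp (-(2 * Real.pi * r) * Complex.I * (inner ℝ θ ξ : ℝ)) := by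
  unfold realWave planeWave
  congr 1
  simp only [PiLp.inner_apply, RCLike.inner_apply, conj_trivial, PiLp.smul_apply, smul_eq_mul]
  push_cast
  rw [Finset.mul_sum, Finset.mul_sum]
  refine Finset.sum_congr rfl fun i _ => ?_
  ring

/-- The kernel `g(|z|) / (4π|z|)`. -/
def radialKernel (g : ℝ → ℂ) (z : Space) : ℂ := g ‖z‖ / (4 * Real.pi * ‖z‖)

theorem integrable_radialKernel {g : ℝ → ℂ} (hg : IntegrableOn (fun r : ℝ => (r : ℂ) * g r) (Set.Ioi 0)) :
    Integrable (radialKernel g) := by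
  refine (integrable_fun_norm_addHaar (volume : Measure Space)
    (f := fun r => g r / (4 * Real.pi * (r : ℂ)))).2 ?_
  rw [finrank_euclideanSpace_fin]
  refine IntegrableOn.congr_fun (hg.mul_const (4 * Real.pi : ℂ)⁻¹) (fun r hr => ?_) measurableSet_Ioi
  have h1 : (r : ℂ) ≠ 0 := by exact_mod_cast (ne_of_gt hr)
  have h2 : (Real.pi : ℂ) ≠ 0 := by exact_mod_cast Real.pi_ne_zero
  rw [Complex.real_smul]
  push_cast
  field_simp

/-- The spherical integral of a plane wave is `4π sinc`, so the radial weight `r²` turns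
`g(r)/(4πr)` into `g(r) sin(pr)/p`. A profile living on times `t` thus has a convolution kernel
living on `|z| = t`: this is Huygens' principle at the level of kernels. -/
theorem integral_realWave_mul_radialKernel {g : ℝ → ℂ}
    (hg : IntegrableOn (fun r : ℝ => (r : ℂ) * g r) (Set.Ioi 0)) (ξ : Space) :
    ∫ z, radialKernel g z * realWave z ξ = ∫ r in Set.Ioi (0 : ℝ), g r * (waveSin (freq ξ) r : ℂ) := by
  have h0 : ∀ z, radialKernel g z * realWave z ξ = realWave ξ z * radialKernel g z := by
    intro z
    rw [mul_comm, realWave, planeWave_comm]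
  simp only [h0]
  have hi : Integrable fun z => realWave ξ z * radialKernel g z :=
    (integrable_radialKernel hg).bdd_mul (continuous_planeWave _).aestronglyMeasurable
      (ae_of_all _ fun z => (norm_planeWave_real ξ z).le)
  rw [integral_polar hi]
  refine setIntegral_congr_fun measurableSet_Ioi fun r hr => ?_
  have h1 : (r : ℂ) ≠ 0 := by exact_mod_cast (ne_of_gt hr)
  have h2 : (Real.pi : ℂ) ≠ 0 := by exact_mod_cast Real.pi_ne_zero
  have h3 : ∀ θ : UnitSphere, realWave ξ (r • (θ : Space)) * radialKernel g (r • (θ : Space))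
      = (g r / (4 * Real.pi * r))
        * Complex.exp (-(2 * Real.pi * r) * Complex.I * (inner ℝ (θ : Space) ξ : ℝ)) := by
    intro θ
    have hθ : ‖(θ : Space)‖ = 1 := by simpa using θ.2
    rw [planeWave_smul_eq_exp, radialKernel, norm_smul, hθ, mul_one,
      Real.norm_of_nonneg (le_of_lt hr), mul_comm]
  simp only [h3]
  rw [integral_const_mul, integral_sphere_planeWave, Complex.real_smul, waveSin]
  push_cast
  field_simp

end RadialKernels

/-! ### Matrix elements of multipliers as averages of translations -/

section Convolution

variable {α : Fin 4 → Matrix (Fin 4) (Fin 4) ℂ}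

/-- The pairing of the Fourier transforms. -/
def fourierPairing (v u : L2) (ξ : Space) : ℂ := inner ℂ (fourierL2 v ξ) (fourierL2 u ξ)

theorem integrable_fourierPairing (v u : L2) : Integrable (fourierPairing v u) :=
  L2.integrable_inner _ _

theorem inner_translate (v u : L2) (z : Space) :
    inner ℂ v (translate z u) = ∫ ξ, realWave z ξ * fourierPairing v u ξ := by
  have hs : IsSymbol (fun ξ => realWave z ξ • (1 : Spinor →L[ℂ] Spinor)) :=
    isSymbol_scalar (continuous_planeWave _).stronglyMeasurable
      (fun ξ => (norm_planeWave_real z ξ).le)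
  rw [← fourierL2.inner_map_map v, fourierL2_translate, inner_mulOp hs]
  refine integral_congr_ae (ae_of_all _ fun ξ => ?_)
  exact inner_smul_right _ _ _

theorem realWave_add (z h ξ : Space) : realWave (z + h) ξ = realWave z ξ * realWave h ξ := by
  unfold realWave planeWave
  rw [← Complex.exp_add]
  congr 1
  simp only [PiLp.add_apply]
  push_cast
  rw [← mul_add, ← Finset.sum_add_distrib]
  congr 1
  refine Finset.sum_congr rfl fun i _ => ?_
  ring

theorem continuous_realWave_uncurry : Continuous fun q : Space × Space => realWave q.1 q.2 := by
  unfold realWave planeWave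
  fun_prop

/-- A Fourier multiplier that is the Fourier transform of an integrable kernel acts by averaging
translations. -/
theorem integral_mul_fourierPairing {k : Space → ℂ} (hk : Integrable k) {n : Space → ℂ}
    (hn : ∀ ξ, ∫ z, k z * realWave z ξ = n ξ) (v u : L2) (h : Space) :
    ∫ ξ, n ξ * realWave h ξ * fourierPairing v u ξ = ∫ z, k z * inner ℂ v (translate (z + h) u) := by
  have e1 : ∀ ξ, n ξ * realWave h ξ * fourierPairing v u ξ
      = ∫ z, k z * realWave (z + h) ξ * fourierPairing v u ξ := by
    intro ξ
    rw [← hn, mul_assoc, ← integral_mul_const]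
    refine integral_congr_ae (ae_of_all _ fun z => ?_)
    dsimp only
    rw [realWave_add]
    ring
  have e2 : ∀ z, k z * inner ℂ v (translate (z + h) u)
      = ∫ ξ, k z * realWave (z + h) ξ * fourierPairing v u ξ := by
    intro z
    rw [inner_translate, ← integral_const_mul]
    simp only [mul_assoc]
  simp only [e1, e2]
  refine integral_integral_swap ?_
  have hi := (integrable_fourierPairing v u).mul_prod hk
  have hb := hi.bdd_mul (f := fun q : Space × Space => realWave (q.2 + h) q.1) (c := 1)
    (continuous_realWave_uncurry.comp
      (by fun_prop : Continuous fun q : Space × Space => (q.2 + h, q.1))).aestronglyMeasurable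
    (ae_of_all _ fun q => (norm_planeWave_real _ _).le)
  refine hb.congr (ae_of_all _ fun q => ?_)
  simp only [Function.uncurry]
  ring

theorem realWave_single (j : Fin 3) (t : ℝ) (ξ : Space) :
    realWave (EuclideanSpace.single j t) ξ = Complex.exp (-(2 * Real.pi * ξ j) * Complex.I * t) := by
  unfold realWave planeWave
  congr 1
  rw [Finset.sum_eq_single j]
  · simp
    ring
  · intro i _ hi
    simp [hi]
  · simp

/-- The factor `ξⱼ` of the Dirac symbol is a derivative in the translation parameter. First-order
multipliers can therefore be read off from scalar kernels, once the pairing is known for all small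
translations. -/
theorem hasDerivAt_integral_realWave {n q : Space → ℂ} (hn : AEStronglyMeasurable n volume)
    {C : ℝ} (h1 : ∀ ξ, ‖n ξ‖ ≤ C) (h2 : ∀ ξ, freq ξ * ‖n ξ‖ ≤ C) (hq : Integrable q) (j : Fin 3) :
    HasDerivAt (fun t : ℝ => ∫ ξ, n ξ * realWave (EuclideanSpace.single j t) ξ * q ξ)
      (-Complex.I * ∫ ξ, n ξ * (2 * Real.pi * (ξ j : ℂ)) * q ξ) 0 := by
  have hcj : Continuous fun ξ : Space => (2 * Real.pi * (ξ j : ℂ)) := by fun_prop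
  have h := hasDerivAt_integral_of_dominated_loc_of_deriv_le (μ := (volume : Measure Space))
    (F := fun (t : ℝ) ξ => n ξ * realWave (EuclideanSpace.single j t) ξ * q ξ)
    (F' := fun t ξ => n ξ * (realWave (EuclideanSpace.single j t) ξ
      * (-(2 * Real.pi * ξ j) * Complex.I)) * q ξ)
    (bound := fun ξ => C * ‖q ξ‖) (x₀ := (0 : ℝ)) (s := Set.univ) univ_mem ?_ ?_ ?_ ?_ ?_ ?_
  · refine h.2.congr_deriv ?_
    rw [← integral_const_mul]
    refine integral_congr_ae (ae_of_all _ fun ξ => ?_)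
    dsimp only
    rw [realWave_single]
    simp
    ring
  · exact Eventually.of_forall fun t =>
      (hn.mul (continuous_planeWave _).aestronglyMeasurable).mul hq.aestronglyMeasurable
  · refine hq.bdd_mul (c := C) (hn.mul (continuous_planeWave _).aestronglyMeasurable)
      (ae_of_all _ fun ξ => ?_)
    rw [norm_mul, norm_planeWave_real, mul_one]
    exact h1 ξ
  · exact (hn.mul ((continuous_planeWave _).aestronglyMeasurable.mul
      (Continuous.aestronglyMeasurable (by fun_prop)))).mul hq.aestronglyMeasurable
  · refine ae_of_all _ fun ξ t _ => ?_
    rw [norm_mul]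
    refine mul_le_mul_of_nonneg_right ?_ (norm_nonneg _)
    refine le_trans ?_ (h2 ξ)
    rw [norm_mul, norm_mul, norm_planeWave_real, one_mul, mul_comm]
    refine mul_le_mul_of_nonneg_right ?_ (norm_nonneg _)
    have e2 : |ξ j| ≤ ‖ξ‖ := PiLp.norm_apply_le ξ j
    have e1 : ‖-(2 * (Real.pi : ℂ) * ξ j) * Complex.I‖ = 2 * Real.pi * |ξ j| := by
      simp [abs_of_pos Real.pi_pos]
    rw [e1]
    unfold freq
    have := Real.pi_pos
    gcongr
  · exact hq.norm.const_mul C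
  · refine ae_of_all _ fun ξ t _ => ?_
    simp only [realWave_single]
    have h3 : HasDerivAt (fun s : ℝ => -(2 * Real.pi * (ξ j : ℂ)) * Complex.I * (s : ℂ))
        (-(2 * Real.pi * (ξ j : ℂ)) * Complex.I) t := by
      simpa using (Complex.ofRealCLM.hasDerivAt (x := t)).const_mul
        (-(2 * Real.pi * (ξ j : ℂ)) * Complex.I)
    exact (h3.cexp.const_mul (n ξ)).mul_const (q ξ)

/-- Reduces a Dirac matrix element to scalar multipliers: the constant matrices commute with the
Fourier transform and are moved onto `u`. -/
theorem inner_fourierOp_smul_shiftedSymbol (hα : IsDiracMatrices α) {n : Space → ℂ}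
    (hn : StronglyMeasurable n) {C : ℝ} (h1 : ∀ ξ, ‖n ξ‖ ≤ C) (h2 : ∀ ξ, freq ξ * ‖n ξ‖ ≤ C)
    (z : ℂ) (v u : L2) :
    inner ℂ v (fourierOp (fun ξ => n ξ • shiftedSymbol α z ξ) u)
      = ∑ j : Fin 3, (∫ ξ, n ξ * (2 * Real.pi * (ξ j : ℂ))
          * fourierPairing v (mulOp (fun _ => spinorOp (α j.castSucc)) u) ξ)
        + (∫ ξ, n ξ * fourierPairing v (mulOp (fun _ => spinorOp (α 3)) u) ξ)
        + z * ∫ ξ, n ξ * fourierPairing v u ξ := by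
  have hs : IsSymbol (fun ξ => n ξ • shiftedSymbol α z ξ) := by
    refine ⟨hn.smul (continuous_shiftedSymbol z).stronglyMeasurable, C + (1 + ‖z‖) * C,
      fun ξ => norm_smul_shiftedSymbol_le hα (h2 ξ) (h1 ξ)⟩
  rw [inner_fourierOp hs]
  have hint : ∀ x y : L2, Integrable fun ξ => n ξ * fourierPairing x y ξ := fun x y =>
    (integrable_fourierPairing x y).bdd_mul hn.aestronglyMeasurable (ae_of_all _ h1)
  have hcj : ∀ j : Fin 3, Continuous fun ξ : Space => (2 * Real.pi * (ξ j : ℂ)) :=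
    fun j => by fun_prop
  have hintj : ∀ (j : Fin 3) (x y : L2),
      Integrable fun ξ => n ξ * (2 * Real.pi * (ξ j : ℂ)) * fourierPairing x y ξ := by
    intro j x y
    refine (integrable_fourierPairing x y).bdd_mul (c := C)
      (hn.mul (hcj j).stronglyMeasurable).aestronglyMeasurable (ae_of_all _ fun ξ => ?_)
    refine le_trans ?_ (h2 ξ)
    rw [norm_mul, mul_comm]
    refine mul_le_mul_of_nonneg_right ?_ (norm_nonneg _)
    have e2 : |ξ j| ≤ ‖ξ‖ := PiLp.norm_apply_le ξ j
    have e1 : ‖2 * (Real.pi : ℂ) * ξ j‖ = 2 * Real.pi * |ξ j| := by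
      simp [abs_of_pos Real.pi_pos]
    rw [e1]
    unfold freq
    have := Real.pi_pos
    gcongr
  have hS : Integrable fun ξ => ∑ j : Fin 3, n ξ * (2 * Real.pi * (ξ j : ℂ))
      * fourierPairing v (mulOp (fun _ => spinorOp (α j.castSucc)) u) ξ :=
    integrable_finsetSum _ fun j _ => hintj j _ _
  have hSB : Integrable fun ξ => (∑ j : Fin 3, n ξ * (2 * Real.pi * (ξ j : ℂ))
      * fourierPairing v (mulOp (fun _ => spinorOp (α j.castSucc)) u) ξ)
      + n ξ * fourierPairing v (mulOp (fun _ => spinorOp (α 3)) u) ξ := hS.add (hint _ _)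
  rw [← integral_const_mul, ← integral_finsetSum _ fun j _ => hintj j _ _,
    ← integral_add hS (hint _ _), ← integral_add hSB ((hint _ _).const_mul z)]
  have hcoe : ∀ a : Spinor →L[ℂ] Spinor, ∀ᵐ ξ, fourierL2 (mulOp (fun _ => a) u) ξ
      = a (fourierL2 u ξ) := by
    intro a
    rw [fourierL2_mulOp_const]
    exact coeFn_mulOp (IsSymbol.const a) _
  refine integral_congr_ae ?_
  filter_upwards [hcoe (spinorOp (α 3)), ae_all_iff.2 fun j : Fin 3 => hcoe (spinorOp (α j.castSucc))]
    with ξ e3 ej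
  have e : (n ξ • shiftedSymbol α z ξ) (fourierL2 u ξ)
      = n ξ • (diracSymbol α ξ (fourierL2 u ξ) + z • fourierL2 u ξ) := rfl
  rw [e, diracSymbol_apply]
  unfold fourierPairing
  simp only [e3, ej, inner_smul_right, inner_add_right, inner_sum]
  rw [mul_add, mul_add, Finset.mul_sum]
  simp only [mul_assoc]
  ring

/-- `u` vanishes outside the ball of radius `L`. -/
def SupportedIn (L : ℝ) (u : L2) : Prop := ∀ᵐ x : Space, L < ‖x‖ → u x = 0

theorem SupportedIn.mulOp_const {L : ℝ} {u : L2} (hu : SupportedIn L u)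
    (a : Spinor →L[ℂ] Spinor) : SupportedIn L (mulOp (fun _ => a) u) := by
  filter_upwards [hu, coeFn_mulOp (IsSymbol.const a) u] with x h1 h2 hx
  rw [h2, h1 hx, map_zero]

theorem SupportedIn.ae_comp_sub {L : ℝ} {u : L2} (hu : SupportedIn L u) (z : Space) :
    ∀ᵐ x : Space, L < ‖x - z‖ → u (x - z) = 0 :=
  (measurePreserving_sub_right (volume : Measure Space) z).quasiMeasurePreserving.ae hu

theorem inner_translate_eq_zero {L : ℝ} {v u : L2} (hv : SupportedIn L v) (hu : SupportedIn L u)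
    {z : Space} (hz : 2 * L < ‖z‖) : inner ℂ v (translate z u) = 0 := by
  rw [L2.inner_def]
  refine integral_eq_zero_of_ae ?_
  filter_upwards [hv, hu.ae_comp_sub z, coeFn_translate z u] with x h1 h2 h3
  rw [h3]
  rcases lt_or_ge L ‖x‖ with h | h
  · rw [h1 h, inner_zero_left]
    rfl
  · rw [h2, inner_zero_right]
    · rfl
    · have := norm_sub_norm_le z x
      rw [norm_sub_rev] at this
      linarith

/-- Huygens' principle: a multiplier whose kernel vanishes near the ball of radius `2L` has no
matrix elements between functions supported in the ball of radius `L`. -/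
theorem inner_fourierOp_eq_zero (hα : IsDiracMatrices α) {k : Space → ℂ} (hk : Integrable k)
    {n : Space → ℂ} (hkn : ∀ ξ, ∫ z, k z * realWave z ξ = n ξ) (hn : StronglyMeasurable n) {C : ℝ}
    (h1 : ∀ ξ, ‖n ξ‖ ≤ C) (h2 : ∀ ξ, freq ξ * ‖n ξ‖ ≤ C) {L T : ℝ} (hLT : 2 * L < T)
    (hk0 : ∀ z, ‖z‖ ≤ T → k z = 0) {v u : L2} (hv : SupportedIn L v) (hu : SupportedIn L u) (z : ℂ) :
    inner ℂ v (fourierOp (fun ξ => n ξ • shiftedSymbol α z ξ) u) = 0 := by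
  -- The strict inequality `2L < T` leaves room for a translation by `h`: the kernel lives on `|s| >
  -- T`, where the shifted supports are still disjoint. Hence the pairing vanishes near `h = 0` and
  -- so do its derivatives.
  have hΦ : ∀ x y : L2, SupportedIn L x → SupportedIn L y → ∀ h : Space, ‖h‖ < T - 2 * L →
      ∫ ξ, n ξ * realWave h ξ * fourierPairing x y ξ = 0 := by
    intro x y hx hy h hh
    rw [integral_mul_fourierPairing hk hkn]
    refine integral_eq_zero_of_ae (ae_of_all _ fun s => ?_)
    dsimp only
    rcases le_or_gt ‖s‖ T with hs | hs
    · rw [hk0 s hs, zero_mul]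
      rfl
    · rw [inner_translate_eq_zero hx hy, mul_zero]
      · rfl
      · have := norm_sub_norm_le s (-h)
        rw [sub_neg_eq_add, norm_neg] at this
        linarith
  have hd : ∀ (j : Fin 3) (x y : L2), SupportedIn L x → SupportedIn L y →
      ∫ ξ, n ξ * (2 * Real.pi * (ξ j : ℂ)) * fourierPairing x y ξ = 0 := by
    intro j x y hx hy
    have h3 := hasDerivAt_integral_realWave hn.aestronglyMeasurable h1 h2
      (integrable_fourierPairing x y) j
    have h4 : (fun t : ℝ => ∫ ξ, n ξ * realWave (EuclideanSpace.single j t) ξ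
        * fourierPairing x y ξ) =ᶠ[𝓝 0] fun _ => 0 := by
      filter_upwards [Metric.ball_mem_nhds (0 : ℝ) (sub_pos.2 hLT)] with t ht
      refine hΦ x y hx hy _ ?_
      rw [EuclideanSpace.norm_single]
      simpa using ht
    have h5 := h3.unique ((hasDerivAt_const (0 : ℝ) (0 : ℂ)).congr_of_eventuallyEq h4)
    exact (mul_eq_zero.1 h5).resolve_left (neg_ne_zero.2 Complex.I_ne_zero)
  have h0 : ∀ x y : L2, SupportedIn L x → SupportedIn L y →
      ∫ ξ, n ξ * fourierPairing x y ξ = 0 := by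
    intro x y hx hy
    have := hΦ x y hx hy 0 (by simpa using hLT)
    have e : ∀ ξ, realWave 0 ξ = 1 := by
      intro ξ
      simp [realWave, planeWave]
    simpa only [e, mul_one] using this
  rw [inner_fourierOp_smul_shiftedSymbol hα hn h1 h2,
    Finset.sum_eq_zero fun j _ => hd j _ _ hv (hu.mulOp_const _), h0 _ _ hv (hu.mulOp_const _),
    h0 _ _ hv hu]
  simp

end Convolution

/-! ### Free resolvent and truncated resolvent between balls -/

section Huygens

variable {α : Fin 4 → Matrix (Fin 4) (Fin 4) ℂ}

theorem tendsto_wavePrimitive {κ : ℂ} (hκ : 0 < κ.im) (p : ℝ) :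
    Tendsto (wavePrimitive κ p) atTop (𝓝 0) := by
  have h1 : Tendsto (fun t : ℝ => ‖κ‖ / κ.im * ((κ.im * t) ^ 1 * Real.exp (-(κ.im * t)))
      + (κ.im * t) ^ 0 * Real.exp (-(κ.im * t))) atTop (𝓝 0) := by
    have ht : Tendsto (fun t : ℝ => κ.im * t) atTop atTop := tendsto_id.const_mul_atTop hκ
    have ha := ((Real.tendsto_pow_mul_exp_neg_atTop_nhds_zero 1).comp ht).const_mul (‖κ‖ / κ.im)
    have hb := (Real.tendsto_pow_mul_exp_neg_atTop_nhds_zero 0).comp ht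
    simpa using ha.add hb
  refine squeeze_zero_norm' ?_ h1
  filter_upwards [eventually_ge_atTop 0] with t ht
  unfold wavePrimitive
  rw [norm_mul, norm_expProfile]
  have h2 : ‖Complex.I * κ * waveSin p t - Real.cos (p * t)‖ ≤ ‖κ‖ * t + 1 := by
    refine (norm_sub_le _ _).trans (add_le_add ?_ ?_)
    · rw [norm_mul, norm_mul, Complex.norm_I, one_mul, Complex.norm_real]
      exact mul_le_mul_of_nonneg_left (abs_waveSin_le p ht) (norm_nonneg _)
    · rw [Complex.norm_real]
      exact Real.abs_cos_le_one _
  have h3 := mul_le_mul_of_nonneg_left h2 (Real.exp_pos (-(κ.im * t))).le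
  refine h3.trans (le_of_eq ?_)
  field_simp

theorem integrableOn_mul_expProfile {κ : ℂ} (hκ : 0 < κ.im) :
    IntegrableOn (fun r : ℝ => (r : ℂ) * expProfile κ r) (Set.Ioi 0) := by
  have h := integrableOn_rpow_mul_exp_neg_mul_rpow (p := 1) (s := 1) (b := κ.im) (by norm_num)
    one_pos hκ
  refine Integrable.mono' h (Continuous.aestronglyMeasurable ?_) ?_
  · have := continuous_expProfile κ
    fun_prop
  · refine (ae_restrict_iff' measurableSet_Ioi).2 (ae_of_all _ fun r hr => ?_)
    rw [norm_mul, norm_expProfile, Complex.norm_real, Real.norm_of_nonneg (le_of_lt hr),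
      Real.rpow_one, neg_mul]

theorem integrableOn_expProfile_mul_waveSin {κ : ℂ} (hκ : 0 < κ.im) (p : ℝ) :
    IntegrableOn (fun r : ℝ => expProfile κ r * (waveSin p r : ℂ)) (Set.Ioi 0) := by
  refine Integrable.mono (integrableOn_mul_expProfile hκ) (Continuous.aestronglyMeasurable ?_) ?_
  · refine (continuous_expProfile κ).mul (Complex.continuous_ofReal.comp ?_)
    exact continuous_waveSin.comp (by fun_prop : Continuous fun t : ℝ => (p, t))
  · refine (ae_restrict_iff' measurableSet_Ioi).2 (ae_of_all _ fun r hr => ?_)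
    rw [norm_mul, norm_mul, mul_comm, Complex.norm_real, Complex.norm_real]
    refine mul_le_mul_of_nonneg_right ?_ (norm_nonneg _)
    rw [Real.norm_eq_abs, Real.norm_of_nonneg (le_of_lt hr)]
    exact abs_waveSin_le p (le_of_lt hr)

theorem integral_Ioi_expProfile_mul_waveSin {κ : ℂ} (hκ : 0 < κ.im) {T : ℝ} (hT : 0 ≤ T) (p : ℝ) :
    ∫ t in Set.Ioi T, expProfile κ t * (waveSin p t : ℂ)
      = ((p : ℂ) ^ 2 - κ ^ 2)⁻¹ - profileSymbol T (expProfile κ) p := by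
  have hne := sq_sub_sq_ne_zero hκ p
  have hi := (integrableOn_expProfile_mul_waveSin hκ p).mono_set (Set.Ioi_subset_Ioi hT)
  have h := integral_Ioi_of_hasDerivAt_of_tendsto
    (hasDerivAt_wavePrimitive κ p T).continuousAt.continuousWithinAt
    (fun t _ => hasDerivAt_wavePrimitive κ p t) (hi.const_mul _) (tendsto_wavePrimitive hκ p)
  rw [integral_const_mul] at h
  have h2 := profileSymbol_expProfile_eq T κ p
  refine mul_left_cancel₀ hne ?_
  rw [h, mul_sub, h2, mul_inv_cancel₀ hne]
  ring

/-- Between functions supported in a ball, the free resolvent agrees with its truncation to times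
exceeding the diameter. -/
theorem inner_freeResolvent_eq (hα : IsDiracMatrices α) {w : ℂ} (hw : 0 < w.im) {L T : ℝ}
    (hT : 0 ≤ T) (hLT : 2 * L < T) {v u : L2} (hv : SupportedIn L v) (hu : SupportedIn L u) :
    inner ℂ v (freeResolvent α w u)
      = inner ℂ v (propagator α T (momentum w) (spectralParam w) u) := by
  have hκ := momentum_im_pos hw
  set κ := momentum w
  set z := spectralParam w
  let n : Space → ℂ := fun ξ => ((freq ξ : ℂ) ^ 2 - κ ^ 2)⁻¹ - profileSymbol T (expProfile κ) (freq ξ)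
  have hnc : Continuous n := by
    refine Continuous.sub (Continuous.inv₀ ?_ fun ξ => sq_sub_sq_ne_zero hκ _)
      ((continuous_profileSymbol T (continuous_expProfile κ)).comp continuous_freq)
    have := continuous_freq
    fun_prop
  -- The difference of the full and truncated resolvents is the part of the wave integral after time
  -- `T`, whose kernel vanishes on the ball of radius `T`.
  let g : ℝ → ℂ := Set.indicator (Set.Ioi T) (expProfile κ)
  have hg : IntegrableOn (fun r : ℝ => (r : ℂ) * g r) (Set.Ioi 0) := by
    have h1 : (fun r : ℝ => (r : ℂ) * g r)
        = Set.indicator (Set.Ioi T) (fun r : ℝ => (r : ℂ) * expProfile κ r) := by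
      funext r
      simp only [g, Set.indicator_apply, mul_ite, mul_zero]
    rw [h1]
    exact (integrableOn_mul_expProfile hκ).indicator measurableSet_Ioi
  have hk0 : ∀ x : Space, ‖x‖ ≤ T → radialKernel g x = 0 := by
    intro x hx
    simp only [radialKernel, g, Set.indicator_apply, Set.mem_Ioi, not_lt.2 hx, if_false, zero_div]
  have hkn : ∀ ξ, ∫ x, radialKernel g x * realWave x ξ = n ξ := by
    intro ξ
    rw [integral_realWave_mul_radialKernel hg]
    have h1 : ∀ r : ℝ, g r * (waveSin (freq ξ) r : ℂ)
        = Set.indicator (Set.Ioi T) (fun r => expProfile κ r * (waveSin (freq ξ) r : ℂ)) r := by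
      intro r
      simp only [g, Set.indicator_apply, ite_mul, zero_mul]
    simp only [h1]
    rw [setIntegral_indicator measurableSet_Ioi, Set.inter_eq_right.2 (Set.Ioi_subset_Ioi hT),
      integral_Ioi_expProfile_mul_waveSin hκ hT]
  have hb1 : ∀ ξ, ‖profileSymbol T (expProfile κ) (freq ξ)‖ ≤ 1 * T ^ 2 := fun ξ =>
    norm_profileSymbol_le hT (fun t ht => norm_expProfile_le_one hκ.le ht.1) _
  have hb2 : ∀ ξ, freq ξ * ‖profileSymbol T (expProfile κ) (freq ξ)‖ ≤ 1 * T := fun ξ =>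
    mul_norm_profileSymbol_le hT (fun t ht => norm_expProfile_le_one hκ.le ht.1) (freq_nonneg ξ)
  have h1 : ∀ ξ, ‖n ξ‖ ≤ (1 / κ.im ^ 2 + 1 * T ^ 2) + (1 / κ.im + 1 * T) := fun ξ =>
    (norm_sub_le _ _).trans ((add_le_add (norm_inv_sq_sub_sq_le hκ _) (hb1 ξ)).trans
      (le_add_of_nonneg_right (by positivity)))
  have h2 : ∀ ξ, freq ξ * ‖n ξ‖ ≤ (1 / κ.im ^ 2 + 1 * T ^ 2) + (1 / κ.im + 1 * T) := by
    intro ξ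
    have ha := mul_le_mul_of_nonneg_left (norm_sub_le (((freq ξ : ℂ) ^ 2 - κ ^ 2)⁻¹)
      (profileSymbol T (expProfile κ) (freq ξ))) (freq_nonneg ξ)
    have hc := mul_norm_inv_sq_sub_sq_le hκ (freq_nonneg ξ)
    have hd := hb2 ξ
    have he : 0 ≤ 1 / κ.im ^ 2 + 1 * T ^ 2 := by positivity
    rw [mul_add] at ha
    change freq ξ * ‖_ - _‖ ≤ _
    linarith
  have hz := inner_fourierOp_eq_zero hα (integrable_radialKernel hg) hkn hnc.stronglyMeasurable h1 h2
    hLT hk0 hv hu z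
  have hns : IsSymbol (fun ξ => n ξ • shiftedSymbol α z ξ) :=
    ⟨(hnc.smul (continuous_shiftedSymbol z)).stronglyMeasurable, _,
      fun ξ => norm_smul_shiftedSymbol_le hα (h2 ξ) (h1 ξ)⟩
  have hsum : freeResolvent α w
      = fourierOp (fun ξ => n ξ • shiftedSymbol α z ξ) + propagator α T κ z := by
    rw [propagator, ← fourierOp_add hns (isSymbol_propagatorSymbol hα hT κ z)]
    unfold freeResolvent
    congr 1
    funext ξ
    refine Eq.trans ?_ (add_smul _ _ _)
    simp only [n, sub_add_cancel]
    rfl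
  rw [hsum]
  change inner ℂ v (fourierOp _ u + propagator α T κ z u) = _
  rw [inner_add_right, hz, zero_add]

end Huygens

end DiracResonance

end

noncomputable section

namespace DiracResonance

/-! ### Fourier transforms at complex frequencies -/

section WaveTransform

/-- The pairing of `u` with the plane wave of complex frequency `ζ`. -/
def waveTransform (ζ : Fin 3 → ℂ) (u : L2) : Spinor := ∫ x, planeWave ζ x • u x

theorem norm_planeWave_le (ζ : Fin 3 → ℂ) (x : Space) :
    ‖planeWave ζ x‖ ≤ Real.exp ((∑ i, ‖ζ i‖) * ‖x‖) := by
  unfold planeWave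
  refine (Complex.norm_exp_le_exp_norm _).trans (Real.exp_le_exp.2 ?_)
  rw [norm_mul, norm_neg, Complex.norm_I, one_mul, Finset.sum_mul]
  refine (norm_sum_le _ _).trans (Finset.sum_le_sum fun i _ => ?_)
  rw [norm_mul, Complex.norm_real]
  exact mul_le_mul_of_nonneg_left (PiLp.norm_apply_le x i) (norm_nonneg _)

theorem SupportedIn.integrable {L : ℝ} {u : L2} (hu : SupportedIn L u) : Integrable u := by
  have h : IntegrableOn u (Metric.closedBall 0 L) := by
    have : IsFiniteMeasure ((volume : Measure Space).restrict (Metric.closedBall 0 L)) :=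
      ⟨by rw [Measure.restrict_apply_univ]; exact measure_closedBall_lt_top⟩
    exact ((Lp.memLp u).mono_measure Measure.restrict_le_self).integrable one_le_two
  refine h.integrable_of_ae_notMem_eq_zero ?_
  filter_upwards [hu] with x hx hn
  exact hx (by simpa using hn)

theorem SupportedIn.integrable_planeWave_smul {L : ℝ} {u : L2} (hu : SupportedIn L u)
    (ζ : Fin 3 → ℂ) : Integrable fun x => planeWave ζ x • u x := by
  refine Integrable.mono' (hu.integrable.norm.const_mul (Real.exp ((∑ i, ‖ζ i‖) * L)))
    ((continuous_planeWave ζ).aestronglyMeasurable.smul (Lp.aestronglyMeasurable u)) ?_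
  filter_upwards [hu] with x hx
  rw [norm_smul]
  rcases lt_or_ge L ‖x‖ with h | h
  · rw [hx h]
    simp
  · refine mul_le_mul_of_nonneg_right ((norm_planeWave_le ζ x).trans (Real.exp_le_exp.2 ?_))
      (norm_nonneg _)
    exact mul_le_mul_of_nonneg_left h (Finset.sum_nonneg fun i _ => norm_nonneg _)

theorem waveTransform_mulOp_const {L : ℝ} {u : L2} (hu : SupportedIn L u) (ζ : Fin 3 → ℂ)
    (a : Spinor →L[ℂ] Spinor) :
    waveTransform ζ (mulOp (fun _ => a) u) = a (waveTransform ζ u) := by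
  unfold waveTransform
  rw [← a.integral_comp_comm (hu.integrable_planeWave_smul ζ)]
  refine integral_congr_ae ?_
  filter_upwards [coeFn_mulOp (IsSymbol.const a) u] with x hx
  rw [hx, map_smul]

theorem conj_planeWave (ζ : Fin 3 → ℂ) (x : Space) :
    (starRingEnd ℂ) (planeWave (fun i => (starRingEnd ℂ) (ζ i)) x) = planeWave (fun i => -ζ i) x := by
  unfold planeWave
  rw [← Complex.exp_conj]
  congr 1
  simp

theorem planeWave_mul_planeWave_sub (ζ : Fin 3 → ℂ) (x y : Space) :
    planeWave (fun i => -ζ i) x * planeWave ζ (x - y) = planeWave (fun i => -ζ i) y := by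
  unfold planeWave
  rw [← Complex.exp_add]
  congr 1
  simp only [PiLp.sub_apply]
  rw [← mul_add, ← Finset.sum_add_distrib]
  congr 1
  refine Finset.sum_congr rfl fun i _ => ?_
  push_cast
  ring

/-- `y ↦ ⟨v, τ_y u⟩` is a correlation, that is, a convolution with a reflected function, so its
transform factorises. Compact support permits complex frequencies; the conjugate on the side of `v`
comes from the antilinear slot. -/
theorem integral_planeWave_mul_inner_translate {L : ℝ} {v u : L2} (hv : SupportedIn L v)
    (hu : SupportedIn L u) (ζ : Fin 3 → ℂ) :
    Integrable (fun y => planeWave (fun i => -ζ i) y * inner ℂ v (translate y u)) ∧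
    ∫ y, planeWave (fun i => -ζ i) y * inner ℂ v (translate y u)
      = inner ℂ (waveTransform (fun i => (starRingEnd ℂ) (ζ i)) v) (waveTransform ζ u) := by
  set f : Space → Spinor := fun x => planeWave (fun i => (starRingEnd ℂ) (ζ i)) x • v x
  set g : Space → Spinor := fun x => planeWave ζ x • u x
  have hf : Integrable f := hv.integrable_planeWave_smul _
  have hg : Integrable g := hu.integrable_planeWave_smul _
  let B : Spinor →L[ℝ] Spinor →L[ℝ] ℂ :=
    (isBoundedBilinearMap_inner (𝕜 := ℂ) (E := Spinor)).toContinuousLinearMap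
  have hB : ∀ x y, B x y = inner ℂ x y := fun x y => rfl
  have key : ∀ y, planeWave (fun i => -ζ i) y * inner ℂ v (translate y u)
      = convolution f (fun x => g (-x)) B volume y := by
    intro y
    rw [L2.inner_def, ← integral_const_mul]
    refine integral_congr_ae ?_
    filter_upwards [coeFn_translate y u] with x hx
    rw [hx, hB, neg_sub]
    simp only [f, g]
    rw [inner_smul_left, inner_smul_right, conj_planeWave, ← mul_assoc,
      planeWave_mul_planeWave_sub]
  have hfun : (fun y => planeWave (fun i => -ζ i) y * inner ℂ v (translate y u))
      = convolution f (fun x => g (-x)) B volume := funext key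
  rw [hfun]
  refine ⟨hf.integrable_convolution B hg.comp_neg, ?_⟩
  rw [integral_convolution B hf hg.comp_neg, integral_neg_eq_self, hB]
  rfl

theorem integrable_inner_translate {L : ℝ} {v u : L2} (hv : SupportedIn L v)
    (hu : SupportedIn L u) : Integrable fun y => inner ℂ v (translate y u) := by
  have h := (integral_planeWave_mul_inner_translate hv hu 0).1
  have e : ∀ y, planeWave (fun i => -(0 : Fin 3 → ℂ) i) y = 1 := by
    intro y
    simp [planeWave]
  simpa only [e, one_mul] using h

/-- The complex frequency `κ θ` for a direction `θ`. -/
def dirFreq (κ : ℂ) (θ : UnitSphere) (i : Fin 3) : ℂ := κ * ((θ : Space) i : ℂ)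

theorem sum_norm_dirFreq_le (κ : ℂ) (θ : UnitSphere) : ∑ i, ‖dirFreq κ θ i‖ ≤ 3 * ‖κ‖ := by
  have hθ : ‖(θ : Space)‖ = 1 := by simpa using θ.2
  refine (Finset.sum_le_card_nsmul _ _ ‖κ‖ fun i _ => ?_).trans (by simp)
  unfold dirFreq
  rw [norm_mul, Complex.norm_real]
  refine mul_le_of_le_one_right (norm_nonneg _) ?_
  exact (PiLp.norm_apply_le (θ : Space) i).trans hθ.le

/-- The matrix elements of the plane waves of direction `θ`. -/
def spherePairing (κ : ℂ) (v u : L2) (θ : UnitSphere) : ℂ :=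
  inner ℂ (waveTransform (dirFreq ((starRingEnd ℂ) κ) θ) v) (waveTransform (dirFreq κ θ) u)

theorem integral_planeWave_dirFreq {L : ℝ} {v u : L2} (hv : SupportedIn L v)
    (hu : SupportedIn L u) (κ : ℂ) (θ : UnitSphere) :
    ∫ y, planeWave (fun i => -dirFreq κ θ i) y * inner ℂ v (translate y u) = spherePairing κ v u θ := by
  rw [(integral_planeWave_mul_inner_translate hv hu _).2]
  unfold spherePairing
  congr 2
  funext i
  simp [dirFreq]

theorem planeWave_neg_sub (ζ : Fin 3 → ℂ) (y h : Space) :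
    planeWave (fun i => -ζ i) (y - h) = planeWave ζ h * planeWave (fun i => -ζ i) y := by
  unfold planeWave
  rw [← Complex.exp_add]
  congr 1
  simp only [PiLp.sub_apply]
  rw [← mul_add, ← Finset.sum_add_distrib]
  congr 1
  refine Finset.sum_congr rfl fun i _ => ?_
  push_cast
  ring

/-- The integrand of the spherical superposition is jointly integrable. -/
theorem integrable_sphere_prod {L : ℝ} {v u : L2} (hv : SupportedIn L v)
    (hu : SupportedIn L u) (κ : ℂ) (h : Space) :
    Integrable (fun q : UnitSphere × Space =>
      planeWave (fun i => -dirFreq κ q.1 i) (q.2 - h) * inner ℂ v (translate q.2 u))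
      (sphereMeasure.prod volume) := by
  have hF := integrable_inner_translate hv hu
  have h1 : Integrable (fun q : UnitSphere × Space => (Real.exp (3 * ‖κ‖ * (2 * L + ‖h‖)) : ℝ)
      * ‖(inner ℂ v (translate q.2 u) : ℂ)‖) (sphereMeasure.prod volume) :=
    (integrable_const _).mul_prod hF.norm
  refine h1.mono' ?_ (ae_of_all _ fun q => ?_)
  · refine AEStronglyMeasurable.mul (Continuous.aestronglyMeasurable ?_)
      (hF.aestronglyMeasurable.comp_snd)
    unfold planeWave dirFreq
    fun_prop
  · rw [norm_mul]
    rcases lt_or_ge (2 * L) ‖q.2‖ with hq | hq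
    · rw [inner_translate_eq_zero hv hu hq]
      simp
    · refine mul_le_mul_of_nonneg_right ((norm_planeWave_le _ _).trans (Real.exp_le_exp.2 ?_))
        (norm_nonneg _)
      have h2 := sum_norm_dirFreq_le κ q.1
      have h3 := norm_sub_le q.2 h
      simp only [norm_neg]
      exact mul_le_mul h2 (by linarith) (norm_nonneg _) (by positivity)

theorem integrable_spherePairing {L : ℝ} {v u : L2} (hv : SupportedIn L v)
    (hu : SupportedIn L u) (κ : ℂ) : Integrable (spherePairing κ v u) sphereMeasure := by
  have h := (integrable_sphere_prod hv hu κ 0).integral_prod_left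
  simpa only [sub_zero, integral_planeWave_dirFreq hv hu] using h

theorem norm_spherePairing_le {κ : ℂ} {v u : L2} {a b : ℝ} (θ : UnitSphere)
    (ha : ‖waveTransform (dirFreq ((starRingEnd ℂ) κ) θ) v‖ ≤ a)
    (hb : ‖waveTransform (dirFreq κ θ) u‖ ≤ b) : ‖spherePairing κ v u θ‖ ≤ a * b :=
  (norm_inner_le_norm _ _).trans
    (mul_le_mul ha hb (norm_nonneg _) ((norm_nonneg _).trans ha))

end WaveTransform

/-! ### The jump between the sheets as a superposition over the sphere -/

section SphereRepresentation

variable {α : Fin 4 → Matrix (Fin 4) (Fin 4) ℂ}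

/-- If the kernel of a multiplier is a spherical superposition of plane waves on a large ball, so
are its matrix elements. -/
theorem integral_mul_fourierPairing_eq_sphere {k n : Space → ℂ} (hk : Integrable k)
    (hkn : ∀ ξ, ∫ z, k z * realWave z ξ = n ξ) {c κ : ℂ} {L T : ℝ}
    (hkS : ∀ z, z ≠ 0 → ‖z‖ ≤ T →
      k z = c * ∫ θ, planeWave (fun i => -dirFreq κ θ i) z ∂sphereMeasure)
    {v u : L2} (hv : SupportedIn L v) (hu : SupportedIn L u) {h : Space} (hh : ‖h‖ < T - 2 * L) :
    ∫ ξ, n ξ * realWave h ξ * fourierPairing v u ξ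
      = c * ∫ θ, planeWave (dirFreq κ θ) h * spherePairing κ v u θ ∂sphereMeasure := by
  rw [integral_mul_fourierPairing hk hkn]
  have e1 : ∫ z, k z * inner ℂ v (translate (z + h) u)
      = ∫ z, c * ∫ θ, planeWave (fun i => -dirFreq κ θ i) z
        * inner ℂ v (translate (z + h) u) ∂sphereMeasure := by
    refine integral_congr_ae ?_
    have h0 : ∀ᵐ z : Space, z ≠ 0 := by
      rw [ae_iff]
      simp
    filter_upwards [h0] with z hz
    rw [integral_mul_const]
    -- The superposition formula is known only for `|z| ≤ T`; beyond, the matrix element vanishes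
    -- because `|h| < T - 2L`.
    rcases le_or_gt ‖z‖ T with hs | hs
    · rw [hkS z hz hs, mul_assoc]
    · rw [inner_translate_eq_zero hv hu, mul_zero, mul_zero, mul_zero]
      have := norm_sub_norm_le z (-h)
      rw [sub_neg_eq_add, norm_neg] at this
      linarith
  have e2 : ∫ z, c * ∫ θ, planeWave (fun i => -dirFreq κ θ i) z
        * inner ℂ v (translate (z + h) u) ∂sphereMeasure
      = c * ∫ y, ∫ θ, planeWave (fun i => -dirFreq κ θ i) (y - h)
        * inner ℂ v (translate y u) ∂sphereMeasure := by
    rw [integral_const_mul]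
    congr 1
    refine Eq.trans ?_ (integral_add_right_eq_self (fun y => ∫ θ, planeWave
      (fun i => -dirFreq κ θ i) (y - h) * inner ℂ v (translate y u) ∂sphereMeasure) h)
    simp only [add_sub_cancel_right]
  rw [e1, e2]
  congr 1
  rw [← integral_integral_swap (integrable_sphere_prod hv hu κ h)]
  refine integral_congr_ae (ae_of_all _ fun θ => ?_)
  dsimp only
  rw [← integral_planeWave_dirFreq hv hu, ← integral_const_mul]
  refine integral_congr_ae (ae_of_all _ fun y => ?_)
  dsimp only
  rw [planeWave_neg_sub, mul_assoc]

theorem planeWave_single (ζ : Fin 3 → ℂ) (j : Fin 3) (t : ℝ) :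
    planeWave ζ (EuclideanSpace.single j t) = Complex.exp (-(Complex.I * ζ j) * t) := by
  unfold planeWave
  congr 1
  rw [Finset.sum_eq_single j]
  · simp
    ring
  · intro i _ hi
    simp [hi]
  · simp

theorem norm_dirFreq_le (κ : ℂ) (θ : UnitSphere) (i : Fin 3) : ‖dirFreq κ θ i‖ ≤ ‖κ‖ := by
  have hθ : ‖(θ : Space)‖ = 1 := by simpa using θ.2
  unfold dirFreq
  rw [norm_mul, Complex.norm_real]
  exact mul_le_of_le_one_right (norm_nonneg _) ((PiLp.norm_apply_le (θ : Space) i).trans hθ.le)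

theorem hasDerivAt_integral_sphere {κ : ℂ} {G : UnitSphere → ℂ} (hG : Integrable G sphereMeasure)
    (j : Fin 3) : HasDerivAt (fun t : ℝ =>
        ∫ θ, planeWave (dirFreq κ θ) (EuclideanSpace.single j t) * G θ ∂sphereMeasure)
      (-Complex.I * ∫ θ, dirFreq κ θ j * G θ ∂sphereMeasure) 0 := by
  simp only [planeWave_single]
  have hc : Continuous fun θ : UnitSphere => dirFreq κ θ j := by
    unfold dirFreq
    fun_prop
  have hb : ∀ (θ : UnitSphere) (t : ℝ), |t| ≤ 1 →
      ‖Complex.exp (-(Complex.I * dirFreq κ θ j) * t)‖ ≤ Real.exp ‖κ‖ := by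
    intro θ t ht
    refine (Complex.norm_exp_le_exp_norm _).trans (Real.exp_le_exp.2 ?_)
    rw [norm_mul, norm_neg, norm_mul, Complex.norm_I, one_mul, Complex.norm_real]
    exact (mul_le_of_le_one_right (norm_nonneg _) ht).trans (norm_dirFreq_le κ θ j)
  have h := hasDerivAt_integral_of_dominated_loc_of_deriv_le (μ := sphereMeasure)
    (F := fun (t : ℝ) θ => Complex.exp (-(Complex.I * dirFreq κ θ j) * t) * G θ)
    (F' := fun t θ => Complex.exp (-(Complex.I * dirFreq κ θ j) * t)
      * (-(Complex.I * dirFreq κ θ j)) * G θ)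
    (bound := fun θ => Real.exp ‖κ‖ * ‖κ‖ * ‖G θ‖) (x₀ := (0 : ℝ)) (s := Metric.ball 0 1)
    (Metric.ball_mem_nhds _ one_pos) ?_ ?_ ?_ ?_ ?_ ?_
  · refine h.2.congr_deriv ?_
    rw [← integral_const_mul]
    refine integral_congr_ae (ae_of_all _ fun θ => ?_)
    dsimp only
    simp
    ring
  · exact Eventually.of_forall fun t =>
      (Continuous.aestronglyMeasurable (by fun_prop)).mul hG.aestronglyMeasurable
  · refine hG.bdd_mul (c := Real.exp ‖κ‖) (Continuous.aestronglyMeasurable (by fun_prop))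
      (ae_of_all _ fun θ => hb θ 0 (by simp))
  · exact (Continuous.aestronglyMeasurable (by fun_prop)).mul hG.aestronglyMeasurable
  · refine ae_of_all _ fun θ t ht => ?_
    have ht' : |t| ≤ 1 := by
      have : |t| < 1 := by simpa using ht
      exact this.le
    rw [norm_mul, norm_mul]
    refine mul_le_mul_of_nonneg_right ?_ (norm_nonneg _)
    refine mul_le_mul (hb θ t ht') ?_ (norm_nonneg _) (Real.exp_pos _).le
    rw [norm_neg, norm_mul, Complex.norm_I, one_mul]
    exact norm_dirFreq_le κ θ j
  · exact hG.norm.const_mul _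
  · refine ae_of_all _ fun θ t _ => ?_
    have h3 : HasDerivAt (fun s : ℝ => -(Complex.I * dirFreq κ θ j) * (s : ℂ))
        (-(Complex.I * dirFreq κ θ j)) t := by
      simpa using (Complex.ofRealCLM.hasDerivAt (x := t)).const_mul (-(Complex.I * dirFreq κ θ j))
    exact h3.cexp.mul_const (G θ)

/-- A bound for the spherical superposition, uniform in the frequency. -/
def sphereConst (α : Fin 4 → Matrix (Fin 4) (Fin 4) ℂ) : ℝ :=
  sphereMeasure.real Set.univ * (1 + ∑ j, ‖spinorOp (α j)‖)

theorem sphereConst_nonneg (α : Fin 4 → Matrix (Fin 4) (Fin 4) ℂ) : 0 ≤ sphereConst α := by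
  unfold sphereConst
  positivity

/-- Differentiating the spherical superposition at zero translation produces the factors `κθⱼ`,
whence `3‖κ‖ + 1 + ‖z‖`. The bound is a product of transforms on the sphere, so smallness of either
`v` or `u` there is enough. -/
theorem norm_inner_fourierOp_sphere_le (hα : IsDiracMatrices α) {k : Space → ℂ} (hk : Integrable k)
    {n : Space → ℂ} (hkn : ∀ ξ, ∫ z, k z * realWave z ξ = n ξ) (hn : StronglyMeasurable n) {C : ℝ}
    (h1 : ∀ ξ, ‖n ξ‖ ≤ C) (h2 : ∀ ξ, freq ξ * ‖n ξ‖ ≤ C) {c κ : ℂ} {L T : ℝ} (hLT : 2 * L < T)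
    (hkS : ∀ z, z ≠ 0 → ‖z‖ ≤ T →
      k z = c * ∫ θ, planeWave (fun i => -dirFreq κ θ i) z ∂sphereMeasure)
    {v u : L2} (hv : SupportedIn L v) (hu : SupportedIn L u) (z : ℂ) {a b : ℝ}
    (ha : ∀ θ, ‖waveTransform (dirFreq ((starRingEnd ℂ) κ) θ) v‖ ≤ a)
    (hb : ∀ θ, ‖waveTransform (dirFreq κ θ) u‖ ≤ b) :
    ‖inner ℂ v (fourierOp (fun ξ => n ξ • shiftedSymbol α z ξ) u)‖
      ≤ ‖c‖ * (3 * ‖κ‖ + 1 + ‖z‖) * sphereConst α * (a * b) := by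
  have hd : ∀ (j : Fin 3) (x y : L2), SupportedIn L x → SupportedIn L y →
      ∫ ξ, n ξ * (2 * Real.pi * (ξ j : ℂ)) * fourierPairing x y ξ
        = c * ∫ θ, dirFreq κ θ j * spherePairing κ x y θ ∂sphereMeasure := by
    intro j x y hx hy
    have h3 := hasDerivAt_integral_realWave hn.aestronglyMeasurable h1 h2
      (integrable_fourierPairing x y) j
    have h3' := (hasDerivAt_integral_sphere (κ := κ) (integrable_spherePairing hx hy κ) j).const_mul c
    have h4 : (fun t : ℝ => ∫ ξ, n ξ * realWave (EuclideanSpace.single j t) ξ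
        * fourierPairing x y ξ) =ᶠ[𝓝 0] fun t => c * ∫ θ, planeWave (dirFreq κ θ)
          (EuclideanSpace.single j t) * spherePairing κ x y θ ∂sphereMeasure := by
      filter_upwards [Metric.ball_mem_nhds (0 : ℝ) (sub_pos.2 hLT)] with t ht
      refine integral_mul_fourierPairing_eq_sphere hk hkn hkS hx hy ?_
      rw [EuclideanSpace.norm_single]
      simpa using ht
    have h5 := h3.unique (h3'.congr_of_eventuallyEq h4)
    refine mul_left_cancel₀ (neg_ne_zero.2 Complex.I_ne_zero) ?_
    rw [h5]
    ring
  have h0 : ∀ x y : L2, SupportedIn L x → SupportedIn L y →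
      ∫ ξ, n ξ * fourierPairing x y ξ = c * ∫ θ, spherePairing κ x y θ ∂sphereMeasure := by
    intro x y hx hy
    have := integral_mul_fourierPairing_eq_sphere hk hkn hkS hx hy (h := 0) (by simpa using hLT)
    have e : ∀ ξ, realWave 0 ξ = 1 := by
      intro ξ
      simp [realWave, planeWave]
    have e' : ∀ θ, planeWave (dirFreq κ θ) 0 = 1 := by
      intro ξ
      simp [planeWave]
    simpa only [e, e', mul_one, one_mul] using this
  set S := sphereMeasure.real Set.univ
  have hS : 0 ≤ S := measureReal_nonneg
  have hbα : ∀ (M : Spinor →L[ℂ] Spinor) (θ : UnitSphere),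
      ‖waveTransform (dirFreq κ θ) (mulOp (fun _ => M) u)‖ ≤ ‖M‖ * b := by
    intro M θ
    rw [waveTransform_mulOp_const hu]
    exact (M.le_opNorm _).trans (mul_le_mul_of_nonneg_left (hb θ) (norm_nonneg _))
  have hA : ∀ (j : Fin 3) (M : Spinor →L[ℂ] Spinor),
      ‖∫ θ, dirFreq κ θ j * spherePairing κ v (mulOp (fun _ => M) u) θ ∂sphereMeasure‖
        ≤ ‖κ‖ * (a * (‖M‖ * b)) * S := by
    intro j M
    refine norm_integral_le_of_norm_le_const (ae_of_all _ fun θ => ?_)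
    rw [norm_mul]
    exact mul_le_mul (norm_dirFreq_le κ θ j) (norm_spherePairing_le θ (ha θ) (hbα M θ))
      (norm_nonneg _) (norm_nonneg _)
  have hA0 : ∀ (y : L2) (b' : ℝ), (∀ θ, ‖waveTransform (dirFreq κ θ) y‖ ≤ b') →
      ‖∫ θ, spherePairing κ v y θ ∂sphereMeasure‖ ≤ a * b' * S := fun y b' hb' =>
    norm_integral_le_of_norm_le_const (ae_of_all _ fun θ => norm_spherePairing_le θ (ha θ) (hb' θ))
  rw [inner_fourierOp_smul_shiftedSymbol hα hn h1 h2]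
  simp only [hd _ _ _ hv (hu.mulOp_const _), h0 _ _ hv (hu.mulOp_const _), h0 _ _ hv hu]
  obtain ⟨θ₀⟩ : Nonempty UnitSphere := ⟨⟨EuclideanSpace.single 0 1, by simp⟩⟩
  have ha0 : 0 ≤ a := (norm_nonneg _).trans (ha θ₀)
  have hb0 : 0 ≤ b := (norm_nonneg _).trans (hb θ₀)
  set Q := ∑ j, ‖spinorOp (α j)‖ with hQ
  have hQj : ∀ j, ‖spinorOp (α j)‖ ≤ Q := fun j =>
    Finset.single_le_sum (f := fun j => ‖spinorOp (α j)‖) (fun i _ => norm_nonneg _)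
      (Finset.mem_univ j)
  have hQ0 : 0 ≤ Q := (norm_nonneg _).trans (hQj 0)
  have b1 : ∀ j : Fin 3, ‖c * ∫ θ, dirFreq κ θ j * spherePairing κ v
      (mulOp (fun _ => spinorOp (α j.castSucc)) u) θ ∂sphereMeasure‖
      ≤ ‖c‖ * (‖κ‖ * (a * (Q * b)) * S) := by
    intro j
    rw [norm_mul]
    refine mul_le_mul_of_nonneg_left ((hA j _).trans ?_) (norm_nonneg _)
    have := hQj j.castSucc
    gcongr
  have b2 : ‖c * ∫ θ, spherePairing κ v (mulOp (fun _ => spinorOp (α 3)) u) θ ∂sphereMeasure‖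
      ≤ ‖c‖ * (a * (Q * b) * S) := by
    rw [norm_mul]
    refine mul_le_mul_of_nonneg_left ((hA0 _ _ (hbα _)).trans ?_) (norm_nonneg _)
    have := hQj 3
    gcongr
  have b3 : ‖z * (c * ∫ θ, spherePairing κ v u θ ∂sphereMeasure)‖ ≤ ‖z‖ * (‖c‖ * (a * b * S)) := by
    rw [norm_mul, norm_mul]
    exact mul_le_mul_of_nonneg_left (mul_le_mul_of_nonneg_left (hA0 _ _ hb) (norm_nonneg _))
      (norm_nonneg _)
  have b4 : ‖∑ j : Fin 3, c * ∫ θ, dirFreq κ θ j * spherePairing κ v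
      (mulOp (fun _ => spinorOp (α j.castSucc)) u) θ ∂sphereMeasure‖
      ≤ 3 * (‖c‖ * (‖κ‖ * (a * (Q * b)) * S)) := by
    refine (norm_sum_le _ _).trans ((Finset.sum_le_sum fun j _ => b1 j).trans ?_)
    simp
  refine (norm_add₃_le).trans ((add_le_add (add_le_add b4 b2) b3).trans ?_)
  unfold sphereConst
  have p1 : 0 ≤ ‖c‖ * S * (a * b) * (3 * ‖κ‖ + 1) := by positivity
  have p2 : 0 ≤ ‖c‖ * S * (a * b) * ‖z‖ * Q := by positivity
  change _ ≤ ‖c‖ * (3 * ‖κ‖ + 1 + ‖z‖) * (S * (1 + Q)) * (a * b)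
  linarith [show ‖c‖ * (3 * ‖κ‖ + 1 + ‖z‖) * (S * (1 + Q)) * (a * b)
    - (3 * (‖c‖ * (‖κ‖ * (a * (Q * b)) * S)) + ‖c‖ * (a * (Q * b) * S) + ‖z‖ * (‖c‖ * (a * b * S)))
    = ‖c‖ * S * (a * b) * (3 * ‖κ‖ + 1) + ‖c‖ * S * (a * b) * ‖z‖ * Q by ring]

theorem planeWave_neg_dirFreq (κ : ℂ) (θ : UnitSphere) (z : Space) :
    planeWave (fun i => -dirFreq κ θ i) z
      = Complex.exp (Complex.I * κ * (inner ℝ (θ : Space) z : ℝ)) := by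
  unfold planeWave dirFreq
  congr 1
  simp only [PiLp.inner_apply, RCLike.inner_apply, conj_trivial]
  push_cast
  rw [Finset.mul_sum, Finset.mul_sum]
  refine Finset.sum_congr rfl fun i _ => ?_
  ring

theorem expProfile_sub_expProfile_neg (κ : ℂ) (t : ℝ) :
    expProfile κ t - expProfile (-κ) t = 2 * Complex.I * Complex.sin (κ * t) := by
  unfold expProfile
  rw [Complex.sin, show κ * (Complex.I * t) = κ * t * Complex.I by ring,
    show -κ * (Complex.I * t) = -(κ * t) * Complex.I by ring]
  linear_combination (Complex.exp (κ * t * Complex.I) - Complex.exp (-(κ * t) * Complex.I))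
    * Complex.I_sq

/-- The two branches of the truncated resolvent differ by a superposition of plane waves. -/
theorem norm_inner_propagator_sub_le (hα : IsDiracMatrices α) {L T : ℝ} (hT : 0 ≤ T)
    (hLT : 2 * L < T) {v u : L2} (hv : SupportedIn L v) (hu : SupportedIn L u) (κ z : ℂ) {a b : ℝ}
    (ha : ∀ θ, ‖waveTransform (dirFreq ((starRingEnd ℂ) κ) θ) v‖ ≤ a)
    (hb : ∀ θ, ‖waveTransform (dirFreq κ θ) u‖ ≤ b) :
    ‖inner ℂ v (propagator α T κ z u) - inner ℂ v (propagator α T (-κ) z u)‖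
      ≤ ‖κ‖ * (3 * ‖κ‖ + 1 + ‖z‖) * sphereConst α * (a * b) := by
  let n : Space → ℂ := fun ξ => profileSymbol T (fun t => expProfile κ t - expProfile (-κ) t) (freq ξ)
  have hc : Continuous fun t => expProfile κ t - expProfile (-κ) t :=
    (continuous_expProfile κ).sub (continuous_expProfile (-κ))
  have hnc : Continuous n := (continuous_profileSymbol T hc).comp continuous_freq
  let g : ℝ → ℂ := Set.indicator (Set.Iic T) fun t => expProfile κ t - expProfile (-κ) t
  have hg : IntegrableOn (fun r : ℝ => (r : ℂ) * g r) (Set.Ioi 0) := by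
    have h1 : (fun r : ℝ => (r : ℂ) * g r) = Set.indicator (Set.Iic T)
        (fun r : ℝ => (r : ℂ) * (expProfile κ r - expProfile (-κ) r)) := by
      funext r
      simp only [g, Set.indicator_apply, mul_ite, mul_zero]
    rw [h1, IntegrableOn, integrable_indicator_iff measurableSet_Iic, IntegrableOn,
      Measure.restrict_restrict measurableSet_Iic, Set.inter_comm, Set.Ioi_inter_Iic]
    exact ((Complex.continuous_ofReal.mul hc).integrableOn_Icc).mono_set Set.Ioc_subset_Icc_self
  have hkn : ∀ ξ, ∫ x, radialKernel g x * realWave x ξ = n ξ := by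
    intro ξ
    rw [integral_realWave_mul_radialKernel hg]
    have h1 : ∀ r : ℝ, g r * (waveSin (freq ξ) r : ℂ) = Set.indicator (Set.Iic T)
        (fun r => (expProfile κ r - expProfile (-κ) r) * (waveSin (freq ξ) r : ℂ)) r := by
      intro r
      simp only [g, Set.indicator_apply, ite_mul, zero_mul]
    simp only [h1]
    rw [setIntegral_indicator measurableSet_Iic, Set.Ioi_inter_Iic,
      ← intervalIntegral.integral_of_le hT]
    rfl
  -- The jump of the profile is `2i sin(κr)`, and the plane waves integrate over the sphere to `4π
  -- sin(κr)/(κr)`; comparison with `2i sin(κr)/(4πr)` gives the constant `2iκ/(4π)²`.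
  have hkS : ∀ x : Space, x ≠ 0 → ‖x‖ ≤ T → radialKernel g x
      = (2 * Complex.I * κ / (4 * Real.pi) ^ 2)
        * ∫ θ, planeWave (fun i => -dirFreq κ θ i) x ∂sphereMeasure := by
    intro x hx hxT
    have h1 := mul_integral_sphere_exp κ x
    simp only [planeWave_neg_dirFreq]
    have h2 : g ‖x‖ = 2 * Complex.I * Complex.sin (κ * ‖x‖) := by
      simp only [g, Set.indicator_apply, Set.mem_Iic, hxT, if_true]
      exact expProfile_sub_expProfile_neg κ _
    have h3 : (‖x‖ : ℂ) ≠ 0 := by exact_mod_cast norm_ne_zero_iff.2 hx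
    have h4 : (Real.pi : ℂ) ≠ 0 := by exact_mod_cast Real.pi_ne_zero
    rw [radialKernel, h2]
    rw [div_mul_eq_mul_div, div_eq_div_iff
      (mul_ne_zero (mul_ne_zero (by norm_num) h4) h3)
      (pow_ne_zero 2 (mul_ne_zero (by norm_num) h4))]
    linear_combination (-(2 * Complex.I * (4 * Real.pi))) * h1
  have hG : ∀ t ∈ Set.Icc 0 T, ‖expProfile κ t - expProfile (-κ) t‖ ≤ 2 * Real.exp (‖κ‖ * T) := by
    intro t ht
    have h1 := norm_expProfile_le κ ht
    have h2 := norm_expProfile_le (-κ) ht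
    rw [norm_neg] at h2
    linarith [norm_sub_le (expProfile κ t) (expProfile (-κ) t)]
  set G := 2 * Real.exp (‖κ‖ * T)
  have hG0 : 0 ≤ G := by positivity
  have h1 : ∀ ξ, ‖n ξ‖ ≤ G * T ^ 2 + G * T := fun ξ =>
    (norm_profileSymbol_le hT hG _).trans (le_add_of_nonneg_right (by positivity))
  have h2 : ∀ ξ, freq ξ * ‖n ξ‖ ≤ G * T ^ 2 + G * T := fun ξ =>
    (mul_norm_profileSymbol_le hT hG (freq_nonneg ξ)).trans (le_add_of_nonneg_left (by positivity))
  have hmain := norm_inner_fourierOp_sphere_le hα (integrable_radialKernel hg) hkn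
    hnc.stronglyMeasurable h1 h2 hLT hkS hv hu z ha hb
  have hns : IsSymbol (fun ξ => n ξ • shiftedSymbol α z ξ) :=
    ⟨(hnc.smul (continuous_shiftedSymbol z)).stronglyMeasurable, _,
      fun ξ => norm_smul_shiftedSymbol_le hα (h2 ξ) (h1 ξ)⟩
  have hsum : propagator α T κ z
      = fourierOp (fun ξ => n ξ • shiftedSymbol α z ξ) + propagator α T (-κ) z := by
    rw [propagator, propagator, ← fourierOp_add hns (isSymbol_propagatorSymbol hα hT (-κ) z)]
    congr 1
    funext ξ
    refine Eq.trans ?_ (add_smul _ _ _)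
    simp only [n]
    rw [profileSymbol_sub T (continuous_expProfile κ) (continuous_expProfile (-κ)), sub_add_cancel]
    rfl
  have e : inner ℂ v (propagator α T κ z u) - inner ℂ v (propagator α T (-κ) z u)
      = inner ℂ v (fourierOp (fun ξ => n ξ • shiftedSymbol α z ξ) u) := by
    rw [hsum]
    change inner ℂ v (fourierOp _ u + propagator α T (-κ) z u) - _ = _
    rw [inner_add_right, add_sub_cancel_right]
  rw [e]
  refine hmain.trans ?_
  obtain ⟨θ₀⟩ : Nonempty UnitSphere := ⟨⟨EuclideanSpace.single 0 1, by simp⟩⟩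
  have ha0 : 0 ≤ a := (norm_nonneg _).trans (ha θ₀)
  have hb0 : 0 ≤ b := (norm_nonneg _).trans (hb θ₀)
  have hc1 : ‖2 * Complex.I * κ / (4 * (Real.pi : ℂ)) ^ 2‖ ≤ ‖κ‖ := by
    have h5 : ‖(4 * (Real.pi : ℂ)) ^ 2‖ = (4 * Real.pi) ^ 2 := by
      simp [abs_of_pos Real.pi_pos]
    rw [norm_div, h5, norm_mul, norm_mul, Complex.norm_I, mul_one]
    refine div_le_of_le_mul₀ (by positivity) (norm_nonneg _) ?_
    have : ‖(2 : ℂ)‖ = 2 := by simp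
    rw [this]
    have h6 : 2 ≤ (4 * Real.pi) ^ 2 := by nlinarith [Real.pi_gt_three]
    rw [mul_comm]
    exact mul_le_mul_of_nonneg_left h6 (norm_nonneg κ)
  have := sphereConst_nonneg α
  gcongr

end SphereRepresentation

end DiracResonance

end

noncomputable section

namespace DiracResonance

/-! ### Sharp cut-offs to balls -/

section BallCutoff

/-- Multiplication by the indicator function of the ball of radius `L`. -/
def ballCut (L : ℝ) : L2 →L[ℂ] L2 :=
  mulOp fun x => Set.indicator (Metric.closedBall (0 : Space) L) (fun _ => (1 : ℂ)) x • 1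

theorem isSymbol_ballCut (L : ℝ) : IsSymbol fun x : Space =>
    Set.indicator (Metric.closedBall (0 : Space) L) (fun _ => (1 : ℂ)) x
      • (1 : Spinor →L[ℂ] Spinor) := by
  classical
  refine isSymbol_scalar (C := 1)
    (stronglyMeasurable_const.indicator measurableSet_closedBall) fun x => ?_
  rw [Set.indicator_apply]
  split_ifs <;> simp

theorem coeFn_ballCut (L : ℝ) (u : L2) :
    ballCut L u =ᵐ[volume] Set.indicator (Metric.closedBall (0 : Space) L) u := by
  classical
  filter_upwards [coeFn_mulOp (isSymbol_ballCut L) u] with x hx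
  rw [ballCut, hx, Set.indicator_apply, Set.indicator_apply]
  split_ifs
  · change (1 : ℂ) • u x = u x
    rw [one_smul]
  · change (0 : ℂ) • u x = 0
    rw [zero_smul]

theorem supportedIn_ballCut (L : ℝ) (u : L2) : SupportedIn L (ballCut L u) := by
  filter_upwards [coeFn_ballCut L u] with x hx h
  rw [hx, Set.indicator_of_notMem]
  simpa using h

theorem SupportedIn.ballCut_eq {L : ℝ} {u : L2} (hu : SupportedIn L u) : ballCut L u = u := by
  classical
  apply Lp.ext
  filter_upwards [coeFn_ballCut L u, hu] with x hx h
  rw [hx, Set.indicator_apply]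
  split_ifs with hm
  · rfl
  · exact (h (by simpa using hm)).symm

theorem norm_ballCut_le (L : ℝ) (u : L2) : ‖ballCut L u‖ ≤ ‖u‖ := by
  classical
  refine (norm_mulOp_apply_le (isSymbol_ballCut L).1 (C := 1) (fun x => ?_) u).trans
    (one_mul _).le
  rw [Set.indicator_apply]
  split_ifs <;> simp

theorem inner_ballCut_left (L : ℝ) (v u : L2) :
    inner ℂ (ballCut L v) u = inner ℂ v (ballCut L u) := by
  classical
  rw [L2.inner_def, L2.inner_def]
  refine integral_congr_ae ?_
  filter_upwards [coeFn_ballCut L u, coeFn_ballCut L v] with x h1 h2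
  rw [h1, h2, Set.indicator_apply, Set.indicator_apply]
  split_ifs <;> simp

theorem supportedIn_mulOp {a : Space → Spinor →L[ℂ] Spinor} (ha : IsSymbol a) {L : ℝ}
    (hL : ∀ x, L < ‖x‖ → a x = 0) (u : L2) : SupportedIn L (mulOp a u) := by
  filter_upwards [coeFn_mulOp ha u] with x hx h
  rw [hx, hL x h]
  rfl

theorem ballCut_mul_mulOp {a : Space → Spinor →L[ℂ] Spinor} (ha : IsSymbol a) {L : ℝ}
    (hL : ∀ x, L < ‖x‖ → a x = 0) : ballCut L * mulOp a = mulOp a := by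
  ext1 u
  exact (supportedIn_mulOp ha hL u).ballCut_eq

theorem mulOp_mul_ballCut {a : Space → Spinor →L[ℂ] Spinor} (ha : IsSymbol a) {L : ℝ}
    (hL : ∀ x, L < ‖x‖ → a x = 0) : mulOp a * ballCut L = mulOp a := by
  classical
  ext1 u
  apply Lp.ext
  change (mulOp a (ballCut L u) : L2) =ᵐ[volume] _
  filter_upwards [coeFn_mulOp ha u, coeFn_mulOp ha (ballCut L u), coeFn_ballCut L u] with x h1 h2 h3
  rw [h1, h2, h3, Set.indicator_apply]
  split_ifs with hm
  · rfl
  · rw [hL x (by simpa using hm)]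
    rfl

variable {α : Fin 4 → Matrix (Fin 4) (Fin 4) ℂ}

theorem ballCut_freeResolvent_ballCut (hα : IsDiracMatrices α) {w : ℂ} (hw : 0 < w.im) {L T : ℝ}
    (hT : 0 ≤ T) (hLT : 2 * L < T) :
    ballCut L * freeResolvent α w * ballCut L
      = ballCut L * propagator α T (momentum w) (spectralParam w) * ballCut L := by
  ext1 u
  refine ext_inner_left ℂ fun v => ?_
  change inner ℂ v (ballCut L (freeResolvent α w (ballCut L u)))
    = inner ℂ v (ballCut L (propagator α T (momentum w) (spectralParam w) (ballCut L u)))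
  rw [← inner_ballCut_left, ← inner_ballCut_left]
  exact inner_freeResolvent_eq hα hw hT hLT (supportedIn_ballCut L v) (supportedIn_ballCut L u)

end BallCutoff

/-! ### Birman–Schwinger algebra -/

section RingIdentities

variable {A : Type*} [Ring A] {ρ R₀ R V χ : A}

/-- The model is `ρ` a cut-off equal to one on the support of `V`. Then `ρ` disappears after each
`V`, and the claim is the resolvent identity. -/
theorem resolvent_inverse_right (h1 : R = R₀ - R₀ * V * R) (h3 : V * ρ = V) :
    (1 + ρ * R₀ * V) * (1 - ρ * R * V) = 1 := by
  have h : R₀ * V * R = R₀ - R := by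
    rw [eq_sub_iff_add_eq, add_comm, ← eq_sub_iff_add_eq]
    exact h1
  have e : ρ * R₀ * V * (ρ * R * V) = ρ * (R₀ - R) * V := by
    rw [← h]
    calc ρ * R₀ * V * (ρ * R * V) = ρ * R₀ * (V * ρ) * R * V := by noncomm_ring
      _ = ρ * (R₀ * V * R) * V := by rw [h3]; noncomm_ring
  calc (1 + ρ * R₀ * V) * (1 - ρ * R * V)
      = 1 + ρ * R₀ * V - ρ * R * V - ρ * R₀ * V * (ρ * R * V) := by noncomm_ring
    _ = 1 := by rw [e]; noncomm_ring

theorem resolvent_inverse_left (h2 : R₀ = R + R * V * R₀) (h3 : V * ρ = V) :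
    (1 - ρ * R * V) * (1 + ρ * R₀ * V) = 1 := by
  have h : R * V * R₀ = R₀ - R := by
    rw [eq_sub_iff_add_eq, add_comm]
    exact h2.symm
  have e : ρ * R * V * (ρ * R₀ * V) = ρ * (R₀ - R) * V := by
    rw [← h]
    calc ρ * R * V * (ρ * R₀ * V) = ρ * R * (V * ρ) * R₀ * V := by noncomm_ring
      _ = ρ * (R * V * R₀) * V := by rw [h3]; noncomm_ring
  calc (1 - ρ * R * V) * (1 + ρ * R₀ * V)
      = 1 + ρ * R₀ * V - ρ * R * V - ρ * R * V * (ρ * R₀ * V) := by noncomm_ring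
    _ = 1 := by rw [e]; noncomm_ring

theorem resolvent_cutoff_eq (h1 : R = R₀ - R₀ * V * R) (h2 : R₀ = R + R * V * R₀)
    (h3 : V * ρ = V) :
    χ * R₀ * χ - χ * R₀ * V * (1 - ρ * R * V) * (ρ * R₀ * χ) = χ * R * χ := by
  have h : R * V * R₀ = R₀ - R := by
    rw [eq_sub_iff_add_eq, add_comm]
    exact h2.symm
  have e : V * (1 - ρ * R * V) * (ρ * R₀) = V * R := by
    calc V * (1 - ρ * R * V) * (ρ * R₀)
        = (V * ρ) * R₀ - (V * ρ) * R * (V * ρ) * R₀ := by noncomm_ring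
      _ = V * R₀ - V * (R * V * R₀) := by rw [h3]; noncomm_ring
      _ = V * R := by rw [h]; noncomm_ring
  calc χ * R₀ * χ - χ * R₀ * V * (1 - ρ * R * V) * (ρ * R₀ * χ)
      = χ * R₀ * χ - χ * R₀ * (V * (1 - ρ * R * V) * (ρ * R₀)) * χ := by noncomm_ring
    _ = χ * (R₀ - R₀ * V * R) * χ := by rw [e]; noncomm_ring
    _ = χ * R * χ := by rw [← h1]

/-- Every `R₀` in the resolvent formula sits between factors absorbed by `ρ` or by the larger
cut-off `ρ'`, and so may be replaced by `P` or `P'`. The inverse involves only `ρ` and `P`; `ρ'` and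
`P'`, which must cover `χ`, stay outside it. -/
theorem resolvent_continuation_eq {ρ' P P' : A} (h1 : R = R₀ - R₀ * V * R)
    (h2 : R₀ = R + R * V * R₀) (a1 : V * ρ = V) (a2 : ρ * V = V) (a4 : ρ' * V = V)
    (a5 : ρ * ρ' = ρ) (b1 : χ * ρ' = χ) (b2 : ρ' * χ = χ) (hH : ρ * R₀ * ρ = ρ * P * ρ)
    (hH' : ρ' * R₀ * ρ' = ρ' * P' * ρ') :
    χ * P' * χ - (χ * P' * V) * (Ring.inverse (1 + ρ * P * V) * (ρ * P' * χ)) = χ * R * χ := by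
  have hab : ∀ {x y : A}, x * ρ' = x → ρ' * y = y → x * P' * y = x * R₀ * y := by
    intro x y hx hy
    calc x * P' * y = (x * ρ') * P' * (ρ' * y) := by rw [hx, hy]
      _ = x * (ρ' * P' * ρ') * y := by noncomm_ring
      _ = x * (ρ' * R₀ * ρ') * y := by rw [hH']
      _ = (x * ρ') * R₀ * (ρ' * y) := by noncomm_ring
      _ = x * R₀ * y := by rw [hx, hy]
  have hK : ρ * P * V = ρ * R₀ * V := by
    calc ρ * P * V = ρ * P * (ρ * V) := by rw [a2]
      _ = (ρ * P * ρ) * V := by noncomm_ring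
      _ = (ρ * R₀ * ρ) * V := by rw [hH]
      _ = ρ * R₀ * (ρ * V) := by noncomm_ring
      _ = ρ * R₀ * V := by rw [a2]
  have hinv : Ring.inverse (1 + ρ * P * V) = 1 - ρ * R * V := by
    rw [hK]
    exact Ring.inverse_unit ⟨_, _, resolvent_inverse_right h1 a1, resolvent_inverse_left h2 a1⟩
  rw [hinv, hab b1 b2, hab b1 a4, hab a5 b2, ← mul_assoc]
  exact resolvent_cutoff_eq h1 h2 a1

end RingIdentities

/-! ### The meromorphic continuation -/

section Continuation

variable {α : Fin 4 → Matrix (Fin 4) (Fin 4) ℂ} {V : Space → Matrix (Fin 4) (Fin 4) ℂ}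

/-- The potential vanishes outside the ball of radius `L`. -/
def PotentialIn (V : Space → Matrix (Fin 4) (Fin 4) ℂ) (L : ℝ) : Prop := ∀ x, L < ‖x‖ → V x = 0

theorem IsPotential.exists_potentialIn (hV : IsPotential V) : ∃ L, 0 < L ∧ PotentialIn V L := by
  obtain ⟨L, hL⟩ := hV.hasCompactSupport.isCompact.isBounded.subset_closedBall (0 : Space)
  refine ⟨max L 1, by positivity, fun x hx => ?_⟩
  by_contra h
  have := hL (subset_tsupport V h)
  rw [mem_closedBall_zero_iff] at this
  exact absurd hx (not_lt.2 (this.trans (le_max_left _ _)))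

theorem Cutoff.exists_radius (χ : Cutoff V) (L : ℝ) :
    ∃ L', L ≤ L' ∧ ∀ x : Space, L' < ‖x‖ → χ.toFun x • (1 : Spinor →L[ℂ] Spinor) = 0 := by
  obtain ⟨B, hB⟩ := χ.hasCompactSupport.isCompact.isBounded.subset_closedBall (0 : Space)
  refine ⟨max L B, le_max_left _ _, fun x hx => ?_⟩
  have h : χ.toFun x = 0 := by
    by_contra h
    have := hB (subset_tsupport χ.toFun h)
    rw [mem_closedBall_zero_iff] at this
    exact absurd hx (not_lt.2 (this.trans (le_max_right _ _)))
  rw [h]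
  exact zero_smul ℂ (1 : Spinor →L[ℂ] Spinor)

theorem PotentialIn.symbol_eq_zero {L : ℝ} (hL : PotentialIn V L) (x : Space) (hx : L < ‖x‖) :
    potentialSymbol V x = 0 := by
  unfold potentialSymbol
  rw [hL x hx]
  exact map_zero _

/-- The potential as an operator. -/
abbrev potentialOp (V : Space → Matrix (Fin 4) (Fin 4) ℂ) : L2 →L[ℂ] L2 :=
  mulOp (potentialSymbol V)

/-- The Birman–Schwinger type operator `1_L P(w) V`. -/
def birmanOp (α : Fin 4 → Matrix (Fin 4) (Fin 4) ℂ) (V : Space → Matrix (Fin 4) (Fin 4) ℂ) (L : ℝ)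
    (w : ℂ) : L2 →L[ℂ] L2 :=
  ballCut L * propagator α (2 * L + 1) (momentum w) (spectralParam w) * potentialOp V

/-- The meromorphic continuation of the cut-off resolvent. -/
def continuation (α : Fin 4 → Matrix (Fin 4) (Fin 4) ℂ) (V : Space → Matrix (Fin 4) (Fin 4) ℂ)
    (χ : Cutoff V) (L L' : ℝ) (w : ℂ) : L2 →L[ℂ] L2 :=
  χ.mul * propagator α (2 * L' + 1) (momentum w) (spectralParam w) * χ.mul
    - (χ.mul * propagator α (2 * L' + 1) (momentum w) (spectralParam w) * potentialOp V)
      ∘L Ring.inverse (1 + birmanOp α V L w)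
      ∘L (ballCut L * propagator α (2 * L' + 1) (momentum w) (spectralParam w) * χ.mul)

theorem isSymbol_cutoff (χ : Cutoff V) :
    IsSymbol fun x => χ.toFun x • (1 : Spinor →L[ℂ] Spinor) := by
  obtain ⟨C, hC⟩ := χ.hasCompactSupport.exists_bound_of_continuous χ.smooth.continuous
  exact isSymbol_scalar χ.smooth.continuous.stronglyMeasurable hC

theorem ballCut_mul_ballCut {L L' : ℝ} (hL : L ≤ L') :
    ballCut L' * ballCut L = ballCut L ∧ ballCut L * ballCut L' = ballCut L := by
  have h : ∀ x : Space, L' < ‖x‖ → Set.indicator (Metric.closedBall (0 : Space) L)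
      (fun _ => (1 : ℂ)) x • (1 : Spinor →L[ℂ] Spinor) = 0 := by
    intro x hx
    rw [Set.indicator_of_notMem (by simpa using hL.trans_lt hx)]
    exact zero_smul ℂ (1 : Spinor →L[ℂ] Spinor)
  exact ⟨ballCut_mul_mulOp (isSymbol_ballCut L) h, mulOp_mul_ballCut (isSymbol_ballCut L) h⟩

theorem continuation_eq (hα : IsDiracMatrices α) (hV : IsPotential V) (χ : Cutoff V) {L L' : ℝ}
    (hL0 : 0 ≤ L) (hL : PotentialIn V L) (hLL' : L ≤ L')
    (hχ : ∀ x : Space, L' < ‖x‖ → χ.toFun x • (1 : Spinor →L[ℂ] Spinor) = 0)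
    {w : ℂ} (hw : 0 < w.im) {R : L2 →L[ℂ] L2} (hR : IsResolvent α V (spectralParam w) R) :
    continuation α V χ L L' w = χ.mul ∘L R ∘L χ.mul := by
  have hVL := hL.symbol_eq_zero
  refine resolvent_continuation_eq (ρ' := ballCut L') (hR.eq_sub hα hV hw)
    (hR.freeResolvent_eq hα hV hw) (mulOp_mul_ballCut hV.isSymbol hVL)
    (ballCut_mul_mulOp hV.isSymbol hVL)
    (ballCut_mul_mulOp hV.isSymbol fun x hx => hVL x (hLL'.trans_lt hx))
    (ballCut_mul_ballCut hLL').2 ?_ ?_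
    (ballCut_freeResolvent_ballCut hα hw (by linarith) (by linarith))
    (ballCut_freeResolvent_ballCut hα hw (by linarith) (by linarith))
  · rw [χ.mul_eq_mulOp]
    exact mulOp_mul_ballCut (isSymbol_cutoff χ) hχ
  · rw [χ.mul_eq_mulOp]
    exact ballCut_mul_mulOp (isSymbol_cutoff χ) hχ

theorem analyticAt_birmanOp (hα : IsDiracMatrices α) {L : ℝ} (hL : 0 ≤ L) {w : ℂ} (hw : w ≠ 0) :
    AnalyticAt ℂ (birmanOp α V L) w := by
  unfold birmanOp
  exact (analyticAt_const.mul (analyticAt_propagator hα (by linarith) hw)).mul analyticAt_const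

end Continuation

end DiracResonance

end

noncomputable section

namespace DiracResonance

/-! ### Taylor polynomials of plane waves and vanishing moments -/

section Taylor

/-- An exponential tail bound for the Taylor remainder of the exponential function. -/
theorem norm_exp_sub_sum_le {s : ℂ} {a : ℝ} (hs : ‖s‖ ≤ a) (M : ℕ) :
    ‖Complex.exp s - ∑ m ∈ Finset.range M, s ^ m / (m.factorial : ℂ)‖ ≤ Real.exp (3 * a - M) := by
  set t := ‖s‖
  have ht : 0 ≤ t := norm_nonneg s
  have hE : ∀ y : ℝ, HasSum (fun n : ℕ => y ^ n / (n.factorial : ℝ)) (Real.exp y) := by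
    intro y
    rw [Real.exp_eq_exp_ℝ]
    exact NormedSpace.expSeries_div_hasSum_exp y
  have h1 := (hasSum_nat_add_iff' M).2 (hE t)
  have h2 := ((hE (3 * t)).mul_left (Real.exp (-M)))
  have h3 : Real.exp t - ∑ m ∈ Finset.range M, t ^ m / (m.factorial : ℝ)
      ≤ Real.exp (-M) * Real.exp (3 * t) := by
    refine hasSum_le_inj (fun n => n + M) (add_left_injective M) (fun c _ => by positivity)
      (fun n => ?_) h1 h2
    -- The tail beyond degree `M` is compared with the series of `e^{3t}`, where each term gains
    -- `3^(n + M) ≥ e^M`.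
    have h4 : (1 : ℝ) ≤ Real.exp (-M) * 3 ^ (n + M) := by
      have h5 : Real.exp (M : ℝ) ≤ 3 ^ (n + M) := by
        have : Real.exp (M : ℝ) = Real.exp 1 ^ M := by rw [← Real.exp_nat_mul, mul_one]
        rw [this]
        have h6 : Real.exp 1 ≤ 3 := Real.exp_one_lt_three.le
        calc Real.exp 1 ^ M ≤ 3 ^ M := by gcongr
          _ ≤ 3 ^ (n + M) := pow_le_pow_right₀ (by norm_num) (by omega)
      rw [Real.exp_neg, ← div_eq_inv_mul, le_div_iff₀ (Real.exp_pos _), one_mul]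
      exact h5
    calc t ^ (n + M) / ((n + M).factorial : ℝ) ≤ (Real.exp (-M) * 3 ^ (n + M)) *
          (t ^ (n + M) / ((n + M).factorial : ℝ)) := le_mul_of_one_le_left (by positivity) h4
      _ = _ := by rw [mul_pow]; ring
  refine (Complex.norm_exp_sub_sum_le_exp_norm_sub_sum s M).trans (h3.trans ?_)
  rw [← Real.exp_add]
  exact Real.exp_le_exp.2 (by linarith)

/-- The exponent of a plane wave. -/
def phase (ζ : Fin 3 → ℂ) (x : Space) : ℂ := -Complex.I * ∑ i, ζ i * (x i : ℂ)

theorem norm_phase_le (ζ : Fin 3 → ℂ) (x : Space) : ‖phase ζ x‖ ≤ (∑ i, ‖ζ i‖) * ‖x‖ := by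
  unfold phase
  rw [norm_mul, norm_neg, Complex.norm_I, one_mul, Finset.sum_mul]
  refine (norm_sum_le _ _).trans (Finset.sum_le_sum fun i _ => ?_)
  rw [norm_mul, Complex.norm_real]
  exact mul_le_mul_of_nonneg_left (PiLp.norm_apply_le x i) (norm_nonneg _)

/-- The Taylor polynomials of plane waves. -/
def taylorWave (M : ℕ) (ζ : Fin 3 → ℂ) (x : Space) : ℂ :=
  ∑ m ∈ Finset.range M, phase ζ x ^ m / (m.factorial : ℂ)

theorem continuous_taylorWave (M : ℕ) (ζ : Fin 3 → ℂ) : Continuous (taylorWave M ζ) := by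
  unfold taylorWave phase
  fun_prop

theorem SupportedIn.integrable_smul {L : ℝ} {u : L2} (hu : SupportedIn L u) {q : Space → ℂ}
    (hq : Continuous q) : Integrable fun x => q x • u x := by
  obtain ⟨C, hC⟩ := (isCompact_closedBall (0 : Space) L).exists_bound_of_continuousOn
    hq.continuousOn
  refine Integrable.mono' (hu.integrable.norm.const_mul C)
    (hq.aestronglyMeasurable.smul (Lp.aestronglyMeasurable u)) ?_
  filter_upwards [hu] with x hx
  rw [norm_smul]
  rcases lt_or_ge L ‖x‖ with h | h
  · rw [hx h]
    simp
  · exact mul_le_mul_of_nonneg_right (hC x (by simpa using h)) (norm_nonneg _)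

/-- The norm of the embedding of `L²` into `L¹` on a ball. -/
def ballConst (L : ℝ) : ℝ :=
  ((volume (Metric.closedBall (0 : Space) L)) ^ (1 / (1 : ℝ≥0∞).toReal - 1 / (2 : ℝ≥0∞).toReal)).toReal

theorem ballConst_nonneg (L : ℝ) : 0 ≤ ballConst L := ENNReal.toReal_nonneg

theorem SupportedIn.integral_norm_le {L : ℝ} {u : L2} (hu : SupportedIn L u) :
    ∫ x, ‖u x‖ ≤ ballConst L * ‖u‖ := by
  have hfin : volume (Metric.closedBall (0 : Space) L) ≠ ⊤ := measure_closedBall_lt_top.ne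
  have h0 : ∫ x, ‖u x‖ = ∫ x in Metric.closedBall (0 : Space) L, ‖u x‖ := by
    rw [← integral_indicator measurableSet_closedBall]
    refine integral_congr_ae ?_
    classical
    filter_upwards [hu] with x hx
    rw [Set.indicator_apply]
    split_ifs with h
    · rfl
    · rw [hx (by simpa using h), norm_zero]
  have hI : Integrable u (volume.restrict (Metric.closedBall (0 : Space) L)) :=
    hu.integrable.restrict
  have h1 := eLpNorm_le_eLpNorm_mul_rpow_measure_univ (p := 1) (q := 2) one_le_two
    (hI.aestronglyMeasurable)
  rw [Measure.restrict_apply_univ] at h1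
  have h2 : eLpNorm u 2 (volume.restrict (Metric.closedBall (0 : Space) L)) ≤ eLpNorm u 2 volume :=
    eLpNorm_mono_measure _ Measure.restrict_le_self
  rw [h0, integral_norm_eq_lintegral_enorm hI.aestronglyMeasurable, ← eLpNorm_one_eq_lintegral_enorm]
  have h3 := h1.trans (mul_le_mul_left h2 _)
  have h4 : eLpNorm u 2 volume ≠ ⊤ := (Lp.memLp u).2.ne
  have h5 : volume (Metric.closedBall (0 : Space) L)
      ^ (1 / (1 : ℝ≥0∞).toReal - 1 / (2 : ℝ≥0∞).toReal) ≠ ⊤ :=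
    ENNReal.rpow_ne_top_of_nonneg (by norm_num) hfin
  have h6 := ENNReal.toReal_mono (ENNReal.mul_ne_top h4 h5) h3
  rw [ENNReal.toReal_mul] at h6
  refine h6.trans ?_
  rw [mul_comm, Lp.norm_def]
  exact le_rfl

theorem norm_waveTransform_le {L : ℝ} {u : L2} (hu : SupportedIn L u) (ζ : Fin 3 → ℂ) :
    ‖waveTransform ζ u‖ ≤ Real.exp ((∑ i, ‖ζ i‖) * L) * (ballConst L * ‖u‖) := by
  have h : ‖waveTransform ζ u‖ ≤ ∫ x, Real.exp ((∑ i, ‖ζ i‖) * L) * ‖u x‖ := by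
    refine norm_integral_le_of_norm_le (hu.integrable.norm.const_mul _) ?_
    filter_upwards [hu] with x hx
    rw [norm_smul]
    rcases lt_or_ge L ‖x‖ with h | h
    · rw [hx h]
      simp
    · refine mul_le_mul_of_nonneg_right ((norm_planeWave_le ζ x).trans (Real.exp_le_exp.2 ?_))
        (norm_nonneg _)
      exact mul_le_mul_of_nonneg_left h (Finset.sum_nonneg fun i _ => norm_nonneg _)
  rw [integral_const_mul] at h
  exact h.trans (mul_le_mul_of_nonneg_left hu.integral_norm_le (Real.exp_pos _).le)

/-- If the moments of `u` vanish, its wave transform is small. -/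
theorem norm_waveTransform_le_of_moments {L : ℝ} {u : L2} (hu : SupportedIn L u) {ζ : Fin 3 → ℂ}
    {M : ℕ} (h : ∫ x, taylorWave M ζ x • u x = 0) {a : ℝ} (ha : (∑ i, ‖ζ i‖) * L ≤ a) :
    ‖waveTransform ζ u‖ ≤ Real.exp (3 * a - M) * (ballConst L * ‖u‖) := by
  have e : waveTransform ζ u = ∫ x, (planeWave ζ x - taylorWave M ζ x) • u x := by
    simp only [sub_smul]
    rw [integral_sub (hu.integrable_planeWave_smul ζ)
      (hu.integrable_smul (continuous_taylorWave M ζ)), h, sub_zero]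
    rfl
  have h : ‖waveTransform ζ u‖ ≤ ∫ x, Real.exp (3 * a - M) * ‖u x‖ := by
    rw [e]
    refine norm_integral_le_of_norm_le (hu.integrable.norm.const_mul _) ?_
    filter_upwards [hu] with x hx
    rw [norm_smul]
    rcases lt_or_ge L ‖x‖ with h | h
    · rw [hx h]
      simp
    · refine mul_le_mul_of_nonneg_right ?_ (norm_nonneg _)
      refine norm_exp_sub_sum_le ((norm_phase_le ζ x).trans (le_trans ?_ ha)) M
      exact mul_le_mul_of_nonneg_left h (Finset.sum_nonneg fun i _ => norm_nonneg _)
  rw [integral_const_mul] at h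
  exact h.trans (mul_le_mul_of_nonneg_left hu.integral_norm_le (Real.exp_pos _).le)

/-- Monomials in the coordinates. -/
def coordMonomial (k : Fin 3 → ℕ) (x : Space) : ℂ := ∏ i, (x i : ℂ) ^ k i

theorem continuous_coordMonomial (k : Fin 3 → ℕ) : Continuous (coordMonomial k) := by
  unfold coordMonomial
  fun_prop

/-- The coefficients of the Taylor polynomials of plane waves. -/
def waveCoeff (k : Fin 3 → ℕ) (n : ℕ) : ℂ :=
  (-Complex.I) ^ n * (Nat.multinomial Finset.univ k : ℂ) / (n.factorial : ℂ)

theorem taylorWave_eq (M : ℕ) (ζ : Fin 3 → ℂ) (x : Space) :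
    taylorWave M ζ x = ∑ n ∈ Finset.range M, ∑ k ∈ Finset.piAntidiag Finset.univ n,
      (waveCoeff k n * ∏ i, ζ i ^ k i) * coordMonomial k x := by
  unfold taylorWave phase
  refine Finset.sum_congr rfl fun n _ => ?_
  rw [mul_pow, Finset.sum_pow_eq_sum_piAntidiag, Finset.mul_sum, Finset.sum_div]
  refine Finset.sum_congr rfl fun k _ => ?_
  unfold waveCoeff coordMonomial
  simp only [mul_pow, Finset.prod_mul_distrib]
  ring

theorem integral_taylorWave_smul {L : ℝ} {u : L2} (hu : SupportedIn L u) (M : ℕ) (ζ : Fin 3 → ℂ) :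
    ∫ x, taylorWave M ζ x • u x
      = ∑ n ∈ Finset.range M, ∑ k ∈ Finset.piAntidiag Finset.univ n,
        (waveCoeff k n * ∏ i, ζ i ^ k i) • ∫ x, coordMonomial k x • u x := by
  simp only [taylorWave_eq, Finset.sum_smul, mul_smul]
  rw [integral_finsetSum]
  · refine Finset.sum_congr rfl fun n _ => ?_
    rw [integral_finsetSum]
    · refine Finset.sum_congr rfl fun k _ => ?_
      rw [integral_smul, integral_smul]
    · exact fun k _ => ((hu.integrable_smul (continuous_coordMonomial k)).smul
        (∏ i, ζ i ^ k i)).smul (waveCoeff k n)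
  · exact fun n _ => integrable_finsetSum _ fun k _ =>
      ((hu.integrable_smul (continuous_coordMonomial k)).smul
        (∏ i, ζ i ^ k i)).smul (waveCoeff k n)

end Taylor

/-! ### Polynomial spinors on the ball -/

section MomentSpace

/-- The function `1_B(x) x^k e_i`. -/
def monomialSpinor (L : ℝ) (k : Fin 3 → ℕ) (i : Fin 4) : L2 :=
  mulOp (fun x => Set.indicator (Metric.closedBall (0 : Space) L) (coordMonomial k) x
    • (1 : Spinor →L[ℂ] Spinor))
    (indicatorConstLp 2 (measurableSet_closedBall (x := (0 : Space)) (ε := L))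
      measure_closedBall_lt_top.ne (EuclideanSpace.single i (1 : ℂ) : Spinor))

theorem isSymbol_indicator_coordMonomial (L : ℝ) (k : Fin 3 → ℕ) :
    IsSymbol fun x => Set.indicator (Metric.closedBall (0 : Space) L) (coordMonomial k) x
      • (1 : Spinor →L[ℂ] Spinor) := by
  classical
  obtain ⟨C, hC⟩ := (isCompact_closedBall (0 : Space) L).exists_bound_of_continuousOn
    (continuous_coordMonomial k).continuousOn
  refine isSymbol_scalar (C := max C 0) ((continuous_coordMonomial k).stronglyMeasurable.indicator
    measurableSet_closedBall) fun x => ?_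
  rw [Set.indicator_apply]
  split_ifs with h
  · exact (hC x h).trans (le_max_left _ _)
  · rw [norm_zero]
    exact le_max_right _ _

theorem inner_monomialSpinor (L : ℝ) (k : Fin 3 → ℕ) (i : Fin 4) (v : L2) :
    inner ℂ (monomialSpinor L k i) v = (∫ x, coordMonomial k x • ballCut L v x) i := by
  classical
  have hI := (supportedIn_ballCut L v).integrable_smul (continuous_coordMonomial k)
  rw [L2.inner_def]
  have e : (∫ x, coordMonomial k x • ballCut L v x) i
      = ∫ x, (EuclideanSpace.proj i : Spinor →L[ℂ] ℂ) (coordMonomial k x • ballCut L v x) :=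
    ((EuclideanSpace.proj i : Spinor →L[ℂ] ℂ).integral_comp_comm hI).symm
  rw [e]
  refine integral_congr_ae ?_
  filter_upwards [coeFn_mulOp (isSymbol_indicator_coordMonomial L k)
    (indicatorConstLp 2 (measurableSet_closedBall (x := (0 : Space)) (ε := L))
      measure_closedBall_lt_top.ne (EuclideanSpace.single i (1 : ℂ) : Spinor)), coeFn_ballCut L v,
    indicatorConstLp_coeFn (p := 2) (hs := measurableSet_closedBall (x := (0 : Space)) (ε := L))
      (hμs := measure_closedBall_lt_top.ne)
      (c := (EuclideanSpace.single i (1 : ℂ) : Spinor))] with x h1 h2 h3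
  rw [monomialSpinor, h1, h2, h3, Set.indicator_apply, Set.indicator_apply, Set.indicator_apply]
  split_ifs with h
  · change inner ℂ (coordMonomial k x • (EuclideanSpace.single i (1 : ℂ) : Spinor)) (v x)
      = coordMonomial k x * v x i
    rw [inner_smul_left, EuclideanSpace.inner_single_left, map_one, one_mul]
    congr 1
    unfold coordMonomial
    simp
  · change inner ℂ ((0 : ℂ) • (0 : Spinor)) (v x)
      = (EuclideanSpace.proj i : Spinor →L[ℂ] ℂ) (coordMonomial k x • (0 : Spinor))
    simp

/-- The space of polynomial spinors on a ball, of degree less than `M` in every coordinate. -/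
def momentSpace (L : ℝ) (M : ℕ) : Submodule ℂ L2 :=
  Submodule.span ℂ (Set.range fun p : (Fin 3 → Fin M) × Fin 4 =>
    monomialSpinor L (fun i => p.1 i) p.2)

instance finiteDimensional_momentSpace (L : ℝ) (M : ℕ) : FiniteDimensional ℂ (momentSpace L M) :=
  FiniteDimensional.span_of_finite ℂ (Set.finite_range _)

theorem finrank_momentSpace_le (L : ℝ) (M : ℕ) : Module.finrank ℂ (momentSpace L M) ≤ 4 * M ^ 3 := by
  refine (finrank_range_le_card (R := ℂ) _).trans (le_of_eq ?_)
  simp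
  ring

theorem integral_coordMonomial_eq_zero {L : ℝ} {M : ℕ} {v : L2} (hv : v ∈ (momentSpace L M)ᗮ)
    {k : Fin 3 → ℕ} (hk : ∀ i, k i < M) : ∫ x, coordMonomial k x • ballCut L v x = 0 := by
  ext i
  rw [← inner_monomialSpinor]
  exact (Submodule.mem_orthogonal _ _).1 hv _
    (Submodule.subset_span ⟨⟨fun i => ⟨k i, hk i⟩, i⟩, rfl⟩)

/-- The Taylor polynomial has total degree less than `M`, so each of its monomials has every
exponent less than `M`. -/
theorem integral_taylorWave_eq_zero {L : ℝ} {M : ℕ} {v : L2} (hv : v ∈ (momentSpace L M)ᗮ)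
    (ζ : Fin 3 → ℂ) : ∫ x, taylorWave M ζ x • ballCut L v x = 0 := by
  rw [integral_taylorWave_smul (supportedIn_ballCut L v)]
  refine Finset.sum_eq_zero fun n hn => Finset.sum_eq_zero fun k hk => ?_
  rw [integral_coordMonomial_eq_zero hv, smul_zero]
  intro i
  have h1 : ∑ i, k i = n := (Finset.mem_piAntidiag.1 hk).1
  have h2 : k i ≤ ∑ i, k i := Finset.single_le_sum (f := k) (fun i _ => Nat.zero_le _) (Finset.mem_univ i)
  have h3 := Finset.mem_range.1 hn
  omega

end MomentSpace

/-! ### Moments along a sphere of frequencies -/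

section SphereMoments

/-- The Taylor moments of `u` along the sphere of radius `κ`, as a function of the direction. -/
def sphereMoments (L : ℝ) (M : ℕ) (κ : ℂ) : L2 →ₗ[ℂ] (UnitSphere → Spinor) where
  toFun u θ := ∫ x, taylorWave M (dirFreq κ θ) x • ballCut L u x
  map_add' u v := by
    funext θ
    have hq := continuous_taylorWave M (dirFreq κ θ)
    refine Eq.trans (integral_congr_ae ?_) (integral_add
      ((supportedIn_ballCut L u).integrable_smul hq) ((supportedIn_ballCut L v).integrable_smul hq))
    rw [map_add]
    filter_upwards [Lp.coeFn_add (ballCut L u) (ballCut L v)] with x hx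
    rw [hx, Pi.add_apply, smul_add]
  map_smul' c u := by
    funext θ
    refine Eq.trans (integral_congr_ae ?_) (integral_smul c _)
    rw [map_smul]
    filter_upwards [Lp.coeFn_smul c (ballCut L u)] with x hx
    rw [hx, Pi.smul_apply, smul_comm]

/-- Spherical polynomials of degree less than `M`, reduced modulo `θ₀² + θ₁² + θ₂² = 1`. -/
def spherePolynomials (M : ℕ) : Submodule ℂ (UnitSphere → Spinor) :=
  Submodule.span ℂ (Set.range fun p : (Fin M × Fin M × Fin 2) × Fin 4 =>
    fun θ : UnitSphere => coordMonomial ![p.1.1, p.1.2.1, p.1.2.2] (θ : Space)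
      • (EuclideanSpace.single p.2 (1 : ℂ) : Spinor))

instance finiteDimensional_spherePolynomials (M : ℕ) :
    FiniteDimensional ℂ (spherePolynomials M) :=
  FiniteDimensional.span_of_finite ℂ (Set.finite_range _)

theorem finrank_spherePolynomials_le (M : ℕ) :
    Module.finrank ℂ (spherePolynomials M) ≤ 8 * M ^ 2 := by
  refine (finrank_range_le_card (R := ℂ) _).trans (le_of_eq ?_)
  simp
  ring

theorem coordMonomial_vec (a b c : ℕ) (x : Space) :
    coordMonomial ![a, b, c] x = (x 0 : ℂ) ^ a * (x 1 : ℂ) ^ b * (x 2 : ℂ) ^ c := by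
  unfold coordMonomial
  rw [Fin.prod_univ_three]
  rfl

theorem coordMonomial_reduce (a b c : ℕ) (θ : UnitSphere) :
    coordMonomial ![a, b, c + 2] (θ : Space) = coordMonomial ![a, b, c] (θ : Space)
      - coordMonomial ![a + 2, b, c] (θ : Space) - coordMonomial ![a, b + 2, c] (θ : Space) := by
  have h : ((θ : Space) 0 : ℂ) ^ 2 + ((θ : Space) 1 : ℂ) ^ 2 + ((θ : Space) 2 : ℂ) ^ 2 = 1 := by
    have h1 : ‖(θ : Space)‖ = 1 := by simpa using θ.2
    have h2 := EuclideanSpace.real_norm_sq_eq (θ : Space)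
    rw [h1, Fin.sum_univ_three] at h2
    have h3 : (θ : Space) 0 ^ 2 + (θ : Space) 1 ^ 2 + (θ : Space) 2 ^ 2 = 1 := by linarith
    have h4 := congrArg ((↑) : ℝ → ℂ) h3
    push_cast at h4
    exact h4
  simp only [coordMonomial_vec]
  linear_combination ((θ : Space) 0 : ℂ) ^ a * ((θ : Space) 1 : ℂ) ^ b * ((θ : Space) 2 : ℂ) ^ c * h

/-- Induction on the last exponent in steps of two, trading `θ₂²` for `1 - θ₀² - θ₁²`. The total
degree never grows, so last exponents `0` and `1` suffice; this makes the dimension quadratic in `M`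
instead of cubic. -/
theorem coordMonomial_single_mem (M : ℕ) (i : Fin 4) (c : ℕ) : ∀ a b : ℕ, a + b + c < M →
    (fun θ : UnitSphere => coordMonomial ![a, b, c] (θ : Space)
      • (EuclideanSpace.single i (1 : ℂ) : Spinor)) ∈ spherePolynomials M := by
  induction c using Nat.twoStepInduction with
  | zero =>
    intro a b h
    exact Submodule.subset_span ⟨((⟨a, by omega⟩, ⟨b, by omega⟩, 0), i), rfl⟩
  | one =>
    intro a b h
    exact Submodule.subset_span ⟨((⟨a, by omega⟩, ⟨b, by omega⟩, 1), i), rfl⟩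
  | more c ih _ =>
    intro a b h
    have := (spherePolynomials M).sub_mem ((spherePolynomials M).sub_mem (ih a b (by omega))
      (ih (a + 2) b (by omega))) (ih a (b + 2) (by omega))
    convert this using 1
    funext θ
    rw [coordMonomial_reduce, sub_smul, sub_smul]
    rfl

theorem coordMonomial_smul_mem {M : ℕ} {k : Fin 3 → ℕ} (hk : ∑ i, k i < M) (s : Spinor) :
    (fun θ : UnitSphere => coordMonomial k (θ : Space) • s) ∈ spherePolynomials M := by
  have h1 : ∀ i, (fun θ : UnitSphere => coordMonomial k (θ : Space)
      • (EuclideanSpace.single i (1 : ℂ) : Spinor)) ∈ spherePolynomials M := by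
    intro i
    rw [Fin.sum_univ_three] at hk
    have h2 := coordMonomial_single_mem M i (k 2) (k 0) (k 1) hk
    have h3 : ![k 0, k 1, k 2] = k := by
      funext j
      fin_cases j <;> rfl
    rwa [h3] at h2
  have h2 := (spherePolynomials M).sum_mem (t := Finset.univ)
    fun i _ => (spherePolynomials M).smul_mem (s i) (h1 i)
  convert h2 using 1
  funext θ
  ext j
  simp [Finset.sum_apply, Pi.single_apply, mul_comm]

/-- In `(κθ)^k` the number `κ` only contributes a scalar, so the moments range in one and the same
space of spherical polynomials for all `κ`. -/
theorem sphereMoments_mem (L : ℝ) (M : ℕ) (κ : ℂ) (u : L2) :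
    sphereMoments L M κ u ∈ spherePolynomials M := by
  have e : sphereMoments L M κ u = ∑ n ∈ Finset.range M, ∑ k ∈ Finset.piAntidiag Finset.univ n,
      (waveCoeff k n * ∏ i, κ ^ k i) • fun θ : UnitSphere =>
        coordMonomial k (θ : Space) • ∫ x, coordMonomial k x • ballCut L u x := by
    funext θ
    refine (integral_taylorWave_smul (supportedIn_ballCut L u) M _).trans ?_
    simp only [Finset.sum_apply, Pi.smul_apply]
    refine Finset.sum_congr rfl fun n _ => Finset.sum_congr rfl fun k _ => ?_
    rw [smul_smul]
    congr 1
    unfold dirFreq coordMonomial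
    simp only [mul_pow, Finset.prod_mul_distrib]
    ring
  rw [e]
  refine Submodule.sum_mem _ fun n hn => Submodule.sum_mem _ fun k hk =>
    Submodule.smul_mem _ _ (coordMonomial_smul_mem ?_ _)
  rw [(Finset.mem_piAntidiag.1 hk).1]
  exact Finset.mem_range.1 hn

end SphereMoments

end DiracResonance

end

noncomputable section

namespace DiracResonance

/-! ### Norm bounds from matrix elements -/

section Residual

variable {H : Type} [NormedAddCommGroup H] [InnerProductSpace ℂ H] [CompleteSpace H]

/-- The residual part of `K u` is its projection to the complement of `E`, so it may be tested
against itself. -/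
theorem norm_residualPart_le {K : H →L[ℂ] H} {E : Submodule ℂ H} [FiniteDimensional ℂ E] {c : ℝ}
    (hc : 0 ≤ c) (h : ∀ v ∈ Eᗮ, ∀ u, ‖inner ℂ v (K u)‖ ≤ c * ‖v‖ * ‖u‖) :
    ‖residualPart K E‖ ≤ c := by
  refine ContinuousLinearMap.opNorm_le_bound _ hc fun u => ?_
  set r := residualPart K E u with hr
  have hre : r = K u - E.orthogonalProjectionOnto (K u) := rfl
  have hmem : r ∈ Eᗮ := by
    rw [hre]
    exact Submodule.sub_starProjection_mem_orthogonal (K u)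
  have h1 : inner ℂ r r = inner ℂ r (K u) := by
    have h0 : inner ℂ r r = inner ℂ r (K u - E.orthogonalProjectionOnto (K u)) := by rw [← hre]
    rw [h0, inner_sub_right, (Submodule.mem_orthogonal' _ _).1 hmem _ (Submodule.coe_mem _), sub_zero]
  have h2 := h r hmem u
  rw [← h1, inner_self_eq_norm_sq_to_K] at h2
  have h3 : ‖((‖r‖ : ℂ)) ^ 2‖ = ‖r‖ ^ 2 := by simp
  have h4 : ‖r‖ ^ 2 ≤ c * ‖r‖ * ‖u‖ := by
    rw [← h3]
    exact h2
  rcases (norm_nonneg r).eq_or_lt with h0 | h0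
  · rw [← h0]
    positivity
  · nlinarith

theorem norm_le_of_inner_le {x : H} {c : ℝ} (hc : 0 ≤ c) (h : ∀ v : H, ‖inner ℂ v x‖ ≤ c * ‖v‖) :
    ‖x‖ ≤ c := by
  have h2 := h x
  rw [inner_self_eq_norm_sq_to_K] at h2
  have h3 : ‖((‖x‖ : ℂ)) ^ 2‖ = ‖x‖ ^ 2 := by simp
  have h4 : ‖x‖ ^ 2 ≤ c * ‖x‖ := by
    rw [← h3]
    exact h2
  rcases (norm_nonneg x).eq_or_lt with h0 | h0
  · rw [← h0]
    exact hc
  · nlinarith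

end Residual

/-! ### Low and high frequencies -/

section FrequencySplitting

/-- Split at `|ξ| = Λ`: above, the symbol is at most `D/Λ`; below, the transforms are bounded
pointwise and the ball has finite volume. -/
theorem norm_inner_fourierOp_le {a : Space → Spinor →L[ℂ] Spinor} (ha : StronglyMeasurable a)
    {C D Λ e f : ℝ} (hC : ∀ ξ, ‖a ξ‖ ≤ C) (hD : ∀ ξ, freq ξ * ‖a ξ‖ ≤ D) (hΛ : 0 < Λ) {v u : L2}
    (he : ∀ᵐ ξ : Space, ‖ξ‖ ≤ Λ → ‖fourierL2 v ξ‖ ≤ e)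
    (hf : ∀ᵐ ξ : Space, ‖ξ‖ ≤ Λ → ‖fourierL2 u ξ‖ ≤ f) :
    ‖inner ℂ v (fourierOp a u)‖ ≤ D / Λ * ‖v‖ * ‖u‖
      + C * e * f * volume.real (Metric.closedBall (0 : Space) Λ) := by
  classical
  set B := Metric.closedBall (0 : Space) Λ
  have hC0 : 0 ≤ C := (norm_nonneg _).trans (hC 0)
  have hD0 : 0 ≤ D := (mul_nonneg (freq_nonneg 0) (norm_nonneg _)).trans (hD 0)
  have hlow : IsSymbol (B.indicator a) :=
    ⟨ha.indicator measurableSet_closedBall, C, fun ξ => by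
      rw [Set.indicator_apply]; split_ifs
      · exact hC ξ
      · rw [norm_zero]; exact hC0⟩
  have hhigh' : ∀ ξ, ‖(Bᶜ).indicator a ξ‖ ≤ D / Λ := by
    intro ξ
    rw [Set.indicator_apply]
    split_ifs with h
    · have h1 : Λ < ‖ξ‖ := by simpa [B] using h
      have h2 : Λ ≤ freq ξ := by
        unfold freq
        nlinarith [Real.pi_gt_three]
      rw [le_div_iff₀ hΛ, mul_comm]
      exact (mul_le_mul_of_nonneg_right h2 (norm_nonneg _)).trans (hD ξ)
    · rw [norm_zero]
      positivity
  have hhighm : StronglyMeasurable ((Bᶜ).indicator a) :=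
    ha.indicator measurableSet_closedBall.compl
  have hsplit : a = fun ξ => B.indicator a ξ + (Bᶜ).indicator a ξ := by
    funext ξ
    exact (congrFun (Set.indicator_self_add_compl B a) ξ).symm
  have hop : fourierOp a u = fourierOp (B.indicator a) u + fourierOp ((Bᶜ).indicator a) u := by
    conv_lhs => rw [hsplit]
    rw [fourierOp_add hlow ⟨hhighm, _, hhigh'⟩]
    rfl
  rw [hop, inner_add_right, add_comm (D / Λ * ‖v‖ * ‖u‖)]
  refine (norm_add_le _ _).trans (add_le_add ?_ ?_)
  · rw [inner_fourierOp hlow]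
    have hint : Integrable (B.indicator fun _ => C * e * f) (volume : Measure Space) :=
      (integrable_indicator_iff measurableSet_closedBall).2
        (integrableOn_const measure_closedBall_lt_top.ne)
    refine (norm_integral_le_of_norm_le hint ?_).trans ?_
    · filter_upwards [he, hf] with ξ h1 h2
      rw [Set.indicator_apply, Set.indicator_apply]
      split_ifs with h
      · have hξ : ‖ξ‖ ≤ Λ := by simpa [B] using h
        calc ‖inner ℂ (fourierL2 v ξ) (a ξ (fourierL2 u ξ))‖
            ≤ ‖fourierL2 v ξ‖ * (‖a ξ‖ * ‖fourierL2 u ξ‖) :=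
              (norm_inner_le_norm _ _).trans
                (mul_le_mul_of_nonneg_left ((a ξ).le_opNorm _) (norm_nonneg _))
          _ ≤ e * (C * f) := by
              have := (norm_nonneg _).trans (h1 hξ)
              gcongr
              · exact h1 hξ
              · exact hC ξ
              · exact h2 hξ
          _ = C * e * f := by ring
      · change ‖inner ℂ (fourierL2 v ξ) (0 : Spinor)‖ ≤ 0
        rw [inner_zero_right, norm_zero]
    · rw [integral_indicator_const _ measurableSet_closedBall, smul_eq_mul, mul_comm]
  · refine (norm_inner_le_norm _ _).trans ?_
    have h1 := norm_fourierOp_apply_le hhighm hhigh' u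
    calc ‖v‖ * ‖fourierOp ((Bᶜ).indicator a) u‖ ≤ ‖v‖ * (D / Λ * ‖u‖) := by gcongr
      _ = D / Λ * ‖v‖ * ‖u‖ := by ring

theorem sum_norm_realFreq_le (ξ : Space) :
    ∑ i, ‖(2 * Real.pi * (ξ i : ℂ) : ℂ)‖ ≤ 24 * ‖ξ‖ := by
  have h1 : ∀ i, ‖(2 * Real.pi * (ξ i : ℂ) : ℂ)‖ ≤ 8 * ‖ξ‖ := by
    intro i
    have h2 := PiLp.norm_apply_le ξ i
    have h3 : ‖(2 * Real.pi * (ξ i : ℂ) : ℂ)‖ = 2 * Real.pi * ‖ξ i‖ := by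
      rw [norm_mul, norm_mul, Complex.norm_real, Complex.norm_real, Real.norm_of_nonneg Real.pi_pos.le]
      simp
    rw [h3]
    nlinarith [Real.pi_le_four, Real.pi_pos, norm_nonneg (ξ i)]
  rw [Fin.sum_univ_three]
  linarith [h1 0, h1 1, h1 2]

theorem fourierL2_ballCut_le_of_mem_orthogonal {L : ℝ} (hL : 0 ≤ L) {M : ℕ} {v : L2}
    (hv : v ∈ (momentSpace L M)ᗮ) (Λ : ℝ) : ∀ᵐ ξ : Space, ‖ξ‖ ≤ Λ →
      ‖fourierL2 (ballCut L v) ξ‖ ≤ Real.exp (72 * L * Λ - M) * (ballConst L * ‖v‖) := by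
  filter_upwards [fourierL2_ae_eq (supportedIn_ballCut L v).integrable] with ξ h1 h2
  rw [h1]
  -- `24 Λ L` bounds the exponent for real frequencies up to `Λ`; the factor `3` in the Taylor tail
  -- turns it into `72`.
  have h3 := norm_waveTransform_le_of_moments (supportedIn_ballCut L v)
    (integral_taylorWave_eq_zero hv fun i => 2 * Real.pi * (ξ i : ℂ)) (a := 24 * Λ * L)
    (mul_le_mul_of_nonneg_right ((sum_norm_realFreq_le ξ).trans (by linarith)) hL)
  refine h3.trans (mul_le_mul (Real.exp_le_exp.2 (by linarith)) ?_ ?_ (Real.exp_pos _).le)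
  · exact mul_le_mul_of_nonneg_left (norm_ballCut_le L v) (ballConst_nonneg L)
  · exact mul_nonneg (ballConst_nonneg L) (norm_nonneg _)

theorem fourierL2_le_of_supportedIn {L : ℝ} (hL : 0 ≤ L) {u : L2} (hu : SupportedIn L u) (Λ : ℝ) :
    ∀ᵐ ξ : Space, ‖ξ‖ ≤ Λ → ‖fourierL2 u ξ‖ ≤ Real.exp (24 * L * Λ) * (ballConst L * ‖u‖) := by
  filter_upwards [fourierL2_ae_eq hu.integrable] with ξ h1 h2
  rw [h1]
  refine (norm_waveTransform_le hu _).trans ?_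
  refine mul_le_mul_of_nonneg_right (Real.exp_le_exp.2 ?_)
    (mul_nonneg (ballConst_nonneg L) (norm_nonneg _))
  nlinarith [mul_le_mul_of_nonneg_right ((sum_norm_realFreq_le ξ).trans
    (mul_le_mul_of_nonneg_left h2 (by norm_num : (0 : ℝ) ≤ 24))) hL]

end FrequencySplitting

/-! ### Bounds for `1_L P V` on both sheets -/

section BirmanEstimates

variable {α : Fin 4 → Matrix (Fin 4) (Fin 4) ℂ} {V : Space → Matrix (Fin 4) (Fin 4) ℂ}

/-- The operator `1_L P(κ, z) V` with independent parameters. -/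
def cutPropagator (α : Fin 4 → Matrix (Fin 4) (Fin 4) ℂ) (V : Space → Matrix (Fin 4) (Fin 4) ℂ)
    (L : ℝ) (κ z : ℂ) : L2 →L[ℂ] L2 :=
  ballCut L * propagator α (2 * L + 1) κ z * potentialOp V

theorem inner_cutPropagator (L : ℝ) (κ z : ℂ) (v u : L2) :
    inner ℂ v (cutPropagator α V L κ z u)
      = inner ℂ (ballCut L v) (propagator α (2 * L + 1) κ z (potentialOp V u)) :=
  (inner_ballCut_left L v _).symm

theorem norm_cutPropagator_apply_le {L : ℝ} {κ z : ℂ} {C : ℝ} (hC : 0 ≤ C)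
    (h : ∀ ξ, ‖propagatorSymbol α (2 * L + 1) κ z ξ‖ ≤ C) (u : L2) :
    ‖cutPropagator α V L κ z u‖ ≤ C * ‖potentialOp V‖ * ‖u‖ := by
  refine (norm_ballCut_le L _).trans ((ContinuousLinearMap.le_opNorm _ _).trans ?_)
  calc ‖propagator α (2 * L + 1) κ z‖ * ‖potentialOp V u‖ ≤ C * (‖potentialOp V‖ * ‖u‖) :=
        mul_le_mul (norm_propagator_le hC h) (ContinuousLinearMap.le_opNorm _ _)
          (norm_nonneg _) hC
    _ = _ := by ring

/-- The bound for the propagator on the physical sheet. -/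
def timeConst (L : ℝ) : ℝ := 3 * (2 * L + 1) + 2 * (2 * L + 1) ^ 2

theorem timeConst_nonneg {L : ℝ} (hL : 0 ≤ L) : 0 ≤ timeConst L := by
  unfold timeConst
  positivity

/-- At low frequencies the transform of `1_L v` is of size `e^{72LΛ - M}` by orthogonality to
polynomials, while that of `V u` is at most `e^{24LΛ}`; together they give `96`. High frequencies
contribute `(1 + |κ|)/Λ`. -/
theorem norm_inner_cutPropagator_le_of_orthogonal (hα : IsDiracMatrices α) (hV : IsPotential V)
    {L : ℝ} (hL : 0 ≤ L) (hVL : PotentialIn V L) {κ z : ℂ} (hκ : 0 ≤ κ.im) (hz : ‖z‖ ≤ ‖κ‖ + 1)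
    {M : ℕ} {v : L2} (hv : v ∈ (momentSpace L M)ᗮ) {Λ : ℝ} (hΛ : 0 < Λ) (u : L2) :
    ‖inner ℂ v (cutPropagator α V L κ z u)‖
      ≤ (4 * (1 + L) * (1 + ‖κ‖) / Λ + timeConst L * ballConst L ^ 2 * Real.exp (96 * L * Λ - M)
        * volume.real (Metric.closedBall (0 : Space) Λ)) * ‖potentialOp V‖ * ‖v‖ * ‖u‖ := by
  have hT : 0 ≤ 2 * L + 1 := by linarith
  have hu : SupportedIn L (potentialOp V u) := supportedIn_mulOp hV.isSymbol hVL.symbol_eq_zero u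
  rw [inner_cutPropagator]
  have h := norm_inner_fourierOp_le (continuous_propagatorSymbol (2 * L + 1) κ z).stronglyMeasurable
    (norm_propagatorSymbol_le hα hT hκ hz) (freq_mul_norm_propagatorSymbol_le hα hT hκ hz) hΛ
    (fourierL2_ballCut_le_of_mem_orthogonal hL hv Λ) (fourierL2_le_of_supportedIn hL hu Λ)
  refine h.trans ?_
  have h1 : ‖potentialOp V u‖ ≤ ‖potentialOp V‖ * ‖u‖ := ContinuousLinearMap.le_opNorm _ _
  have h2 := norm_ballCut_le L v
  have h3 := ballConst_nonneg L
  have h4 := timeConst_nonneg hL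
  have e : Real.exp (96 * L * Λ - M) = Real.exp (72 * L * Λ - M) * Real.exp (24 * L * Λ) := by
    rw [← Real.exp_add]
    congr 1
    ring
  have h5 : 2 * (1 + (2 * L + 1)) * (1 + ‖κ‖) / Λ = 4 * (1 + L) * (1 + ‖κ‖) / Λ := by ring
  have h6 : 0 ≤ 4 * (1 + L) * (1 + ‖κ‖) / Λ := by positivity
  rw [h5, e]
  change _ + timeConst L * _ * _ * _ ≤ _
  set p := Real.exp (72 * L * Λ - M)
  set q := Real.exp (24 * L * Λ)
  set m := volume.real (Metric.closedBall (0 : Space) Λ)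
  set P := 4 * (1 + L) * (1 + ‖κ‖) / Λ
  have hp : 0 ≤ p := (Real.exp_pos _).le
  have hq : 0 ≤ q := (Real.exp_pos _).le
  have hm : 0 ≤ m := measureReal_nonneg
  calc P * ‖ballCut L v‖ * ‖potentialOp V u‖ + timeConst L * (p * (ballConst L * ‖v‖))
        * (q * (ballConst L * ‖potentialOp V u‖)) * m
      ≤ P * ‖v‖ * (‖potentialOp V‖ * ‖u‖) + timeConst L * (p * (ballConst L * ‖v‖))
        * (q * (ballConst L * (‖potentialOp V‖ * ‖u‖))) * m := by gcongr
    _ = _ := by ring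

/-- The size of the jump of the propagator across the sheets, for data with a gain `e`. -/
def jumpBound (α : Fin 4 → Matrix (Fin 4) (Fin 4) ℂ) (L R e : ℝ) : ℝ :=
  R * (4 * R + 2) * sphereConst α * ballConst L ^ 2 * e

/-- `p` and `q` allow the exponential gain to sit on either side: on `v` for the residual bound, on
`u` for the determinant bound. -/
theorem norm_inner_cutPropagator_sub_le (hα : IsDiracMatrices α) (hV : IsPotential V)
    {L : ℝ} (hL : 0 ≤ L) (hVL : PotentialIn V L) {κ z : ℂ} {R : ℝ} (hR : ‖κ‖ ≤ R)
    (hz : ‖z‖ ≤ ‖κ‖ + 1) {v u : L2} {p q : ℝ} (hp : 0 ≤ p) (hq : 0 ≤ q)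
    (hv : ∀ ζ : Fin 3 → ℂ, ∑ i, ‖ζ i‖ ≤ 3 * R →
      ‖waveTransform ζ (ballCut L v)‖ ≤ p * (ballConst L * ‖v‖))
    (hu : ∀ θ, ‖waveTransform (dirFreq κ θ) (potentialOp V u)‖
      ≤ q * (ballConst L * ‖potentialOp V u‖)) :
    ‖inner ℂ v (cutPropagator α V L κ z u) - inner ℂ v (cutPropagator α V L (-κ) z u)‖
      ≤ jumpBound α L R (p * q) * ‖potentialOp V‖ * ‖v‖ * ‖u‖ := by
  have hus : SupportedIn L (potentialOp V u) := supportedIn_mulOp hV.isSymbol hVL.symbol_eq_zero u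
  rw [inner_cutPropagator, inner_cutPropagator]
  have h := norm_inner_propagator_sub_le hα (by linarith : 0 ≤ 2 * L + 1) (by linarith)
    (supportedIn_ballCut L v) hus κ z (fun θ => hv _ ?_) hu
  · refine h.trans ?_
    have h1 : ‖potentialOp V u‖ ≤ ‖potentialOp V‖ * ‖u‖ := ContinuousLinearMap.le_opNorm _ _
    have h3 := ballConst_nonneg L
    have h4 := sphereConst_nonneg α
    have hR0 : 0 ≤ R := (norm_nonneg _).trans hR
    have h5 : 3 * ‖κ‖ + 1 + ‖z‖ ≤ 4 * R + 2 := by linarith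
    unfold jumpBound
    calc ‖κ‖ * (3 * ‖κ‖ + 1 + ‖z‖) * sphereConst α
          * (p * (ballConst L * ‖v‖) * (q * (ballConst L * ‖potentialOp V u‖)))
        ≤ R * (4 * R + 2) * sphereConst α
          * (p * (ballConst L * ‖v‖) * (q * (ballConst L * (‖potentialOp V‖ * ‖u‖)))) := by gcongr
      _ = _ := by ring
  · refine (sum_norm_dirFreq_le _ θ).trans ?_
    rw [RCLike.norm_conj]
    linarith

theorem waveTransform_potentialOp_le (hV : IsPotential V) {L : ℝ} (hL : 0 ≤ L)
    (hVL : PotentialIn V L) {κ : ℂ} {R : ℝ} (hR : ‖κ‖ ≤ R) (u : L2) (θ : UnitSphere) :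
    ‖waveTransform (dirFreq κ θ) (potentialOp V u)‖
      ≤ Real.exp (3 * R * L) * (ballConst L * ‖potentialOp V u‖) := by
  refine (norm_waveTransform_le (supportedIn_mulOp hV.isSymbol hVL.symbol_eq_zero u) _).trans ?_
  refine mul_le_mul_of_nonneg_right (Real.exp_le_exp.2 ?_)
    (mul_nonneg (ballConst_nonneg L) (norm_nonneg _))
  exact mul_le_mul_of_nonneg_right ((sum_norm_dirFreq_le κ θ).trans (by linarith)) hL

/-- The bound for the part of `1_L P V` that is not captured by polynomials of degree `< M`. -/
def residualBound (α : Fin 4 → Matrix (Fin 4) (Fin 4) ℂ) (V : Space → Matrix (Fin 4) (Fin 4) ℂ)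
    (L R Λ : ℝ) (M : ℕ) : ℝ :=
  (4 * (1 + L) * (1 + R) / Λ + timeConst L * ballConst L ^ 2 * Real.exp (96 * L * Λ - M)
    * volume.real (Metric.closedBall (0 : Space) Λ)
    + jumpBound α L R (Real.exp (12 * L * R - M))) * ‖potentialOp V‖

/-- For `Im κ ≤ 0`, replace `κ` by `-κ` with the same `z` and pay for the jump. Orthogonality of `v`
to polynomials makes the jump small: `e^{9RL - M}` from `v` against `e^{3RL}` from `u`. -/
theorem norm_residualPart_cutPropagator_le (hα : IsDiracMatrices α) (hV : IsPotential V)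
    {L : ℝ} (hL : 0 ≤ L) (hVL : PotentialIn V L) {κ z : ℂ} {R : ℝ} (hR : ‖κ‖ ≤ R)
    (hz : ‖z‖ ≤ ‖κ‖ + 1) (M : ℕ) {Λ : ℝ} (hΛ : 0 < Λ) :
    ‖residualPart (cutPropagator α V L κ z) (momentSpace L M)‖ ≤ residualBound α V L R Λ M := by
  have hR0 : 0 ≤ R := (norm_nonneg _).trans hR
  have h3 := ballConst_nonneg L
  have h4 := timeConst_nonneg hL
  have h5 := sphereConst_nonneg α
  have hm : 0 ≤ volume.real (Metric.closedBall (0 : Space) Λ) := measureReal_nonneg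
  have hJ : 0 ≤ jumpBound α L R (Real.exp (12 * L * R - M)) := by
    unfold jumpBound
    positivity
  have hA : ∀ κ' : ℂ, ‖κ'‖ = ‖κ‖ → 0 ≤ κ'.im → ∀ v ∈ (momentSpace L M)ᗮ, ∀ u,
      ‖inner ℂ v (cutPropagator α V L κ' z u)‖ ≤ (4 * (1 + L) * (1 + R) / Λ
        + timeConst L * ballConst L ^ 2 * Real.exp (96 * L * Λ - M)
        * volume.real (Metric.closedBall (0 : Space) Λ)) * ‖potentialOp V‖ * ‖v‖ * ‖u‖ := by
    intro κ' hκ' him v hv u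
    refine (norm_inner_cutPropagator_le_of_orthogonal hα hV hL hVL him (by rwa [hκ']) hv hΛ u).trans ?_
    rw [hκ']
    gcongr
  refine norm_residualPart_le ?_ fun v hv u => ?_
  · unfold residualBound
    positivity
  · rcases le_total 0 κ.im with him | him
    · refine (hA κ rfl him v hv u).trans ?_
      unfold residualBound
      refine mul_le_mul_of_nonneg_right (mul_le_mul_of_nonneg_right (mul_le_mul_of_nonneg_right
        (le_add_of_nonneg_right hJ) (norm_nonneg _)) (norm_nonneg _)) (norm_nonneg _)
    · have h1 := hA (-κ) (norm_neg κ) (by rw [Complex.neg_im]; linarith) v hv u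
      have h2 := norm_inner_cutPropagator_sub_le hα hV hL hVL hR hz (v := v) (u := u)
        (Real.exp_pos (9 * R * L - M)).le (Real.exp_pos (3 * R * L)).le (fun ζ hζ => ?_)
        (waveTransform_potentialOp_le hV hL hVL hR u)
      · have e : Real.exp (9 * R * L - M) * Real.exp (3 * R * L) = Real.exp (12 * L * R - M) := by
          rw [← Real.exp_add]
          congr 1
          ring
        rw [e] at h2
        have h6 := norm_le_norm_add_norm_sub' (inner ℂ v (cutPropagator α V L κ z u))
          (inner ℂ v (cutPropagator α V L (-κ) z u))
        unfold residualBound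
        calc _ ≤ _ := h6.trans (add_le_add h1 h2)
          _ = _ := by ring
      · have h7 := norm_waveTransform_le_of_moments (supportedIn_ballCut L v)
          (integral_taylorWave_eq_zero hv ζ) (mul_le_mul_of_nonneg_right hζ hL)
        refine h7.trans (mul_le_mul (Real.exp_le_exp.2 (by linarith)) ?_ ?_ (Real.exp_pos _).le)
        · exact mul_le_mul_of_nonneg_left (norm_ballCut_le L v) h3
        · exact mul_nonneg h3 (norm_nonneg _)

/-- `-κ` lies where the propagator is bounded uniformly, and the jump sees `V u` only through its
transform at the frequencies `κθ`, which the vanishing moments make exponentially small. So the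
exponential growth for `Im κ ≤ 0` is confined to the directions dual to these moments. -/
theorem norm_cutPropagator_le_of_moments (hα : IsDiracMatrices α) (hV : IsPotential V)
    {L : ℝ} (hL : 0 ≤ L) (hVL : PotentialIn V L) {κ z : ℂ} {R : ℝ} (hR : ‖κ‖ ≤ R)
    (hz : ‖z‖ ≤ ‖κ‖ + 1) (him : κ.im ≤ 0) {M : ℕ} {u : L2}
    (hu : sphereMoments L M κ (potentialOp V u) = 0) :
    ‖cutPropagator α V L κ z u‖
      ≤ (timeConst L + jumpBound α L R (Real.exp (12 * L * R - M))) * ‖potentialOp V‖ * ‖u‖ := by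
  have hR0 : 0 ≤ R := (norm_nonneg _).trans hR
  have h3 := ballConst_nonneg L
  have h4 := timeConst_nonneg hL
  have h5 := sphereConst_nonneg α
  have hus : SupportedIn L (potentialOp V u) := supportedIn_mulOp hV.isSymbol hVL.symbol_eq_zero u
  have hJ : 0 ≤ jumpBound α L R (Real.exp (12 * L * R - M)) := by
    unfold jumpBound
    positivity
  refine norm_le_of_inner_le (by positivity) fun v => ?_
  have h1 : ‖inner ℂ v (cutPropagator α V L (-κ) z u)‖ ≤ ‖v‖ * (timeConst L * ‖potentialOp V‖ * ‖u‖) :=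
    (norm_inner_le_norm _ _).trans (mul_le_mul_of_nonneg_left (norm_cutPropagator_apply_le h4
      (norm_propagatorSymbol_le hα (by linarith) (by rw [Complex.neg_im]; linarith)
        (by rwa [norm_neg])) u) (norm_nonneg _))
  have h2 := norm_inner_cutPropagator_sub_le hα hV hL hVL hR hz (v := v) (u := u)
    (Real.exp_pos (3 * R * L)).le (Real.exp_pos (9 * R * L - M)).le (fun ζ hζ => ?_) (fun θ => ?_)
  · have e : Real.exp (3 * R * L) * Real.exp (9 * R * L - M) = Real.exp (12 * L * R - M) := by
      rw [← Real.exp_add]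
      congr 1
      ring
    rw [e] at h2
    have h6 := norm_le_norm_add_norm_sub' (inner ℂ v (cutPropagator α V L κ z u))
      (inner ℂ v (cutPropagator α V L (-κ) z u))
    calc _ ≤ _ := h6.trans (add_le_add h1 h2)
      _ = _ := by ring
  · refine (norm_waveTransform_le (supportedIn_ballCut L v) ζ).trans
      (mul_le_mul (Real.exp_le_exp.2 (mul_le_mul_of_nonneg_right hζ hL)) ?_ ?_ (Real.exp_pos _).le)
    · exact mul_le_mul_of_nonneg_left (norm_ballCut_le L v) h3
    · exact mul_nonneg h3 (norm_nonneg _)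
  · have h7 : ∫ x, taylorWave M (dirFreq κ θ) x • potentialOp V u x = 0 := by
      have := congrFun hu θ
      change ∫ x, taylorWave M (dirFreq κ θ) x • ballCut L (potentialOp V u) x = 0 at this
      rwa [hus.ballCut_eq] at this
    have h8 : (∑ i, ‖dirFreq κ θ i‖) * L ≤ 3 * R * L :=
      mul_le_mul_of_nonneg_right ((sum_norm_dirFreq_le κ θ).trans (by linarith)) hL
    refine (norm_waveTransform_le_of_moments hus h7 h8).trans (mul_le_mul_of_nonneg_right
      (Real.exp_le_exp.2 (by linarith)) (mul_nonneg h3 (norm_nonneg _)))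

end BirmanEstimates

end DiracResonance

end

noncomputable section

namespace DiracResonance

/-! ### Choice of the degree and growth of the determinant -/

section UniformConstants

theorem exists_cube_mul_exp_le {c b : ℝ} (hc : 0 ≤ c) (hb : 0 ≤ b) : ∃ A, 0 < A ∧
    ∀ R M : ℝ, 1 ≤ R → A * R ≤ M → c * R ^ 3 * Real.exp (b * R - M) ≤ 1 / 8 := by
  -- `b` cancels the exponent, `1` absorbs `R³ ≤ 6 e^R`, and `48 c = 8 · 6c` produces the `1/8`.
  refine ⟨b + 1 + 48 * c, by positivity, fun R M hR hM => ?_⟩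
  have h1 : R ^ 3 ≤ 6 * Real.exp R := by
    have := Real.pow_div_factorial_le_exp R (by linarith) 3
    rw [div_le_iff₀ (by positivity)] at this
    simpa [Nat.factorial, mul_comm] using this
  have h2 : Real.exp R * Real.exp (b * R - M) ≤ Real.exp (-(48 * c * R)) := by
    rw [← Real.exp_add]
    exact Real.exp_le_exp.2 (by linarith)
  have h3 : 48 * c * Real.exp (-(48 * c * R)) ≤ 1 := by
    rw [Real.exp_neg, ← div_eq_mul_inv, div_le_one (Real.exp_pos _)]
    have := Real.add_one_le_exp (48 * c * R)
    nlinarith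
  calc c * R ^ 3 * Real.exp (b * R - M) ≤ c * (6 * Real.exp R) * Real.exp (b * R - M) := by gcongr
    _ = 6 * c * (Real.exp R * Real.exp (b * R - M)) := by ring
    _ ≤ 6 * c * Real.exp (-(48 * c * R)) := by gcongr
    _ ≤ 1 / 8 := by linarith

variable {α : Fin 4 → Matrix (Fin 4) (Fin 4) ℂ} {V : Space → Matrix (Fin 4) (Fin 4) ℂ}

theorem jumpBound_le {L R e : ℝ} (hR : 1 ≤ R) (he : 0 ≤ e) :
    jumpBound α L R e ≤ 6 * sphereConst α * ballConst L ^ 2 * R ^ 3 * e := by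
  unfold jumpBound
  have h1 := sphereConst_nonneg α
  have h2 : R * (4 * R + 2) ≤ 6 * R ^ 3 := by
    have : R ^ 2 ≤ R ^ 3 := pow_le_pow_right₀ hR (by norm_num)
    nlinarith
  calc R * (4 * R + 2) * sphereConst α * ballConst L ^ 2 * e
      ≤ 6 * R ^ 3 * sphereConst α * ballConst L ^ 2 * e := by gcongr
    _ = _ := by ring

theorem exists_residualBound_le (α : Fin 4 → Matrix (Fin 4) (Fin 4) ℂ)
    (V : Space → Matrix (Fin 4) (Fin 4) ℂ) {L : ℝ} (hL : 0 ≤ L) : ∃ A, 0 < A ∧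
    ∀ (R : ℝ) (M : ℕ), 1 ≤ R → A * R ≤ M →
      jumpBound α L R (Real.exp (12 * L * R - M)) ≤ 1 ∧
      ∃ Λ, 0 < Λ ∧ residualBound α V L R Λ M ≤ 1 / 2 := by
  set v₀ := ‖potentialOp V‖
  have hv : 0 ≤ v₀ := norm_nonneg _
  have h4 := timeConst_nonneg hL
  have h5 := sphereConst_nonneg α
  -- The frequency threshold will be `Λ = aR`: then the high-frequency term is at most `8(1 + L)v₀/a
  -- ≤ 1/4`.
  set a := 32 * (1 + L) * v₀ + 1
  have ha : 0 < a := by positivity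
  set m := volume.real (Metric.ball (0 : Space) 1)
  have hm : 0 ≤ m := measureReal_nonneg
  obtain ⟨A₁, hA₁, h₁⟩ := exists_cube_mul_exp_le
    (c := timeConst L * ballConst L ^ 2 * a ^ 3 * m * v₀) (b := 96 * L * a) (by positivity)
    (by positivity)
  obtain ⟨A₂, hA₂, h₂⟩ := exists_cube_mul_exp_le
    (c := 6 * sphereConst α * ballConst L ^ 2 * (v₀ + 1)) (b := 12 * L) (by positivity)
    (by positivity)
  refine ⟨A₁ + A₂, by positivity, fun R M hR hM => ?_⟩
  have hR0 : 0 < R := by linarith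
  have i1 := h₁ R M hR (by nlinarith)
  have i2 := h₂ R M hR (by nlinarith)
  have hJ := jumpBound_le (α := α) (L := L) hR (Real.exp_pos (12 * L * R - M)).le
  set J := jumpBound α L R (Real.exp (12 * L * R - M))
  have hJ0 : 0 ≤ J := by
    simp only [J]
    unfold jumpBound
    positivity
  have i3 : J * (v₀ + 1) ≤ 1 / 8 := by
    refine (mul_le_mul_of_nonneg_right hJ (by positivity)).trans (le_trans (le_of_eq ?_) i2)
    ring
  refine ⟨by nlinarith, a * R, by positivity, ?_⟩
  unfold residualBound
  rw [Measure.addHaar_real_closedBall _ _ (by positivity), finrank_euclideanSpace_fin, add_mul,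
    add_mul]
  have i4 : 4 * (1 + L) * (1 + R) / (a * R) * v₀ ≤ 1 / 4 := by
    rw [div_mul_eq_mul_div, div_le_iff₀ (by positivity)]
    have : 4 * (1 + L) * (1 + R) * v₀ ≤ 4 * (1 + L) * (2 * R) * v₀ := by
      gcongr
      linarith
    refine this.trans ?_
    simp only [a]
    nlinarith
  have i5 : timeConst L * ballConst L ^ 2 * Real.exp (96 * L * (a * R) - M) * ((a * R) ^ 3 * m) * v₀
      ≤ 1 / 8 := by
    refine le_trans (le_of_eq ?_) i1
    rw [show 96 * L * (a * R) = 96 * L * a * R by ring]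
    ring
  have i6 : J * v₀ ≤ 1 / 8 := by nlinarith
  change 4 * (1 + L) * (1 + R) / (a * R) * v₀ + timeConst L * ballConst L ^ 2
    * Real.exp (96 * L * (a * R) - M) * ((a * R) ^ 3 * m) * v₀ + J * v₀ ≤ 1 / 2
  linarith

/-- The determinant whose zeros contain the resonances. -/
def birmanDet (α : Fin 4 → Matrix (Fin 4) (Fin 4) ℂ) (V : Space → Matrix (Fin 4) (Fin 4) ℂ)
    (L : ℝ) (M : ℕ) (w : ℂ) : ℂ :=
  LinearMap.det (schurComplement (birmanOp α V L w) (momentSpace L M) :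
    momentSpace L M →ₗ[ℂ] momentSpace L M)

theorem one_add_pow_le_exp {x : ℝ} (hx : 0 ≤ x) (n : ℕ) : (1 + x) ^ n ≤ Real.exp (x * n) := by
  rw [mul_comm, Real.exp_nat_mul]
  exact pow_le_pow_left₀ (by positivity) (by linarith [Real.add_one_le_exp x]) n

/-- With `M = ⌈AR⌉`, the factor `(1 + 2a)^(4M³)` is `e^{O(R³)}`. For `Im κ ≤ 0` there are at most
`8M²` exceptional directions, in which the norm is `e^{O(R)}`; they contribute another `e^{O(R³)}`.
-/
theorem exists_birmanDet_le (hα : IsDiracMatrices α) (hV : IsPotential V) {L : ℝ} (hL : 0 ≤ L)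
    (hVL : PotentialIn V L) : ∃ C, 0 < C ∧ ∀ R : ℝ, 1 ≤ R → ∃ M : ℕ,
      4 * (M : ℝ) ^ 3 ≤ C * R ^ 3 ∧ ∀ w : ℂ, w ≠ 0 → ‖momentum w‖ ≤ R →
        ‖residualPart (birmanOp α V L w) (momentSpace L M)‖ ≤ 1 / 2 ∧
        ‖birmanDet α V L M w‖ ≤ Real.exp (C * R ^ 3) := by
  obtain ⟨A, hA, h⟩ := exists_residualBound_le α V hL
  set v₀ := ‖potentialOp V‖
  have hv : 0 ≤ v₀ := norm_nonneg _
  have h4 := timeConst_nonneg hL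
  set T := 2 * L + 1 with hTdef
  have hT : 0 ≤ T := by positivity
  set a := (timeConst L + 1) * v₀
  have ha : 0 ≤ a := by positivity
  set c₁ := 2 * ((T + 3 * T ^ 2) * v₀) + (T + 1)
  have hc₁ : 0 ≤ c₁ := by positivity
  refine ⟨8 * a * (A + 1) ^ 3 + 8 * c₁ * (A + 1) ^ 2 + 4 * (A + 1) ^ 3, by positivity,
    fun R hR => ⟨⌈A * R⌉₊, ?_⟩⟩
  have hR0 : 0 < R := by linarith
  have hM1 : A * R ≤ (⌈A * R⌉₊ : ℝ) := Nat.le_ceil _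
  have hM2 : (⌈A * R⌉₊ : ℝ) ≤ (A + 1) * R := by
    have := Nat.ceil_lt_add_one (show 0 ≤ A * R by positivity)
    linarith
  set M := ⌈A * R⌉₊
  have hM0 : (0 : ℝ) ≤ M := Nat.cast_nonneg M
  obtain ⟨hJ, Λ, hΛ, hres⟩ := h R M hR hM1
  have hM3 : (M : ℝ) ^ 3 ≤ (A + 1) ^ 3 * R ^ 3 := by
    rw [← mul_pow]
    exact pow_le_pow_left₀ hM0 hM2 3
  have hM22 : (M : ℝ) ^ 2 * R ≤ (A + 1) ^ 2 * R ^ 3 := by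
    have := pow_le_pow_left₀ hM0 hM2 2
    nlinarith
  refine ⟨?_, fun w hw hwR => ?_⟩
  · have : 0 ≤ (8 * a * (A + 1) ^ 3 + 8 * c₁ * (A + 1) ^ 2) * R ^ 3 := by positivity
    nlinarith
  have hz := norm_spectralParam_le hw
  have hQ : ‖residualPart (birmanOp α V L w) (momentSpace L M)‖ ≤ 1 / 2 :=
    (norm_residualPart_cutPropagator_le hα hV hL hVL hwR hz M hΛ).trans hres
  refine ⟨hQ, ?_⟩
  have b1 : (1 + 2 * a) ^ (4 * M ^ 3) ≤ Real.exp (8 * a * (A + 1) ^ 3 * R ^ 3) := by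
    refine (one_add_pow_le_exp (by positivity) _).trans (Real.exp_le_exp.2 ?_)
    push_cast
    nlinarith
  have hrest : 0 ≤ 4 * (A + 1) ^ 3 * R ^ 3 := by positivity
  have hrest2 : 0 ≤ 8 * c₁ * (A + 1) ^ 2 * R ^ 3 := by positivity
  rcases le_total 0 (momentum w).im with him | him
  -- On the closed physical sheet there are no exceptional directions: the moment map is zero and `k
  -- = 0`.
  · have hle := norm_det_schurComplement_le hQ ha ha (0 : L2 →ₗ[ℂ] ℂ) ⊥ (fun u => by simp)
      (finrank_momentSpace_le L M) (k := 0) (by simp) (fun u _ => ?_) (fun u => ?_)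
    · refine hle.trans ?_
      rw [pow_zero, mul_one]
      refine b1.trans (Real.exp_le_exp.2 ?_)
      linarith
    all_goals
      refine (norm_cutPropagator_apply_le h4 (norm_propagatorSymbol_le hα hT him hz) u).trans ?_
      refine mul_le_mul_of_nonneg_right ?_ (norm_nonneg _)
      exact mul_le_mul_of_nonneg_right (by linarith) hv
  · set c := (Real.exp (R * T) * T + (R + 2) * (Real.exp (R * T) * T ^ 2)) * v₀
    have hc : 0 ≤ c := by positivity
    have hle := norm_det_schurComplement_le hQ ha hc
      (sphereMoments L M (momentum w) ∘ₗ (potentialOp V : L2 →ₗ[ℂ] L2)) (spherePolynomials M)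
      (fun u => sphereMoments_mem L M _ _) (finrank_momentSpace_le L M)
      (finrank_spherePolynomials_le M) (fun u hu => ?_) (fun u => ?_)
    · refine hle.trans ?_
      have hcR : 1 + 2 * c ≤ Real.exp (c₁ * R) := by
        have e1 : c ≤ (T + 3 * T ^ 2) * v₀ * Real.exp ((T + 1) * R) := by
          have e2 : Real.exp ((T + 1) * R) = Real.exp (R * T) * Real.exp R := by
            rw [← Real.exp_add]
            congr 1
            ring
          have e3 : R + 1 ≤ Real.exp R := Real.add_one_le_exp R
          rw [e2]
          calc c ≤ (Real.exp (R * T) * (T * Real.exp R)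
                + (3 * Real.exp R) * (Real.exp (R * T) * T ^ 2)) * v₀ := by
                simp only [c]
                gcongr
                · exact le_mul_of_one_le_right hT (by linarith)
                · linarith
            _ = _ := by ring
        have e4 : 1 ≤ Real.exp ((T + 1) * R) := Real.one_le_exp (by positivity)
        have e5 : 1 + 2 * ((T + 3 * T ^ 2) * v₀) ≤ Real.exp (2 * ((T + 3 * T ^ 2) * v₀) * R) := by
          have := Real.add_one_le_exp (2 * ((T + 3 * T ^ 2) * v₀) * R)
          have h9 : 2 * ((T + 3 * T ^ 2) * v₀) ≤ 2 * ((T + 3 * T ^ 2) * v₀) * R :=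
            le_mul_of_one_le_right (by positivity) hR
          linarith
        calc 1 + 2 * c ≤ (1 + 2 * ((T + 3 * T ^ 2) * v₀)) * Real.exp ((T + 1) * R) := by nlinarith
          _ ≤ Real.exp (2 * ((T + 3 * T ^ 2) * v₀) * R) * Real.exp ((T + 1) * R) := by gcongr
          _ = Real.exp (c₁ * R) := by
            rw [← Real.exp_add]
            congr 1
            simp only [c₁]
            ring
      have b2 : (1 + 2 * c) ^ (8 * M ^ 2) ≤ Real.exp (8 * c₁ * (A + 1) ^ 2 * R ^ 3) := by
        refine (pow_le_pow_left₀ (by positivity) hcR _).trans ?_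
        rw [← Real.exp_nat_mul]
        refine Real.exp_le_exp.2 ?_
        push_cast
        have := mul_le_mul_of_nonneg_left hM22 hc₁
        linarith
      refine (mul_le_mul b1 b2 (by positivity) (Real.exp_pos _).le).trans ?_
      rw [← Real.exp_add]
      exact Real.exp_le_exp.2 (by linarith)
    · refine (norm_cutPropagator_le_of_moments hα hV hL hVL hwR hz him hu).trans ?_
      refine mul_le_mul_of_nonneg_right ?_ (norm_nonneg _)
      exact mul_le_mul_of_nonneg_right (by linarith) hv
    · refine (norm_cutPropagator_apply_le (C := Real.exp (R * T) * T
        + (R + 2) * (Real.exp (R * T) * T ^ 2)) (by positivity) (fun ξ => ?_) u).trans le_rfl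
      refine (norm_propagatorSymbol_le_exp hα hT _ _ ξ).trans ?_
      have hzR : 1 + ‖spectralParam w‖ ≤ R + 2 := by linarith
      gcongr

end UniformConstants

/-! ### Points on the imaginary axis where `K` is small -/

section Centers

variable {α : Fin 4 → Matrix (Fin 4) (Fin 4) ℂ} {V : Space → Matrix (Fin 4) (Fin 4) ℂ}

theorem momentum_I_mul (t : ℝ) : momentum (Complex.I * t) = Complex.I * ((t + t⁻¹) / 2 : ℝ) := by
  unfold momentum
  rw [mul_inv, Complex.inv_I]
  push_cast
  ring

theorem norm_propagatorSymbol_le_of_momentum (hα : IsDiracMatrices α) {T : ℝ} (hT : 0 ≤ T) {y : ℝ}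
    (hy : 1 ≤ y) {z : ℂ} (hz : ‖z‖ ≤ y + 1) (ξ : Space) :
    ‖propagatorSymbol α T (Complex.I * y) z ξ‖ ≤ 12 / y := by
  have hy0 : 0 < y := by linarith
  have him : (Complex.I * (y : ℂ)).im = y := by simp
  have hn : ‖Complex.I * (y : ℂ)‖ = y := by simp [abs_of_pos hy0]
  obtain ⟨h1, h2⟩ := norm_profileSymbol_le_of_norm_eq_im hT (κ := Complex.I * y) (by rwa [him])
    (by rw [him, hn]) (freq_nonneg ξ)
  rw [him] at h1 h2
  refine (norm_smul_shiftedSymbol_le hα h2 h1).trans ?_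
  have h3 : (1 + ‖z‖) * (3 / y ^ 2) ≤ (3 * y) * (3 / y ^ 2) := by
    gcongr
    linarith
  refine (add_le_add_right h3 _).trans (le_of_eq ?_)
  field_simp
  norm_num

/-- Points on the positive imaginary axis, far from the unit circle. -/
theorem exists_center (hα : IsDiracMatrices α) (V : Space → Matrix (Fin 4) (Fin 4) ℂ) {L : ℝ}
    (hL : 0 ≤ L) : ∃ s₀ : ℝ, 2 ≤ s₀ ∧ ∀ t : ℝ, 0 < t → s₀ ≤ t + t⁻¹ →
      ‖birmanOp α V L (Complex.I * t)‖ ≤ 1 / 2 ∧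
      ‖potentialOp V * freeResolvent α (Complex.I * t)‖ < 1 := by
  set v₀ := ‖potentialOp V‖
  have hv : 0 ≤ v₀ := norm_nonneg _
  -- Here `κ = iy` with `y = (t + 1/t)/2`, and `12 v₀ / y ≤ 1/2` requires `y ≥ 24 v₀`; the extra `2`
  -- ensures `y ≥ 1`.
  refine ⟨48 * v₀ + 2, by linarith, fun t ht hts => ?_⟩
  set y := (t + t⁻¹) / 2 with hy
  have hy1 : 24 * v₀ + 1 ≤ y := by linarith
  have hy0 : 0 < y := by linarith
  have him : (Complex.I * (y : ℂ)).im = y := by simp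
  have hn : ‖Complex.I * (y : ℂ)‖ = y := by simp [abs_of_pos hy0]
  have hw : 0 < (Complex.I * (t : ℂ)).im := by simpa using ht
  have hz : ‖spectralParam (Complex.I * t)‖ ≤ y + 1 := by
    have := norm_spectralParam_le (ne_zero_of_im_pos hw)
    rwa [momentum_I_mul, hn] at this
  have h12 : 12 / y * v₀ ≤ 1 / 2 := by
    rw [div_mul_eq_mul_div, div_le_iff₀ hy0]
    linarith
  constructor
  · refine ContinuousLinearMap.opNorm_le_bound _ (by norm_num) fun u => ?_
    refine (norm_cutPropagator_apply_le (C := 12 / y) (by positivity) (fun ξ => ?_) u).trans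
      (mul_le_mul_of_nonneg_right h12 (norm_nonneg _))
    rw [momentum_I_mul]
    exact norm_propagatorSymbol_le_of_momentum hα (by linarith) (by linarith) hz ξ
  · have h1 : ‖freeResolvent α (Complex.I * t)‖ ≤ 12 / y := by
      refine ContinuousLinearMap.opNorm_le_bound _ (by positivity) fun u => ?_
      refine norm_fourierOp_apply_le (continuous_freeSymbol hw).stronglyMeasurable (fun ξ => ?_) u
      refine (norm_freeSymbol_le hα hw ξ).trans ?_
      rw [momentum_I_mul, him]
      have h3 : (1 + ‖spectralParam (Complex.I * t)‖) * (1 / y ^ 2) ≤ (3 * y) * (1 / y ^ 2) := by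
        gcongr
        linarith
      refine (add_le_add_right h3 _).trans ?_
      have e : 1 / y + 3 * y * (1 / y ^ 2) = 4 / y := by
        field_simp
        norm_num
      rw [e]
      gcongr
      norm_num
    calc ‖potentialOp V * freeResolvent α (Complex.I * t)‖ ≤ v₀ * (12 / y) :=
          (norm_mul_le _ _).trans (mul_le_mul_of_nonneg_left h1 hv)
      _ ≤ 1 / 2 := by rwa [mul_comm]
      _ < 1 := by norm_num

theorem exists_inverse_of_norm_le_half {H : Type} [NormedAddCommGroup H] [InnerProductSpace ℂ H]
    [CompleteSpace H] {K : H →L[ℂ] H} (hK : ‖K‖ ≤ 1 / 2) :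
    ∃ M : H →L[ℂ] H, M * (1 + K) = 1 ∧ ∀ x, ‖M x‖ ≤ 2 * ‖x‖ := by
  have hu : IsUnit (1 + K) := by
    have := isUnit_one_sub_of_norm_lt_one (x := -K) (by rw [norm_neg]; linarith)
    rwa [sub_neg_eq_add] at this
  obtain ⟨u, hu⟩ := hu
  refine ⟨(u⁻¹ : (H →L[ℂ] H)ˣ), by rw [← hu]; exact u.inv_mul, fun x => ?_⟩
  have h1 : (1 + K) * ((u⁻¹ : (H →L[ℂ] H)ˣ) : H →L[ℂ] H) = 1 := by rw [← hu]; exact u.mul_inv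
  set y := ((u⁻¹ : (H →L[ℂ] H)ˣ) : H →L[ℂ] H) x
  have h2 : y + K y = x := congrArg (fun A : H →L[ℂ] H => A x) h1
  have h3 : ‖K y‖ ≤ 1 / 2 * ‖y‖ :=
    (K.le_opNorm y).trans (mul_le_mul_of_nonneg_right hK (norm_nonneg _))
  have h4 : ‖y‖ ≤ ‖x‖ + ‖K y‖ := by
    have : y = x - K y := eq_sub_of_add_eq h2
    calc ‖y‖ = ‖x - K y‖ := by rw [← this]
      _ ≤ _ := norm_sub_le _ _
  linarith

theorem one_le_norm_birmanDet {L : ℝ} {M : ℕ} {w : ℂ}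
    (hQ : ‖residualPart (birmanOp α V L w) (momentSpace L M)‖ ≤ 1 / 2)
    (hK : ‖birmanOp α V L w‖ ≤ 1 / 2) : 1 ≤ ‖birmanDet α V L M w‖ * 3 ^ (4 * M ^ 3) := by
  obtain ⟨B, hB, hb⟩ := exists_inverse_of_norm_le_half hK
  -- The inverse of `1 + K` has norm at most `2`, so the base is `3/2 · 2 = 3`.
  have := one_le_norm_det_schurComplement hQ (finrank_momentSpace_le L M) hB hb (by norm_num)
  norm_num at this
  exact this

end Centers

end DiracResonance

end

noncomputable section

namespace DiracResonance

/-! ### Zeros of the determinant in one annulus -/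

section ZeroCounting

variable {α : Fin 4 → Matrix (Fin 4) (Fin 4) ℂ} {V : Space → Matrix (Fin 4) (Fin 4) ℂ}

theorem norm_momentum_le (w : ℂ) : ‖momentum w‖ ≤ (‖w‖ + ‖w‖⁻¹) / 2 := by
  unfold momentum
  rw [norm_div, ← norm_inv, show ‖(2 : ℂ)‖ = 2 by simp]
  gcongr
  exact norm_sub_le _ _

theorem analyticAt_birmanDet (hα : IsDiracMatrices α) {L : ℝ} (hL : 0 ≤ L) {M : ℕ} {w : ℂ}
    (hw : w ≠ 0) (hQ : ‖residualPart (birmanOp α V L w) (momentSpace L M)‖ ≤ 1 / 2) :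
    AnalyticAt ℂ (birmanDet α V L M) w :=
  analyticAt_det (analyticAt_schurComplement (analyticAt_birmanOp hα hL hw) hQ)

/-- The zeros of the determinant in an annulus. -/
theorem exists_sum_order_le (hα : IsDiracMatrices α) (hV : IsPotential V) {L : ℝ} (hL : 0 ≤ L)
    (hVL : PotentialIn V L) : ∃ C s₀ : ℝ, 0 < C ∧ 2 ≤ s₀ ∧
      (∀ t : ℝ, 0 < t → s₀ ≤ t + t⁻¹ →
        ∃ R, IsResolvent α V (spectralParam (Complex.I * t)) R) ∧
      ∀ t : ℝ, 0 < t → s₀ ≤ t + t⁻¹ → ∃ M : ℕ, ∀ s : Finset ℂ,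
        (∀ w ∈ s, t / s₀ ≤ ‖w‖ ∧ ‖w‖ ≤ t * s₀) →
        (∀ w ∈ s, (∀ᶠ z in 𝓝 w, ‖residualPart (birmanOp α V L z) (momentSpace L M)‖ ≤ 1 / 2) ∧
          analyticOrderAt (birmanDet α V L M) w ≠ ⊤) ∧
        ∑ w ∈ s, ((analyticOrderAt (birmanDet α V L M) w).toNat : ℝ) ≤ C * (t + t⁻¹) ^ 3 := by
  obtain ⟨C, hC, h⟩ := exists_birmanDet_le hα hV hL hVL
  obtain ⟨s₀, hs₀, hcen⟩ := exists_center hα V hL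
  have hs0 : 0 < s₀ := by linarith
  set T := Real.log s₀
  have hT : 0 < T := Real.log_pos (by linarith)
  have hexpT : Real.exp T = s₀ := Real.exp_log hs0
  -- The logarithmic half-width of the annulus on which the determinant must be bounded, dictated by
  -- the doubled disc in the variable `log w`.
  set τ := 2 * (T + Real.pi)
  have hτ : 0 < τ := by
    have := Real.pi_pos
    positivity
  refine ⟨6 * C * Real.exp τ ^ 3, s₀, by positivity, hs₀, fun t ht hts => ?_, fun t ht hts => ?_⟩
  · exact exists_isResolvent hα hV (by simpa using ht) (hcen t ht hts).2
  have hti : 0 < t⁻¹ := inv_pos.2 ht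
  set σ := t + t⁻¹
  have hexp1 : 1 ≤ Real.exp τ := Real.one_le_exp hτ.le
  have hR : 1 ≤ Real.exp τ * σ := by nlinarith
  -- `e^τ (t + 1/t)` dominates `|κ|` on the larger annulus. The degree `M` depends on `t`, so each
  -- annulus has its own determinant.
  obtain ⟨M, hM, hdet⟩ := h (Real.exp τ * σ) hR
  refine ⟨M, fun s hs => ?_⟩
  set c : ℂ := Complex.I * t
  have hcn : ‖c‖ = t := by simp [c, abs_of_pos ht]
  have hann : ∀ w : ℂ, t * Real.exp (-τ) ≤ ‖w‖ → ‖w‖ ≤ t * Real.exp τ →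
      w ≠ 0 ∧ ‖momentum w‖ < Real.exp τ * σ := by
    intro w h1 h2
    have hw : 0 < ‖w‖ := lt_of_lt_of_le (by positivity) h1
    refine ⟨norm_pos_iff.1 hw, (norm_momentum_le w).trans_lt ?_⟩
    have h3 : ‖w‖⁻¹ ≤ t⁻¹ * Real.exp τ := by
      have := inv_anti₀ (by positivity) h1
      rwa [mul_inv, Real.exp_neg, inv_inv] at this
    have h4 : 0 < Real.exp τ * σ := by positivity
    have h5 : ‖w‖ + ‖w‖⁻¹ ≤ Real.exp τ * σ := by
      calc ‖w‖ + ‖w‖⁻¹ ≤ t * Real.exp τ + t⁻¹ * Real.exp τ := add_le_add h2 h3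
        _ = _ := by ring
    linarith
  have hcan : t * Real.exp (-τ) ≤ ‖c‖ ∧ ‖c‖ ≤ t * Real.exp τ := by
    rw [hcn]
    exact ⟨mul_le_of_le_one_right ht.le (Real.exp_le_one_iff.2 (by linarith)),
      le_mul_of_one_le_right ht.le hexp1⟩
  obtain ⟨hc0, hcm⟩ := hann c hcan.1 hcan.2
  obtain ⟨hcQ, hcd⟩ := hdet c hc0 hcm.le
  have hone := one_le_norm_birmanDet hcQ (hcen t ht hts).1
  have hfc : birmanDet α V L M c ≠ 0 := by
    intro h0
    rw [h0, norm_zero, zero_mul] at hone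
    linarith
  have hkey := sum_analyticOrderAt_annulus_le (f := birmanDet α V L M) (c := c) (T := T)
    (M := Real.exp (C * (Real.exp τ * σ) ^ 3)) hc0 hT (Real.one_le_exp (by positivity))
    (fun w h1 h2 => by
      rw [hcn] at h1 h2
      obtain ⟨hw, hm⟩ := hann w h1 h2
      obtain ⟨hQ, hd⟩ := hdet w hw hm.le
      exact ⟨analyticAt_birmanDet hα hL hw hQ, hd⟩) hfc s
    (fun w hw => by
      rw [hcn, Real.exp_neg, hexpT, ← div_eq_mul_inv]
      exact hs w hw)
  refine ⟨fun w hw => ⟨?_, hkey.1 w hw⟩, hkey.2.trans ?_⟩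
  · obtain ⟨h1, h2⟩ := hs w hw
    have h3 : s₀ ≤ Real.exp τ := by
      rw [← hexpT]
      refine Real.exp_le_exp.2 ?_
      simp only [τ]
      linarith [Real.pi_pos]
    obtain ⟨hw0, hm⟩ := hann w (le_trans (by
        rw [Real.exp_neg, ← div_eq_mul_inv]
        gcongr) h1) (h2.trans (by gcongr))
    filter_upwards [eventually_ne_nhds hw0,
      (analyticAt_momentum hw0).continuousAt.norm.eventually (Iio_mem_nhds hm)] with z hz hzm
    exact (hdet z hz hzm.le).1
  · have hfpos : 0 < ‖birmanDet α V L M c‖ := norm_pos_iff.2 hfc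
    have hlog2 : 1 / 2 ≤ Real.log 2 := by linarith [Real.log_two_gt_d9]
    rw [Real.log_div (Real.exp_pos _).ne' hfpos.ne', Real.log_exp, div_le_iff₀ (by linarith)]
    have h1 := Real.log_le_log one_pos hone
    rw [Real.log_one, Real.log_mul hfpos.ne' (by positivity), Real.log_pow] at h1
    have h2 : Real.log 3 ≤ 2 := by
      have := Real.log_le_sub_one_of_pos (show (0 : ℝ) < 3 by norm_num)
      linarith
    -- The loss at the centre is at most twice the upper exponent `C (e^τ σ)³`; three times that,
    -- divided by `log 2 ≥ 1/2`, gives the constant `6C`.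
    have h3 : ((4 * M ^ 3 : ℕ) : ℝ) * Real.log 3 ≤ C * (Real.exp τ * σ) ^ 3 * 2 := by
      push_cast
      exact mul_le_mul hM h2 (Real.log_nonneg (by norm_num)) (by positivity)
    calc C * (Real.exp τ * σ) ^ 3 - Real.log ‖birmanDet α V L M c‖
        ≤ 6 * C * Real.exp τ ^ 3 * σ ^ 3 * (1 / 2) := by
          rw [mul_pow] at h3 ⊢
          linarith
      _ ≤ _ := by gcongr

end ZeroCounting

/-! ### Polar parts and uniqueness of the continuation -/

section PolarParts

variable {α : Fin 4 → Matrix (Fin 4) (Fin 4) ℂ} {V : Space → Matrix (Fin 4) (Fin 4) ℂ}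

theorem smul_sub_comp_comp (c : ℂ) (X A I B : L2 →L[ℂ] L2) :
    c • (X - A ∘L I ∘L B) = c • X + A ∘L I ∘L (-c • B) := by
  ext1 u
  change c • (X u - A (I (B u))) = c • X u + A (I (-c • B u))
  rw [map_smul, map_smul, neg_smul, smul_sub, sub_eq_add_neg]

/-- The weight `a` is put into the right-hand factor, while `W` depends only on the left-hand factor
and the Schur complement; hence one `W` works for all weights. -/
theorem exists_polarIn_continuation (hα : IsDiracMatrices α) (χ : Cutoff V) {L L' : ℝ} (hL : 0 ≤ L)
    (hL' : 0 ≤ L') {M : ℕ} {w₀ : ℂ} (hw₀ : w₀ ≠ 0)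
    (hQ : ∀ᶠ z in 𝓝 w₀, ‖residualPart (birmanOp α V L z) (momentSpace L M)‖ ≤ 1 / 2)
    (ho : analyticOrderAt (birmanDet α V L M) w₀ ≠ ⊤) :
    ∃ W : Submodule ℂ L2, FiniteDimensional ℂ W ∧
      Module.finrank ℂ W ≤ (analyticOrderAt (birmanDet α V L M) w₀).toNat ∧
      ∀ a : ℂ → ℂ, AnalyticAt ℂ a w₀ → PolarIn (fun w => a w • continuation α V χ L L' w) w₀ W := by
  have hP := analyticAt_propagator hα (by linarith : 0 ≤ 2 * L' + 1) hw₀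
  obtain ⟨W, hW, hfin, h⟩ := exists_polarIn_of_schurComplement (analyticAt_birmanOp hα hL hw₀) hQ ho
    ((analyticAt_const (v := χ.mul)).mul hP |>.mul (analyticAt_const (v := potentialOp V)))
  refine ⟨W, hW, hfin, fun a ha => ?_⟩
  have h1 : PolarIn (fun w => a w • (χ.mul
      * propagator α (2 * L' + 1) (momentum w) (spectralParam w) * χ.mul)) w₀ W :=
    PolarIn.of_analyticAt (ha.smul ((analyticAt_const.mul hP).mul analyticAt_const))
  have h2 := h (fun w => (-a w) • (ballCut L
      * propagator α (2 * L' + 1) (momentum w) (spectralParam w) * χ.mul))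
    (ha.neg.smul ((analyticAt_const.mul hP).mul analyticAt_const))
  have h3 := h1.add h2
  rw [sup_idem] at h3
  refine h3.congr (Eventually.of_forall fun w => ?_)
  exact smul_sub_comp_comp (a w) _ _ _ _

/-- Two continuations agree up to isolated points. -/
theorem IsContinuation.eventuallyEq {χ : Cutoff V} {F G : ℂ → L2 →L[ℂ] L2}
    (hF : IsContinuation α V χ F) (hG : IsContinuation α V χ G) {t₀ : ℝ} (ht₀ : 0 < t₀)
    (hR : ∀ t : ℝ, t₀ ≤ t → ∃ R, IsResolvent α V (spectralParam (Complex.I * t)) R) {w : ℂ}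
    (hw : w ≠ 0) : F =ᶠ[𝓝[≠] w] G := by
  have hmer : MeromorphicOn (F - G) {w | w ≠ 0} := hF.1.sub hG.1
  have hzero : ∀ t : ℝ, t₀ ≤ t → (F - G) (Complex.I * t) = 0 := by
    intro t ht
    obtain ⟨R, hR⟩ := hR t ht
    have him : 0 < (Complex.I * (t : ℂ)).im := by simpa using ht₀.trans_le ht
    rw [Pi.sub_apply, hF.2 _ him R hR, hG.2 _ him R hR, sub_self]
  have hc0 : Complex.I * (t₀ : ℂ) ≠ 0 := by simp [ht₀.ne']
  -- The two functions agree on a ray of genuine resolvents accumulating at `it₀`, so their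
  -- difference vanishes near that point; connectedness of `ℂ \ {0}` carries this to every `w`.
  have htop : meromorphicOrderAt (F - G) (Complex.I * t₀) = ⊤ := by
    rw [meromorphicOrderAt_eq_top_iff]
    refine (hmer _ hc0).eventually_eq_zero_or_eventually_ne_zero.resolve_right fun hne => ?_
    have ht : Tendsto (fun t : ℝ => Complex.I * (t : ℂ)) (𝓝[>] t₀) (𝓝[≠] (Complex.I * t₀)) := by
      refine tendsto_nhdsWithin_iff.2 ⟨?_, ?_⟩
      · exact (Continuous.tendsto (by fun_prop) t₀).mono_left nhdsWithin_le_nhds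
      · filter_upwards [self_mem_nhdsWithin] with t ht h
        have h2 : (t : ℂ) = t₀ := mul_left_cancel₀ Complex.I_ne_zero h
        have h3 : t = t₀ := by exact_mod_cast h2
        exact (ne_of_gt ht) h3
    obtain ⟨t, h1, h2⟩ := ((ht.eventually hne).and self_mem_nhdsWithin).exists
    exact h1 (hzero t (le_of_lt h2))
  have hconn : IsPreconnected {w : ℂ | w ≠ 0} :=
    (isConnected_compl_singleton_of_one_lt_rank (by rw [Complex.rank_real_complex]; norm_num)
      (0 : ℂ)).isPreconnected
  have hw2 : meromorphicOrderAt (F - G) w = ⊤ := by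
    by_contra hne
    exact hmer.meromorphicOrderAt_ne_top_of_isPreconnected hconn hw hc0 hne htop
  rw [meromorphicOrderAt_eq_top_iff] at hw2
  filter_upwards [hw2] with z hz
  exact sub_eq_zero.1 hz

end PolarParts

/-! ### Dyadic shells in the coordinate `w` -/

section DyadicCounting

/-- The larger of `‖w‖` and `‖w‖⁻¹`. -/
def outerRadius (w : ℂ) : ℝ := max ‖w‖ ‖w‖⁻¹

theorem one_le_outerRadius {w : ℂ} (hw : w ≠ 0) : 1 ≤ outerRadius w := by
  rcases le_total 1 ‖w‖ with h | h
  · exact h.trans (le_max_left _ _)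
  · exact ((one_le_inv₀ (norm_pos_iff.2 hw)).2 h).trans (le_max_right _ _)

theorem outerRadius_le {w : ℂ} (hw : w ≠ 0) {r : ℝ} (hr : 1 ≤ r) (h : ‖spectralParam w‖ ≤ r) :
    outerRadius w ≤ 3 * r := by
  have h1 : ‖w + w⁻¹‖ ≤ 2 * r := by
    unfold spectralParam at h
    rw [norm_div, show ‖(2 : ℂ)‖ = 2 by simp, div_le_iff₀ two_pos] at h
    linarith
  have h2 : ‖w‖ ≤ ‖w + w⁻¹‖ + ‖w‖⁻¹ := by
    rw [← norm_inv]
    have := norm_sub_le (w + w⁻¹) w⁻¹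
    rwa [add_sub_cancel_right] at this
  have h3 : ‖w‖⁻¹ ≤ ‖w + w⁻¹‖ + ‖w‖ := by
    rw [← norm_inv]
    have := norm_sub_le (w + w⁻¹) w
    rwa [add_sub_cancel_left] at this
  have hp : 0 < ‖w‖ := norm_pos_iff.2 hw
  rcases le_total 1 ‖w‖ with h4 | h4
  · have h5 := (inv_le_one₀ hp).2 h4
    exact max_le (by linarith) (by linarith)
  · exact max_le (by linarith) (by linarith)

/-- The dyadic scale of a point. -/
def dyadicScale (w : ℂ) : ℕ := Nat.log 2 ⌊outerRadius w⌋₊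

theorem two_pow_dyadicScale_le {w : ℂ} (hw : w ≠ 0) : (2 : ℝ) ^ dyadicScale w ≤ outerRadius w := by
  have h1 := one_le_outerRadius hw
  have h2 : ⌊outerRadius w⌋₊ ≠ 0 := (Nat.floor_pos.2 h1).ne'
  have h3 : ((2 ^ dyadicScale w : ℕ) : ℝ) ≤ (⌊outerRadius w⌋₊ : ℝ) :=
    Nat.cast_le.2 (Nat.pow_log_le_self 2 h2)
  push_cast at h3
  exact h3.trans (Nat.floor_le (by linarith))

theorem outerRadius_lt (w : ℂ) : outerRadius w < 2 ^ (dyadicScale w + 1) := by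
  have h1 := Nat.lt_floor_add_one (outerRadius w)
  have h3 : ((⌊outerRadius w⌋₊ + 1 : ℕ) : ℝ) ≤ ((2 ^ (dyadicScale w + 1) : ℕ) : ℝ) :=
    Nat.cast_le.2 (Nat.lt_pow_succ_log_self one_lt_two _)
  push_cast at h3
  linarith

/-- The modulus of the centre of the annulus containing a dyadic shell. -/
def shellCenter (s₀ : ℝ) (p : ℕ × Bool) : ℝ := if p.2 then s₀ * 2 ^ p.1 else (s₀ * 2 ^ p.1)⁻¹

theorem shellCenter_pos {s₀ : ℝ} (hs₀ : 2 ≤ s₀) (p : ℕ × Bool) : 0 < shellCenter s₀ p := by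
  have : 0 < s₀ := by linarith
  unfold shellCenter
  split_ifs <;> positivity

theorem shellCenter_add_inv {s₀ : ℝ} (hs₀ : 2 ≤ s₀) (p : ℕ × Bool) :
    s₀ ≤ shellCenter s₀ p + (shellCenter s₀ p)⁻¹ ∧
    shellCenter s₀ p + (shellCenter s₀ p)⁻¹ ≤ 2 * s₀ * 2 ^ p.1 := by
  have h1 : (1 : ℝ) ≤ 2 ^ p.1 := one_le_pow₀ (by norm_num)
  have h2 : s₀ ≤ s₀ * 2 ^ p.1 := le_mul_of_one_le_right (by linarith) h1
  have h3 : 0 < (s₀ * 2 ^ p.1)⁻¹ := inv_pos.2 (by linarith)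
  have h4 : (s₀ * 2 ^ p.1)⁻¹ ≤ 1 := inv_le_one_of_one_le₀ (by linarith)
  unfold shellCenter
  split_ifs
  · exact ⟨by linarith, by linarith⟩
  · rw [inv_inv]
    exact ⟨by linarith, by linarith⟩

/-- The index of the dyadic shell of a point. -/
def shellIndex (w : ℂ) : ℕ × Bool := (dyadicScale w, decide (1 ≤ ‖w‖))

/-- The Boolean separates shells near `w = ∞` from those near `w = 0`. As `s₀² ≥ 4`, the annulus
about the centre is wider than a dyadic shell, although the centre is pushed outwards by `s₀` to
where `K` is small. -/
theorem mem_annulus_shellCenter {s₀ : ℝ} (hs₀ : 2 ≤ s₀) {w : ℂ} (hw : w ≠ 0) :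
    shellCenter s₀ (shellIndex w) / s₀ ≤ ‖w‖ ∧ ‖w‖ ≤ shellCenter s₀ (shellIndex w) * s₀ := by
  have hp : 0 < ‖w‖ := norm_pos_iff.2 hw
  have hs : 0 < s₀ := by linarith
  have hs2 : 4 ≤ s₀ * s₀ := by nlinarith
  have h1 := two_pow_dyadicScale_le hw
  have h2 := (outerRadius_lt w).le
  rw [pow_succ] at h2
  unfold shellCenter shellIndex
  set q : ℝ := 2 ^ dyadicScale w
  have hq : 0 < q := by positivity
  by_cases h : 1 ≤ ‖w‖
  · have h3 : outerRadius w = ‖w‖ := max_eq_left (((inv_le_one₀ hp).2 h).trans h)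
    rw [h3] at h1 h2
    simp only [h, decide_true, if_true]
    rw [mul_div_cancel_left₀ _ hs.ne']
    refine ⟨h1, h2.trans ?_⟩
    have := mul_le_mul_of_nonneg_right hs2 hq.le
    linarith
  · have h4 : 1 ≤ ‖w‖⁻¹ := (one_le_inv₀ hp).2 (not_le.1 h).le
    have h3 : outerRadius w = ‖w‖⁻¹ := max_eq_right ((not_le.1 h).le.trans h4)
    rw [h3] at h1 h2
    simp only [h, decide_false, Bool.false_eq_true, if_false]
    constructor
    · rw [div_le_iff₀ hs, inv_le_comm₀ (by positivity) (by positivity), mul_inv]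
      calc ‖w‖⁻¹ * s₀⁻¹ ≤ (q * 2) * s₀⁻¹ := by gcongr
        _ ≤ s₀ * q := by
          rw [← div_eq_mul_inv, div_le_iff₀ hs]
          have := mul_le_mul_of_nonneg_right hs2 hq.le
          linarith
    · rw [mul_inv, mul_right_comm, inv_mul_cancel₀ hs.ne', one_mul]
      rwa [le_inv_comm₀ hp hq]

theorem dyadicScale_le {w : ℂ} (hw : w ≠ 0) {r : ℝ} (hr : 1 ≤ r) (h : ‖spectralParam w‖ ≤ r) :
    dyadicScale w ≤ Nat.log 2 ⌊3 * r⌋₊ :=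
  Nat.log_mono_right (Nat.floor_le_floor (outerRadius_le hw hr h))

theorem sum_eight_pow_le {r : ℝ} (hr : 1 ≤ r) :
    ∑ j ∈ Finset.range (Nat.log 2 ⌊3 * r⌋₊ + 1), (8 : ℝ) ^ j ≤ 54 * r ^ 3 := by
  set J := Nat.log 2 ⌊3 * r⌋₊
  have h1 : (2 : ℝ) ^ J ≤ 3 * r := by
    have h2 : ⌊3 * r⌋₊ ≠ 0 := (Nat.floor_pos.2 (by linarith)).ne'
    have h3 : ((2 ^ J : ℕ) : ℝ) ≤ (⌊3 * r⌋₊ : ℝ) := Nat.cast_le.2 (Nat.pow_log_le_self 2 h2)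
    push_cast at h3
    exact h3.trans (Nat.floor_le (by linarith))
  have h2 : (8 : ℝ) ^ J ≤ 27 * r ^ 3 := by
    have := pow_le_pow_left₀ (by positivity) h1 3
    rw [← pow_mul, mul_comm J 3, pow_mul] at this
    norm_num at this
    linarith [mul_pow (3 : ℝ) r 3]
  rw [geom_sum_eq (by norm_num), pow_succ]
  rw [div_le_iff₀ (by norm_num)]
  have : 0 ≤ r ^ 3 := by positivity
  linarith

/-- Dyadic summation: a uniform cubic bound on shells gives a cubic bound for the count. -/
theorem tsum_le_of_shell_bound {m : ℂ → ℝ≥0∞} {P : ℂ → Prop} (hP : ∀ w, P w → w ≠ 0) {C : ℝ}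
    (hC : 0 ≤ C) (h : ∀ p : ℕ × Bool, ∀ s : Finset ℂ, (∀ w ∈ s, P w ∧ shellIndex w = p) →
      ∑ w ∈ s, m w ≤ ENNReal.ofReal (C * 8 ^ p.1)) {r : ℝ} (hr : 1 ≤ r) :
    ∑' w : {w : ℂ // P w ∧ ‖spectralParam w‖ ≤ r}, m w ≤ ENNReal.ofReal (108 * C * r ^ 3) := by
  classical
  rw [ENNReal.tsum_eq_iSup_sum]
  refine iSup_le fun s => ?_
  have e : ∑ w ∈ s, m w = ∑ w ∈ s.map (Function.Embedding.subtype _), m w := by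
    rw [Finset.sum_map]
    rfl
  rw [e]
  set s' : Finset ℂ := s.map (Function.Embedding.subtype _)
  have hs' : ∀ w ∈ s', P w ∧ ‖spectralParam w‖ ≤ r := by
    intro w hw
    obtain ⟨x, _, rfl⟩ := Finset.mem_map.1 hw
    exact x.2
  have hmaps : ∀ w ∈ s', shellIndex w ∈
      (Finset.range (Nat.log 2 ⌊3 * r⌋₊ + 1)) ×ˢ (Finset.univ : Finset Bool) := by
    intro w hw
    obtain ⟨h1, h2⟩ := hs' w hw
    refine Finset.mem_product.2 ⟨Finset.mem_range.2 ?_, Finset.mem_univ _⟩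
    exact Nat.lt_succ_of_le (dyadicScale_le (hP w h1) hr h2)
  rw [← Finset.sum_fiberwise_of_maps_to hmaps]
  calc ∑ p ∈ (Finset.range (Nat.log 2 ⌊3 * r⌋₊ + 1)) ×ˢ (Finset.univ : Finset Bool),
        ∑ w ∈ s' with shellIndex w = p, m w
      ≤ ∑ p ∈ (Finset.range (Nat.log 2 ⌊3 * r⌋₊ + 1)) ×ˢ (Finset.univ : Finset Bool),
        ENNReal.ofReal (C * 8 ^ p.1) := by
        refine Finset.sum_le_sum fun p _ => h p _ fun w hw => ?_
        obtain ⟨h1, h2⟩ := Finset.mem_filter.1 hw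
        exact ⟨(hs' w h1).1, h2⟩
    _ = ENNReal.ofReal (2 * C * ∑ j ∈ Finset.range (Nat.log 2 ⌊3 * r⌋₊ + 1), (8 : ℝ) ^ j) := by
        rw [← ENNReal.ofReal_sum_of_nonneg fun p _ => by positivity, Finset.sum_product]
        congr 1
        rw [Finset.mul_sum]
        refine Finset.sum_congr rfl fun j _ => ?_
        simp
        ring
    _ ≤ _ := by
        refine ENNReal.ofReal_le_ofReal ?_
        have := mul_le_mul_of_nonneg_left (sum_eight_pow_le hr) (show 0 ≤ 2 * C by positivity)
        linarith

end DyadicCounting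

/-! ### The counting bound -/

section CountingResonances

variable {α : Fin 4 → Matrix (Fin 4) (Fin 4) ℂ} {V : Space → Matrix (Fin 4) (Fin 4) ℂ}

/-- The radius `L`, the threshold `s₀` and the constant are fixed before `χ`, which enters only
through analytic outer factors. An arbitrary continuation agrees with the constructed one off
isolated points, hence has the same principal parts. -/
theorem exists_isContinuation_and_counting_le (hα : IsDiracMatrices α) (hV : IsPotential V) :
    ∃ C : ℝ, 0 < C ∧ ∀ χ : Cutoff V, (∃ F, IsContinuation α V χ F) ∧
      ∀ F, IsContinuation α V χ F → ∀ r : ℝ, 1 ≤ r →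
        countingFunction F r ≤ ENNReal.ofReal (C * r ^ 3) := by
  obtain ⟨L, hL, hVL⟩ := hV.exists_potentialIn
  obtain ⟨C, s₀, hC, hs₀, hres, hcount⟩ := exists_sum_order_le hα hV hL.le hVL
  have hs0 : 0 < s₀ := by linarith
  refine ⟨108 * (C * (2 * s₀) ^ 3), by positivity, fun χ => ?_⟩
  obtain ⟨L', hLL', hχ⟩ := χ.exists_radius L
  have hL' : 0 ≤ L' := hL.le.trans hLL'
  choose M hM using fun p : ℕ × Bool =>
    hcount (shellCenter s₀ p) (shellCenter_pos hs₀ p) (shellCenter_add_inv hs₀ p).1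
  -- Each point is measured by the determinant of its own shell, so that all points of one shell
  -- share a determinant when the multiplicities are summed.
  have hpolar : ∀ w : ℂ, w ≠ 0 → ∃ W : Submodule ℂ L2, FiniteDimensional ℂ W ∧
      Module.finrank ℂ W ≤ (analyticOrderAt (birmanDet α V L (M (shellIndex w))) w).toNat ∧
      ∀ a : ℂ → ℂ, AnalyticAt ℂ a w → PolarIn (fun z => a z • continuation α V χ L L' z) w W := by
    intro w hw
    obtain ⟨h1, h2⟩ := (hM (shellIndex w) {w} (fun z hz => by
      rw [Finset.mem_singleton.1 hz]
      exact mem_annulus_shellCenter hs₀ hw)).1 w (Finset.mem_singleton_self w)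
    exact exists_polarIn_continuation hα χ hL.le hL' hw h1 h2
  have hcont : IsContinuation α V χ (continuation α V χ L L') := by
    refine ⟨fun w hw => ?_, fun w hw R hR => continuation_eq hα hV χ hL.le hVL hLL' hχ hw hR⟩
    obtain ⟨W, _, _, h⟩ := hpolar w hw
    have := (h (fun _ => 1) analyticAt_const).meromorphicAt
    simpa only [one_smul] using this
  refine ⟨⟨_, hcont⟩, fun F hF r hr => ?_⟩
  have hmult : ∀ w : ℂ, w ≠ 0 → (multiplicity F w : ℝ≥0∞) ≤ ENNReal.ofReal
      ((analyticOrderAt (birmanDet α V L (M (shellIndex w))) w).toNat : ℝ) := by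
    intro w hw
    obtain ⟨W, hW, hfin, h⟩ := hpolar w hw
    have heq : F =ᶠ[𝓝[≠] w] continuation α V χ L L' :=
      hF.eventuallyEq hcont hs0 (fun t ht => hres t (hs0.trans_le ht)
        (ht.trans (le_add_of_nonneg_right (inv_nonneg.2 (hs0.le.trans ht))))) hw
    have h1 := multiplicity_le_finrank (F := F) hw (W := W) fun a ha => (h a ha).congr
      (heq.mono fun z hz => congrArg (a z • ·) hz)
    rw [ENNReal.ofReal_natCast]
    have h2 : multiplicity F w
        ≤ ((analyticOrderAt (birmanDet α V L (M (shellIndex w))) w).toNat : ℕ∞) :=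
      h1.trans (by exact_mod_cast hfin)
    have h3 := ENat.toENNReal_mono h2
    rwa [ENat.toENNReal_coe] at h3
  refine tsum_le_of_shell_bound (m := fun w => (multiplicity F w : ℝ≥0∞))
    (P := fun w => IsResonance F w) (C := C * (2 * s₀) ^ 3) (fun w hw => hw.1) (by positivity)
    (fun p s hs => ?_) hr
  have hann : ∀ w ∈ s, shellCenter s₀ p / s₀ ≤ ‖w‖ ∧ ‖w‖ ≤ shellCenter s₀ p * s₀ := by
    intro w hw
    obtain ⟨h1, h2⟩ := hs w hw
    rw [← h2]
    exact mem_annulus_shellCenter hs₀ h1.1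
  calc ∑ w ∈ s, (multiplicity F w : ℝ≥0∞)
      ≤ ∑ w ∈ s, ENNReal.ofReal
        ((analyticOrderAt (birmanDet α V L (M p)) w).toNat : ℝ) := by
        refine Finset.sum_le_sum fun w hw => ?_
        obtain ⟨h1, h2⟩ := hs w hw
        have := hmult w h1.1
        rwa [h2] at this
    _ = ENNReal.ofReal (∑ w ∈ s, ((analyticOrderAt (birmanDet α V L (M p)) w).toNat : ℝ)) :=
        (ENNReal.ofReal_sum_of_nonneg fun w _ => Nat.cast_nonneg _).symm
    _ ≤ _ := by
        refine ENNReal.ofReal_le_ofReal ((hM p s hann).2.trans ?_)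
        have h3 := shellCenter_pos hs₀ p
        have h4 := pow_le_pow_left₀ (by positivity) (shellCenter_add_inv hs₀ p).2 3
        have h5 : (2 * s₀ * 2 ^ p.1) ^ 3 = (2 * s₀) ^ 3 * 8 ^ p.1 := by
          rw [mul_pow, ← pow_mul, mul_comm p.1 3, pow_mul]
          norm_num
        rw [h5] at h4
        calc C * (shellCenter s₀ p + (shellCenter s₀ p)⁻¹) ^ 3
            ≤ C * ((2 * s₀) ^ 3 * 8 ^ p.1) := mul_le_mul_of_nonneg_left h4 hC.le
          _ = _ := by ring

end CountingResonances

end DiracResonance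

end

theorem mainTheorem2 (α : Fin 4 → Matrix (Fin 4) (Fin 4) ℂ)
    (hα : DiracResonance.IsDiracMatrices α)
    (V : DiracResonance.Space → Matrix (Fin 4) (Fin 4) ℂ)
    (hV : DiracResonance.IsPotential V) :
    ∃ C : ℝ, 0 < C ∧ ∀ χ : DiracResonance.Cutoff V,
      (∃ F, DiracResonance.IsContinuation α V χ F) ∧
      ∀ F, DiracResonance.IsContinuation α V χ F → ∀ r : ℝ, 1 ≤ r →
        DiracResonance.countingFunction F r ≤ ENNReal.ofReal (C * r ^ 3) :=
  DiracResonance.exists_isContinuation_and_counting_le hα hV
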